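/- **Setting.** Let $\mathbb K$ be $\mathbb R$ or $\mathbb C$. For a finite set $M$ let $L_p^M$ be the space of functions $f:M\to\mathbb K$ with norm $\big(\frac1{|M|}\sum_{i\in M}|f(i)|^p\big)^{1/p}$ if $p<\infty$ and $\max_{i\in M}|f(i)|$ if $p=\infty$. For $N_1,N_2\in\mathbb N=\{1,2,\dots\}$ write $L_q^{N_1}$ and $L_p^{N_1,N_2}$ for $M=\{1,\dots,N_1\}$ and $M=\{1,\dots,N_1\}\times\{1,\dots,N_2\}$, and let $B$ be the closed unit ball of $L_p^{N_1,N_2}$. Consider vector-valued mean computation $$S^{N_1,N_2}:B\to L_q^{N_1},\qquad (S^{N_1,N_2}f)(i)=\frac1{N_2}\sum_{j=1}^{N_2}f(i,j),$$ with information consisting of function values $\delta_{ij}(f)=f(i,j)$. A deterministic algorithm $A$ consists of maps $L_{i+1}:\mathbb K^i\to\{\delta_{kl}\}$, $\tau_i:\mathbb K^i\to\{0,1\}$, $\varphi_i:\mathbb K^i\to L_q^{N_1}$ $(i\ge0)$. On the input $f$ it obtains successively the values $y_{i+1}=\big(L_{i+1}(y_1,\dots,y_i)\big)(f)$. Its cardinality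 $\mathrm{card}(A,f)$ is the first $n\ge0$ with $\tau_n(y_1,\dots,y_n)=1$ ($\infty$ if there is none), and its output $A(f)$ is $\varphi_n(y_1,\dots,y_n)$ for this $n$ ($\varphi_0$ if there is none). It is non-adaptive if all $L_i$ and $\tau_i$ are constant. A randomized algorithm is a probability space together with a family $(A_\omega)$ of deterministic algorithms such that for each $f\in B$ the map $\omega\mapsto\mathrm{card}(A_\omega,f)$ is measurable and $\omega\mapsto A_\omega(f)$ is Borel measurable and almost surely separably valued; it is non-adaptive if every $A_\omega$ is. The randomized $n$-th minimal error $e_n^{\rm ran}(S^{N_1,N_2})$ is the infimum of $\sup_{f\in B}\mathbb E\|S^{N_1,N_2}f-A_\omega(f)\|_{L_q^{N_1}}$ over all randomized algorithms with $\sup_{f\in B}\mathbb E\,\mathrm{card}(A_\omega,f)\le n$, and $e_n^{\rm ran\text{-}non}(S^{N_1,N_2})$ is the corresponding infimum over non-adaptive randomized algorithms. For $0<c_0<1$ put $$\gamma(p,q,n)=\sup_{N_1,N_2\in\mathbb N:\;N_1\le n<c_0N_1N_2}\frac{e_n^{\rm ran\text{-}non}(S^{N_1,N_2})}{e_n^{\rm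 ran}(S^{N_1,N_2})},\qquad \kappa(p,q)=\frac{\left(\frac12-\frac1p\right)\left(\frac1p-\frac1q\right)}{\frac12-\frac1q}.$$ **Corollary.** Let $2<p<q\le\infty$ (with $1/\infty=0$). (i) There is $\bar c\in(0,1)$ such that for every $c_0\in(0,\bar c]$ there are constants $c_1,c_2>0$ such that for all $n\in\mathbb N$ $$c_1\,n^{\kappa(p,q)}\,(\log_2(n+1))^{-(1-1/p)}\;\le\;\gamma(p,q,n)\;\le\;c_2\,n^{\kappa(p,q)}.$$ (ii) $0<\kappa(p,q)\le\frac18$, with $\kappa(p,q)=\frac18$ if and only if $p=4$ and $q=\infty$. (iii) For every $C>0$ there are $n,N_1,N_2\in\mathbb N$ such that the problem $S^{N_1,N_2}$ is linear (the input set is a convex balanced subset of a linear space $X$ over $\mathbb K$, and the solution operator and the information functionals are restrictions of linear maps on $X$) and $$e_n^{\rm ran\text{-}non}(S^{N_1,N_2})>C\,e_n^{\rm ran}(S^{N_1,N_2}).$$ Hence there is no constant $c>0$ such that $e_n^{\rm ran\text{-}non}\le c\,e_n^{\rm ran}$ for all linear problems and all $n\in\mathbb N$. -/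

import Mathlib

open scoped ENNReal

noncomputable section

/-! ### Information-based complexity: problems, algorithms, minimal errors -/

/-- An abstract numerical problem `(F, G, S, K, Λ)`: the input set is (the type) `F`, the target
space is the normed space `G`, `S` is the solution operator, and `Λ` is the set of information
functionals, i.e. of admissible maps `F → K`. -/
structure NumericalProblem (F G K : Type) where
  /-- the solution operator -/
  S : F → G
  /-- the set of information functionals -/
  Λ : Set (F → K)

/-- A problem over the scalar field `𝕜` is linear if `K = 𝕜`, the input set is a (nonempty) convex
balanced subset of a linear space `X` over `𝕜`, and the solution operator (with values in a Banach
space) and all information functionals are restrictions of linear maps defined on `X`. -/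
def NumericalProblem.IsLinear (𝕜 : Type) [RCLike 𝕜] {X G : Type} [AddCommGroup X] [Module 𝕜 X]
    [NormedAddCommGroup G] [NormedSpace 𝕜 G] [CompleteSpace G] {F : Set X}
    (P : NumericalProblem F G 𝕜) : Prop :=
  F.Nonempty ∧ P.Λ.Nonempty ∧ Balanced 𝕜 F ∧
  (∀ f ∈ F, ∀ g ∈ F, ∀ a b : ℝ, 0 ≤ a → 0 ≤ b → a + b = 1 → (a : 𝕜) • f + (b : 𝕜) • g ∈ F) ∧
  (∃ T : X →ₗ[𝕜] G, ∀ f : F, P.S f = T f) ∧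
  (∀ l ∈ P.Λ, ∃ φ : X →ₗ[𝕜] 𝕜, ∀ f : F, l f = φ f)

/-- A deterministic (in general adaptive) algorithm. After `i` values `y : Fin i → K` of information
have been obtained, `L i y` is the next information functional, `τ i y` tells whether to stop
(`true`) or to go on (`false`), and `φ i y` is the output in case of stopping. Since `Fin 0 → K`
has exactly one element, `L 0`, `τ 0`, `φ 0` are just an element of `Λ`, of `{0,1}` and of `G`. -/
structure DetAlg {F G K : Type} (P : NumericalProblem F G K) where
  L : (i : ℕ) → (Fin i → K) → P.Λ
  τ : (i : ℕ) → (Fin i → K) → Bool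
  φ : (i : ℕ) → (Fin i → K) → G

namespace DetAlg

variable {F G K : Type} {P : NumericalProblem F G K}

/-- The first `i` values of information on the input `f` obtained by the algorithm. -/
def info (A : DetAlg P) (f : F) : (i : ℕ) → (Fin i → K)
  | 0 => Fin.elim0
  | i + 1 => Fin.snoc (α := fun _ => K) (info A f i) ((A.L i (info A f i)).1 f)

/-- The cardinality of the algorithm at input `f`: the first `n ≥ 0` at which it stops, and `∞` if
it never stops. -/
def card (A : DetAlg P) (f : F) : ℕ∞ :=
  ⨅ (n : ℕ) (_ : A.τ n (A.info f n) = true), (n : ℕ∞)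

/-- The output at input `f`. As `ENat.toNat ⊤ = 0`, the output is `φ 0` if the algorithm never
stops. -/
def out (A : DetAlg P) (f : F) : G :=
  A.φ (A.card f).toNat (A.info f (A.card f).toNat)

/-- An algorithm is non-adaptive if all `L i` and all `τ i` are constant maps. -/
def NonAdaptive (A : DetAlg P) : Prop :=
  ∀ (i : ℕ) (y z : Fin i → K), A.L i y = A.L i z ∧ A.τ i y = A.τ i z

end DetAlg

/-- A randomized algorithm: a probability space `(Ω, ℙ)` and a family `(A_ω)` of deterministic
algorithms such that, for every input `f`, the cardinality `card (A_ω, f)` is a measurable function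
of `ω` and the output `A_ω(f)` is a Borel measurable, almost surely separably valued function
of `ω`. (The type of deterministic algorithms lies in `Type`, so transporting the σ-algebra and the
measure to it shows that there is no loss in taking `Ω : Type`.) -/
structure RanAlg {F G K : Type} [NormedAddCommGroup G] [MeasurableSpace G] [BorelSpace G]
    (P : NumericalProblem F G K) where
  Ω : Type
  mΩ : MeasurableSpace Ω
  ℙ : MeasureTheory.Measure Ω
  isProb : MeasureTheory.IsProbabilityMeasure ℙ
  alg : Ω → DetAlg P
  measurable_card : ∀ f : F, Measurable fun ω => (((alg ω).card f : ℕ∞) : ℝ≥0∞)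
  measurable_out : ∀ f : F, Measurable fun ω => (alg ω).out f
  separable_out : ∀ f : F, ∃ G₀ : Set G, TopologicalSpace.IsSeparable G₀ ∧
    ∀ᵐ ω ∂ℙ, (alg ω).out f ∈ G₀

namespace RanAlg

variable {F G K : Type} [NormedAddCommGroup G] [MeasurableSpace G] [BorelSpace G]
  {P : NumericalProblem F G K}

attribute [instance] RanAlg.mΩ RanAlg.isProb

/-- `card (A, F) = sup_f 𝔼 card (A_ω, f)`. -/
def card (A : RanAlg P) : ℝ≥0∞ :=
  ⨆ f : F, ∫⁻ ω, (((A.alg ω).card f : ℕ∞) : ℝ≥0∞) ∂A.ℙ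

/-- The error `sup_f 𝔼 ‖S f - A_ω f‖`. -/
def error (A : RanAlg P) : ℝ≥0∞ :=
  ⨆ f : F, ∫⁻ ω, ‖P.S f - (A.alg ω).out f‖ₑ ∂A.ℙ

/-- A randomized algorithm is non-adaptive if all `A_ω` are non-adaptive. -/
def NonAdaptive (A : RanAlg P) : Prop :=
  ∀ ω, (A.alg ω).NonAdaptive

end RanAlg

namespace NumericalProblem

variable {F G K : Type} [NormedAddCommGroup G] [MeasurableSpace G] [BorelSpace G]

/-- The (adaptive) randomized `n`-th minimal error. -/
def eRan (P : NumericalProblem F G K) (n : ℕ) : ℝ≥0∞ :=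
  ⨅ (A : RanAlg P) (_ : A.card ≤ n), A.error

/-- The non-adaptive randomized `n`-th minimal error. -/
def eRanNon (P : NumericalProblem F G K) (n : ℕ) : ℝ≥0∞ :=
  ⨅ (A : RanAlg P) (_ : A.NonAdaptive) (_ : A.card ≤ n), A.error

end NumericalProblem

/-! ### The spaces `L_p^M` -/

/-- `L_p^M`: the space of functions `M → 𝕜` on the finite set `M`, with the norm
`(|M|⁻¹ ∑ |f i|^p)^(1/p)` for `p < ∞` and `max |f i|` for `p = ∞`. -/
def LSpace (𝕜 : Type) (_p : ℝ≥0∞) (M : Type) : Type := M → 𝕜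

namespace LSpace

variable {𝕜 : Type} [RCLike 𝕜] {p : ℝ≥0∞} {M : Type}

instance : AddCommGroup (LSpace 𝕜 p M) := inferInstanceAs (AddCommGroup (M → 𝕜))

instance : Module 𝕜 (LSpace 𝕜 p M) := inferInstanceAs (Module 𝕜 (M → 𝕜))

variable [Fintype M]

instance : Norm (LSpace 𝕜 p M) where
  norm f := if p = ∞ then ⨆ i : M, ‖f i‖
    else ((Fintype.card M : ℝ)⁻¹ * ∑ i : M, ‖f i‖ ^ p.toReal) ^ (1 / p.toReal)

theorem norm_def (f : LSpace 𝕜 p M) : ‖f‖ = if p = ∞ then ⨆ i : M, ‖f i‖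
    else ((Fintype.card M : ℝ)⁻¹ * ∑ i : M, ‖f i‖ ^ p.toReal) ^ (1 / p.toReal) := rfl

/-- The ratio between the normalized norm and the usual (unnormalized) `ℓ_p` norm. -/
def scale (p : ℝ≥0∞) (M : Type) [Fintype M] : ℝ :=
  if p = ∞ then 1 else ((Fintype.card M : ℝ)⁻¹) ^ (1 / p.toReal)

theorem scale_nonneg : 0 ≤ scale p M := by
  unfold scale
  split_ifs <;> positivity

theorem scale_pos [Nonempty M] : 0 < scale p M := by
  unfold scale
  split_ifs
  · positivity
  · have : (0 : ℝ) < Fintype.card M := by exact_mod_cast Fintype.card_pos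
    positivity

/-- The identity map from `L_p^M` onto the usual (unnormalized) `ℓ_p` space. -/
def toPiLp : LSpace 𝕜 p M →ₗ[𝕜] PiLp p fun _ : M => 𝕜 where
  toFun f := WithLp.toLp p fun i => f i
  map_add' _ _ := rfl
  map_smul' _ _ := rfl

theorem norm_eq_scale [Fact (1 ≤ p)] (f : LSpace 𝕜 p M) : ‖f‖ = scale p M * ‖toPiLp f‖ := by
  rw [norm_def, scale]
  split_ifs with h
  · subst h
    rw [PiLp.norm_eq_ciSup, one_mul]
    rfl
  · have h1 : (1 : ℝ≥0∞) ≤ p := Fact.out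
    have hp : 0 < p.toReal := ENNReal.toReal_pos (fun h0 => by simp [h0] at h1) h
    rw [PiLp.norm_eq_sum hp, Real.mul_rpow (by positivity)
      (Finset.sum_nonneg fun i _ => by positivity)]
    rfl

theorem normCore [Fact (1 ≤ p)] : NormedSpace.Core 𝕜 (LSpace 𝕜 p M) where
  norm_nonneg f := by
    rw [norm_eq_scale]; exact mul_nonneg scale_nonneg (norm_nonneg _)
  norm_smul c f := by
    rw [norm_eq_scale, norm_eq_scale, map_smul, norm_smul]; ring
  norm_triangle f g := by
    rw [norm_eq_scale, norm_eq_scale, norm_eq_scale, map_add, ← mul_add]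
    exact mul_le_mul_of_nonneg_left (norm_add_le _ _) scale_nonneg
  norm_eq_zero_iff f := by
    rw [norm_eq_scale]
    refine ⟨fun h => ?_, fun h => by simp [h]⟩
    funext i
    have : Nonempty M := ⟨i⟩
    have h0 : toPiLp f = 0 :=
      norm_eq_zero.1 ((mul_eq_zero.1 h).resolve_left scale_pos.ne')
    exact congrArg (fun g : PiLp p fun _ : M => 𝕜 => g i) h0

instance [Fact (1 ≤ p)] : NormedAddCommGroup (LSpace 𝕜 p M) :=
  NormedAddCommGroup.ofCore (𝕜 := 𝕜) normCore

instance [Fact (1 ≤ p)] : NormedSpace 𝕜 (LSpace 𝕜 p M) :=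
  NormedSpace.ofCore normCore

instance [Fact (1 ≤ p)] : CompleteSpace (LSpace 𝕜 p M) :=
  haveI : FiniteDimensional 𝕜 (LSpace 𝕜 p M) := inferInstanceAs (FiniteDimensional 𝕜 (M → 𝕜))
  FiniteDimensional.complete 𝕜 _

instance [Fact (1 ≤ p)] : MeasurableSpace (LSpace 𝕜 p M) := borel _

instance [Fact (1 ≤ p)] : BorelSpace (LSpace 𝕜 p M) := ⟨rfl⟩

end LSpace

/-! ### Vector-valued mean computation and the adaption gap -/

/-- Vector-valued mean computation `S^{M₁,M₂} : B_{L_p^{M₁ × M₂}} → L_q^{M₁}`,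
`(S f)(i) = |M₂|⁻¹ ∑_j f(i,j)`, on the closed unit ball, with standard information
`δ_{ij}(f) = f(i,j)`. -/
def meanProblem (𝕜 : Type) [RCLike 𝕜] (p q : ℝ≥0∞) [Fact (1 ≤ p)]
    (M₁ M₂ : Type) [Fintype M₁] [Fintype M₂] :
    NumericalProblem (Metric.closedBall (0 : LSpace 𝕜 p (M₁ × M₂)) 1) (LSpace 𝕜 q M₁) 𝕜 where
  S f := fun i => (Fintype.card M₂ : 𝕜)⁻¹ * ∑ j : M₂, f.1 (i, j)
  Λ := Set.range fun (ij : M₁ × M₂) f => f.1 ij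

/-- `γ(p,q,n)`: the largest ratio between the non-adaptive and the adaptive randomized `n`-th minimal
errors of `S^{N₁,N₂}` in the region `N₁ ≤ n < c₀ N₁ N₂` (which forces `N₁, N₂ ≥ 1`). -/
def adaptionGap (𝕜 : Type) [RCLike 𝕜] (p q : ℝ≥0∞) [Fact (1 ≤ p)] [Fact (1 ≤ q)] (c₀ : ℝ)
    (n : ℕ) : ℝ≥0∞ :=
  ⨆ (N₁ : ℕ) (N₂ : ℕ) (_ : N₁ ≤ n ∧ (n : ℝ) < c₀ * N₁ * N₂),
    (meanProblem 𝕜 p q (Fin N₁) (Fin N₂)).eRanNon n / (meanProblem 𝕜 p q (Fin N₁) (Fin N₂)).eRan n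

/-- The exponent `(1/2 - 1/p)(1/p - 1/q) / (1/2 - 1/q)` (with `1/∞ = 0`). -/
def gapExponent (p q : ℝ≥0∞) : ℝ :=
  (1 / 2 - (p⁻¹).toReal) * ((p⁻¹).toReal - (q⁻¹).toReal) / (1 / 2 - (q⁻¹).toReal)

end

/-!
Write `u = 1/p`, `v = 1/q`, `m = n / N₁` (samples per row), and let `n` be at most a small multiple
of `N₁ N₂`. Up to constants the non-adaptive error is `N₁^(u - v) m^(-1/2)`, while an adaptive
algorithm achieves, up to a logarithm, `m^(-1/2)` as long as `N₁^(u - v) ≤ m^(1/2 - u)`. Hence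
adaption gains `N₁^(u - v)` there, and under the constraint the gain is largest when both sides of
it are equal; then `N₁ = n^x` with `x = (1/2 - u) / (1/2 - v)` and the gain is `n^κ`,
`κ = x (u - v)`.

*Lower bounds.* The columns are divided into about `m` blocks, and the fooling functions are
constant on the cells (row) × (block). An algorithm with `n` samples misses half of the cells.
A spike on one cell gives `e^ran ≥ c N₁^(u - v) m^(-(1 - u))` (`le_eRan_spike`); random signs on all
cells give `e^ran ≥ c m^(-1/2)` (`le_eRan_signs`), because the signs in the cells which have not
been visited may be resampled without changing the output (`le_sum_error_of_random_signs`).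
A non-adaptive algorithm has to treat all rows alike, so it is fooled by signs of height `N₁^u` in
one unknown row, which gives `e^ran-non ≥ c N₁^(u - v) m^(-1/2)` (`le_eRanNon_signs`).

*Non-adaptive upper bound.* Monte Carlo with `m` common columns; the `p`-th moments are controlled
by the Marcinkiewicz–Zygmund inequality (`exists_sum_abs_sum_rpow_le`, `exists_eRanNon_le`).

*Adaptive upper bound* (`eRan_le_of_params`). Sample `k ≈ m / 2` columns. A row in which the sampled
mean of `min (|f|², t²)` exceeds a threshold `θ` is read completely; the mean of any other row is
estimated from the samples truncated at level `t`. As `‖f‖_p ≤ 1` and `p > 2`, Markov's inequality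
bounds the expected number of completely read rows by `2 N₁ / θ`, so that they fit the budget if
`N₂` is a multiple of `m`. The error has three sources. A row with mean of `min (|f|², t²)` above
`4 θ` is overlooked with probability at most `exp (-k θ / t²)` (`card_overlooked_le`). In the other
rows the truncated Monte Carlo error is subexponential at scale `t / k`, uniformly in the rows up to
a factor `log N₁` (`exists_exp_control`). The bias of the truncation is at most
`N₁^(u - v) (4 θ / t²)^(1 - u)` in norm, by Hölder's inequality (`card_mul_bias_rpow_le`). The choice
`t² ≈ m / log n` makes the overlooked rows negligible, the fluctuation `m^(-1/2)` up to logarithms,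
and the bias `N₁^(u - v) m^(-(1 - u))`, which the critical regime bounds by `m^(-1/2)`
(`exists_eRan_le`).

All randomized algorithms used in the upper bounds are uniformly distributed on a finite family, so
that expectations are finite sums, normalized by the cardinality of the index set.
-/

/-! ### Deterministic algorithms -/

namespace DetAlg

variable {F G K : Type} {P : NumericalProblem F G K}

theorem info_apply (A : DetAlg P) (f : F) {i : ℕ} (l : Fin i) :
    A.info f i l = (A.L l (A.info f l)).1 f := by
  induction i with
  | zero => exact l.elim0
  | succ i ih =>
    refine Fin.lastCases ?_ (fun l => ?_) l
    · simp [info]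
    · simpa [info] using ih l

theorem card_le_of_halt (A : DetAlg P) {f : F} {n : ℕ} (h : A.τ n (A.info f n) = true) :
    A.card f ≤ n :=
  iInf₂_le n h

theorem exists_halt_of_card_lt (A : DetAlg P) {f : F} {x : ℕ∞} (h : A.card f < x) :
    ∃ n : ℕ, A.τ n (A.info f n) = true ∧ (n : ℕ∞) < x := by
  unfold card at h
  simp only [iInf_lt_iff] at h
  obtain ⟨n, hn, hx⟩ := h
  exact ⟨n, hn, hx⟩

theorem card_eq_of_halt (A : DetAlg P) {f : F} {n : ℕ} (h : A.τ n (A.info f n) = true)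
    (h' : ∀ i < n, A.τ i (A.info f i) = false) : A.card f = n := by
  refine le_antisymm (A.card_le_of_halt h) (le_iInf₂ fun i hi => ?_)
  by_contra hc
  have : i < n := by exact_mod_cast not_le.1 hc
  simp [h' i this] at hi

/-- An algorithm cannot tell `g` from `f` if `g` has the same values as `f` on all functionals
which are evaluated on the input `f`. -/
theorem info_eq_of_agree (A : DetAlg P) {f g : F}
    (h : ∀ i : ℕ, (i : ℕ∞) < A.card f →
      (A.L i (A.info f i)).1 g = (A.L i (A.info f i)).1 f) (i : ℕ) (hi : (i : ℕ∞) ≤ A.card f) :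
    A.info g i = A.info f i := by
  induction i with
  | zero => rfl
  | succ i ih =>
    have hlt : (i : ℕ∞) < A.card f :=
      lt_of_lt_of_le (by exact_mod_cast Nat.lt_succ_self i) hi
    have := ih hlt.le
    simp only [info, this, h i hlt]

theorem card_eq_of_agree (A : DetAlg P) {f g : F}
    (h : ∀ i : ℕ, (i : ℕ∞) < A.card f →
      (A.L i (A.info f i)).1 g = (A.L i (A.info f i)).1 f) : A.card g = A.card f := by
  refine le_antisymm ?_ (le_iInf₂ fun n hn => ?_)
  · by_contra hc
    obtain ⟨n, hn, hx⟩ := A.exists_halt_of_card_lt (not_le.1 hc)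
    by_cases hnf : (n : ℕ∞) ≤ A.card f
    · rw [← A.info_eq_of_agree h n hnf] at hn
      exact absurd (A.card_le_of_halt hn) (not_le.2 hx)
    · -- the cardinality is attained by the first stopping index, which is at most `card f`
      have hex : ∃ n, A.τ n (A.info f n) = true := ⟨n, hn⟩
      classical
      have hcard : A.card f = (Nat.find hex : ℕ) :=
        A.card_eq_of_halt (Nat.find_spec hex) fun i hi => by
          simpa using Nat.find_min hex hi
      have h2 := Nat.find_spec hex
      rw [← A.info_eq_of_agree h _ hcard.ge] at h2
      exact hc ((A.card_le_of_halt h2).trans hcard.ge)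
  · by_contra hc
    have hlt := not_le.1 hc
    rw [A.info_eq_of_agree h n hlt.le] at hn
    exact hc (A.card_le_of_halt hn)

theorem out_eq_of_agree (A : DetAlg P) {f g : F}
    (h : ∀ i : ℕ, (i : ℕ∞) < A.card f →
      (A.L i (A.info f i)).1 g = (A.L i (A.info f i)).1 f) : A.out g = A.out f := by
  unfold out
  rw [A.card_eq_of_agree h, A.info_eq_of_agree h _ (ENat.natCast_toNat_le_self _)]

theorem NonAdaptive.L_eq {A : DetAlg P} (hA : A.NonAdaptive) (f g : F) (i : ℕ) :
    A.L i (A.info f i) = A.L i (A.info g i) :=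
  (hA i _ _).1

theorem NonAdaptive.card_eq {A : DetAlg P} (hA : A.NonAdaptive) (f g : F) :
    A.card f = A.card g := by
  unfold card
  refine iInf_congr fun n => ?_
  rw [(hA n (A.info f n) (A.info g n)).2]

/-- The two-stage algorithm which evaluates `q₁ 0, …, q₁ (a - 1)` with results `y`, then
`q₂ y 0, …, q₂ y (r y - 1)` with results `z`, and returns `o y z` (where `z` is continued by
zeros). -/
def twoStage [Zero K] [Zero G] (a : ℕ) (q₁ : ℕ → P.Λ) (q₂ : (Fin a → K) → ℕ → P.Λ)
    (r : (Fin a → K) → ℕ) (o : (Fin a → K) → (ℕ → K) → G) : DetAlg P where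
  L i y := if h : a ≤ i then q₂ (fun l => y (Fin.castLE h l)) (i - a) else q₁ i
  τ i y := if h : a ≤ i then decide (i = a + r fun l => y (Fin.castLE h l)) else false
  φ i y := if h : a ≤ i then
      o (fun l => y (Fin.castLE h l)) (fun l => if h' : a + l < i then y ⟨a + l, h'⟩ else 0)
    else 0

section twoStage

variable [Zero K] [Zero G] {a : ℕ} {q₁ : ℕ → P.Λ} {q₂ : (Fin a → K) → ℕ → P.Λ}
  {r : (Fin a → K) → ℕ} {o : (Fin a → K) → (ℕ → K) → G}

theorem twoStage_info_castLE (f : F) {i : ℕ} (h : a ≤ i) :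
    (fun l : Fin a => (twoStage a q₁ q₂ r o).info f i (Fin.castLE h l)) =
      fun l : Fin a => (q₁ l).1 f := by
  funext l
  rw [info_apply]
  have : ¬ a ≤ (l : ℕ) := not_le.2 l.2
  simp [twoStage, this]

theorem twoStage_card (f : F) :
    (twoStage a q₁ q₂ r o).card f = ((a + r fun l : Fin a => (q₁ l).1 f : ℕ) : ℕ∞) := by
  have key : ∀ i, (twoStage a q₁ q₂ r o).τ i ((twoStage a q₁ q₂ r o).info f i) =
      decide (i = a + r fun l : Fin a => (q₁ l).1 f) := by
    intro i
    by_cases h : a ≤ i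
    · conv_lhs => simp only [twoStage, h, dite_true]
      congr 3
      rw [← twoStage_info_castLE f h]
      rfl
    · have : ¬ i = a + r fun l : Fin a => (q₁ l).1 f := by omega
      simp [twoStage, h, this]
  refine card_eq_of_halt _ (by rw [key]; simp) fun i hi => ?_
  rw [key]
  simp only [decide_eq_false_iff_not]
  omega

theorem twoStage_out (f : F) :
    (twoStage a q₁ q₂ r o).out f = o (fun l : Fin a => (q₁ l).1 f) (fun l =>
      if l < r (fun l : Fin a => (q₁ l).1 f) then (q₂ (fun l : Fin a => (q₁ l).1 f) l).1 f
        else 0) := by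
  unfold out
  rw [twoStage_card, ENat.toNat_natCast]
  have h : a ≤ a + r fun l : Fin a => (q₁ l).1 f := by omega
  conv_lhs => simp only [twoStage, h, dite_true]
  have h1 := twoStage_info_castLE (q₁ := q₁) (q₂ := q₂) (r := r) (o := o) f h
  congr 1
  funext l
  by_cases hl : l < r fun l : Fin a => (q₁ l).1 f
  · rw [if_pos hl, dif_pos (by omega), ← twoStage, info_apply]
    have h2 := twoStage_info_castLE (q₁ := q₁) (q₂ := q₂) (r := r) (o := o) f
      (i := a + l) (by omega)
    conv_lhs => simp only [twoStage, Nat.le_add_right, dite_true]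
    rw [← h2]
    simp [twoStage]
  · rw [if_neg hl, dif_neg (by omega)]

end twoStage

end DetAlg

/-! ### Inequalities for the normalized norms -/

namespace LSpace

variable {𝕜 : Type} [RCLike 𝕜] {p q : ℝ≥0∞} {M : Type} [Fintype M]

theorem norm_top (f : LSpace 𝕜 ∞ M) : ‖f‖ = ⨆ i, ‖f i‖ := by rw [norm_def, if_pos rfl]

theorem norm_of_ne_top (hp : p ≠ ∞) (f : LSpace 𝕜 p M) :
    ‖f‖ = ((Fintype.card M : ℝ)⁻¹ * ∑ i : M, ‖f i‖ ^ p.toReal) ^ (1 / p.toReal) := by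
  rw [norm_def, if_neg hp]

theorem toReal_pos_of_one_le (h1 : 1 ≤ p) (hp : p ≠ ∞) : 0 < p.toReal :=
  ENNReal.toReal_pos (fun h0 => by simp [h0] at h1) hp

theorem one_le_toReal (h1 : 1 ≤ p) (hp : p ≠ ∞) : 1 ≤ p.toReal := by
  simpa using ENNReal.toReal_mono hp h1

/-- Comparison of the normalized norms: `‖f‖_q` is bounded by the (unnormalized) `ℓ_r` norm with
`r ≤ q`, times `|M|^(-1/q)`. -/
theorem norm_le_rpow_sum [Nonempty M] (hq1 : 1 ≤ q) {r : ℝ} (hr : 0 < r)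
    (hrq : q ≠ ∞ → r ≤ q.toReal) (f : LSpace 𝕜 q M) :
    ‖f‖ ≤ (Fintype.card M : ℝ) ^ (-(q⁻¹).toReal) * (∑ i, ‖f i‖ ^ r) ^ (1 / r) := by
  have hS : 0 ≤ ∑ i, ‖f i‖ ^ r := Finset.sum_nonneg fun i _ => by positivity
  have hle : ∀ i, ‖f i‖ ≤ (∑ i, ‖f i‖ ^ r) ^ (1 / r) := fun i => by
    rw [one_div, Real.le_rpow_inv_iff_of_pos (norm_nonneg _) hS hr]
    exact Finset.single_le_sum (f := fun i => ‖f i‖ ^ r) (fun i _ => by positivity)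
      (Finset.mem_univ i)
  by_cases hq : q = ∞
  · subst hq
    rw [norm_top]
    simpa using ciSup_le hle
  · have hq0 := toReal_pos_of_one_le hq1 hq
    set T := (∑ i, ‖f i‖ ^ r) ^ (1 / r) with hT
    have hT0 : 0 ≤ T := by positivity
    rw [norm_of_ne_top hq, Real.mul_rpow (by positivity) (Finset.sum_nonneg fun i _ => by positivity)]
    rw [ENNReal.toReal_inv, Real.rpow_neg (by positivity), Real.inv_rpow (by positivity), one_div]
    refine mul_le_mul_of_nonneg_left ?_ (by positivity)
    rw [Real.rpow_inv_le_iff_of_pos (Finset.sum_nonneg fun i _ => by positivity) hT0 hq0]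
    calc ∑ i, ‖f i‖ ^ q.toReal = ∑ i, ‖f i‖ ^ r * ‖f i‖ ^ (q.toReal - r) := by
          refine Finset.sum_congr rfl fun i _ => ?_
          rw [← Real.rpow_add_of_nonneg (norm_nonneg _) hr.le (by linarith [hrq hq])]
          congr 1; ring
      _ ≤ ∑ i, ‖f i‖ ^ r * T ^ (q.toReal - r) := by
          refine Finset.sum_le_sum fun i _ => ?_
          refine mul_le_mul_of_nonneg_left ?_ (by positivity)
          exact Real.rpow_le_rpow (norm_nonneg _) (hle i) (by linarith [hrq hq])
      _ = T ^ r * T ^ (q.toReal - r) := by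
          have hTr : T ^ r = ∑ i, ‖f i‖ ^ r := by
            rw [hT, one_div]
            exact Real.rpow_inv_rpow hS hr.ne'
          rw [← Finset.sum_mul, hTr]
      _ = T ^ q.toReal := by
          rw [← Real.rpow_add_of_nonneg hT0 hr.le (by linarith [hrq hq])]
          congr 1; ring

theorem norm_le_of_forall_le (hq1 : 1 ≤ q) {f : LSpace 𝕜 q M} {C : ℝ} (hC : 0 ≤ C)
    (h : ∀ i, ‖f i‖ ≤ C) : ‖f‖ ≤ C := by
  by_cases hq : q = ∞
  · subst hq
    rw [norm_top]
    exact Real.iSup_le h hC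
  · have hq0 := toReal_pos_of_one_le hq1 hq
    rw [norm_of_ne_top hq, one_div, Real.rpow_inv_le_iff_of_pos
      (mul_nonneg (by positivity) (Finset.sum_nonneg fun i _ => by positivity)) hC hq0]
    refine inv_mul_le_of_le_mul₀ (by positivity) (by positivity) ?_
    calc ∑ i, ‖f i‖ ^ q.toReal ≤ ∑ _i : M, C ^ q.toReal := Finset.sum_le_sum fun i _ =>
          Real.rpow_le_rpow (norm_nonneg _) (h i) hq0.le
      _ = _ := by simp

theorem rpow_mul_norm_apply_le [Nonempty M] (hq1 : 1 ≤ q) (f : LSpace 𝕜 q M) (i : M) :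
    (Fintype.card M : ℝ) ^ (-(q⁻¹).toReal) * ‖f i‖ ≤ ‖f‖ := by
  by_cases hq : q = ∞
  · subst hq
    rw [norm_top]
    simpa using le_ciSup (f := fun i => ‖f i‖) (Set.finite_range _).bddAbove i
  · have hq0 := toReal_pos_of_one_le hq1 hq
    rw [norm_of_ne_top hq, Real.mul_rpow (by positivity) (Finset.sum_nonneg fun i _ => by positivity)]
    rw [ENNReal.toReal_inv, Real.rpow_neg (by positivity), Real.inv_rpow (by positivity), one_div]
    refine mul_le_mul_of_nonneg_left ?_ (by positivity)
    rw [Real.le_rpow_inv_iff_of_pos (norm_nonneg _)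
      (Finset.sum_nonneg fun i _ => by positivity) hq0]
    exact Finset.single_le_sum (f := fun i => ‖f i‖ ^ q.toReal) (fun i _ => by positivity)
      (Finset.mem_univ i)

theorem sum_norm_le [Nonempty M] (hq1 : 1 ≤ q) (f : LSpace 𝕜 q M) :
    ∑ i, ‖f i‖ ≤ Fintype.card M * ‖f‖ := by
  have hc : (0 : ℝ) < Fintype.card M := by exact_mod_cast Fintype.card_pos
  by_cases hq : q = ∞
  · subst hq
    rw [norm_top]
    calc ∑ i, ‖f i‖ ≤ ∑ _i : M, ⨆ i, ‖f i‖ := Finset.sum_le_sum fun i _ =>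
          le_ciSup (f := fun i => ‖f i‖) (Set.finite_range _).bddAbove i
      _ = _ := by simp
  · have hq0 := toReal_pos_of_one_le hq1 hq
    rw [norm_of_ne_top hq, ← inv_mul_le_iff₀ hc, one_div]
    refine (Real.le_rpow_inv_iff_of_pos
      (mul_nonneg (by positivity) (Finset.sum_nonneg fun i _ => norm_nonneg _))
      (mul_nonneg (by positivity) (Finset.sum_nonneg fun i _ => by positivity)) hq0).2 ?_
    have := Real.rpow_arith_mean_le_arith_mean_rpow Finset.univ (fun _ : M => (Fintype.card M : ℝ)⁻¹)
      (fun i => ‖f i‖) (fun _ _ => by positivity) (by simp [hc.ne']) (fun i _ => norm_nonneg _)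
      (one_le_toReal hq1 hq)
    simpa [← Finset.mul_sum] using this

theorem sum_rpow_le_of_norm_le_one [Nonempty M] (hp1 : 1 ≤ p) (hp : p ≠ ∞) {f : LSpace 𝕜 p M}
    (h : ‖f‖ ≤ 1) : ∑ i, ‖f i‖ ^ p.toReal ≤ Fintype.card M := by
  have hc : (0 : ℝ) < Fintype.card M := by exact_mod_cast Fintype.card_pos
  have hp0 := toReal_pos_of_one_le hp1 hp
  rw [norm_of_ne_top hp, one_div, Real.rpow_inv_le_iff_of_pos
    (mul_nonneg (by positivity) (Finset.sum_nonneg fun i _ => by positivity)) zero_le_one hp0,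
    inv_mul_le_iff₀ hc] at h
  simpa using h

theorem norm_le_one_of_sum_rpow_le [Nonempty M] (hp1 : 1 ≤ p) (hp : p ≠ ∞) {f : LSpace 𝕜 p M}
    (h : ∑ i, ‖f i‖ ^ p.toReal ≤ Fintype.card M) : ‖f‖ ≤ 1 := by
  have hc : (0 : ℝ) < Fintype.card M := by exact_mod_cast Fintype.card_pos
  have hp0 := toReal_pos_of_one_le hp1 hp
  rw [norm_of_ne_top hp, one_div, Real.rpow_inv_le_iff_of_pos
    (mul_nonneg (by positivity) (Finset.sum_nonneg fun i _ => by positivity)) zero_le_one hp0,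
    inv_mul_le_iff₀ hc]
  simpa using h

end LSpace

/-! ### Moments of sums of independent random variables -/

/-- The second-order bound for `|x + y|^p` around `x`, with the mixed term `|x|^(p-2) y²` already
split by Young's inequality with weight `N`. As `d` does not depend on `y`, the linear term drops
out when `y` runs through the values of a centred random variable, and the factor `1 + C / N` stays
bounded under `N` iterations. -/
theorem exists_abs_add_rpow_le {p : ℝ} (hp : 2 < p) : ∃ C : ℝ, 0 < C ∧
    ∀ N : ℝ, 1 ≤ N → ∀ x : ℝ, ∃ d : ℝ, ∀ y : ℝ,
      |x + y| ^ p ≤ (1 + C / N) * |x| ^ p + d * y + 2 * C * N ^ (p / 2 - 1) * |y| ^ p := by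
  refine ⟨(p + 1) ^ p + p ^ 2, by positivity, fun N hN x => ?_⟩
  set C : ℝ := (p + 1) ^ p + p ^ 2 with hC
  have hC1 : 1 ≤ C := by
    have : 0 ≤ (p + 1) ^ p := by positivity
    nlinarith
  have hC0 : 0 ≤ C := by linarith
  have hN0 : 0 < N := by linarith
  have hNp : 1 ≤ N ^ (p / 2 - 1) := Real.one_le_rpow hN (by linarith)
  rcases eq_or_ne x 0 with rfl | hx
  · refine ⟨0, fun y => ?_⟩
    have : (0 : ℝ) ^ p = 0 := Real.zero_rpow (by linarith)
    have hy : 0 ≤ |y| ^ p := by positivity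
    simp only [zero_add, abs_zero, this, mul_zero, zero_mul]
    nlinarith [mul_nonneg (by nlinarith : 0 ≤ 2 * C * N ^ (p / 2 - 1) - 1) hy]
  · -- the normalized inequality
    have key : ∀ t : ℝ, |1 + t| ^ p ≤ 1 + p * t + C * (t ^ 2 + |t| ^ p) := by
      intro t
      have htp : 0 ≤ |t| ^ p := by positivity
      rcases le_or_gt (p * |t|) 1 with h | h
      · have ht : |t| < 1 := by nlinarith [abs_nonneg t]
        have ht' := abs_lt.1 ht
        have h1 : |1 + t| = 1 + t := abs_of_pos (by linarith)
        have h2 : (1 + t) ^ p ≤ Real.exp (p * t) := by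
          rw [mul_comm, Real.exp_mul]
          exact Real.rpow_le_rpow (by linarith) (by linarith [Real.add_one_le_exp t]) (by linarith)
        have h3 := Real.abs_exp_sub_one_sub_id_le (x := p * t)
          (by rw [abs_mul, abs_of_pos (by linarith : 0 < p)]; exact h)
        have h4 := (abs_le.1 h3).2
        have h5 : p ^ 2 * t ^ 2 ≤ C * t ^ 2 := by
          refine mul_le_mul_of_nonneg_right ?_ (by positivity)
          have : 0 ≤ (p + 1) ^ p := by positivity
          linarith
        rw [h1]
        nlinarith [mul_nonneg hC0 htp]
      · have h1 : |1 + t| ≤ (p + 1) * |t| := by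
          calc |1 + t| ≤ |1| + |t| := abs_add_le _ _
            _ ≤ _ := by rw [abs_one]; linarith
        have h2 : |1 + t| ^ p ≤ (p + 1) ^ p * |t| ^ p := by
          rw [← Real.mul_rpow (by linarith) (abs_nonneg _)]
          exact Real.rpow_le_rpow (abs_nonneg _) h1 (by linarith)
        have h3 : -(p * t) ≤ p ^ 2 * t ^ 2 := by
          have : -(p * t) ≤ p * |t| := by nlinarith [neg_abs_le t]
          have h4 : p * |t| ≤ (p * |t|) ^ 2 := by nlinarith
          rw [mul_pow, sq_abs] at h4
          linarith
        have h4 : 0 ≤ (p + 1) ^ p * t ^ 2 := by positivity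
        have h5 : 0 ≤ p ^ 2 * |t| ^ p := by positivity
        rw [hC]
        nlinarith
    refine ⟨p * |x| ^ p / x, fun y => ?_⟩
    have hx0 : 0 < |x| := abs_pos.2 hx
    have hxp : 0 < |x| ^ p := by positivity
    have h1 := mul_le_mul_of_nonneg_left (key (y / x)) hxp.le
    have e1 : |x| ^ p * |1 + y / x| ^ p = |x + y| ^ p := by
      rw [← Real.mul_rpow (abs_nonneg _) (abs_nonneg _), ← abs_mul]
      congr 2; field_simp
    have e2 : |x| ^ p * |y / x| ^ p = |y| ^ p := by
      rw [← Real.mul_rpow (abs_nonneg _) (abs_nonneg _), ← abs_mul]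
      congr 2; field_simp
    have e3 : |x| ^ p * (1 + p * (y / x) + C * ((y / x) ^ 2 + |y / x| ^ p)) =
        |x| ^ p + p * |x| ^ p / x * y + C * (|x| ^ p * (y / x) ^ 2) + C * |y| ^ p := by
      rw [← e2]; field_simp; ring
    -- Young's inequality for the mixed term
    have h2 : |x| ^ p * (y / x) ^ 2 ≤ |x| ^ p / N + N ^ (p / 2 - 1) * |y| ^ p := by
      rcases le_or_gt ((y / x) ^ 2) (1 / N) with h | h
      · have : |x| ^ p * (y / x) ^ 2 ≤ |x| ^ p * (1 / N) := mul_le_mul_of_nonneg_left h hxp.le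
        have h' : 0 ≤ N ^ (p / 2 - 1) * |y| ^ p := by positivity
        rw [mul_one_div] at this
        linarith
      · have hs : 1 ≤ N * (y / x) ^ 2 := by
          rw [div_lt_iff₀ hN0] at h; linarith
        have h3 : 1 ≤ (N * (y / x) ^ 2) ^ (p / 2 - 1) := Real.one_le_rpow hs (by linarith)
        have h4 : (y / x) ^ 2 ≤ N ^ (p / 2 - 1) * |y / x| ^ p := by
          rw [Real.mul_rpow hN0.le (by positivity)] at h3
          have hyx : 0 < |y / x| := by
            rcases eq_or_ne (y / x) 0 with h0 | h0
            · rw [h0] at hs; norm_num at hs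
            · exact abs_pos.2 h0
          have e4 : ((y / x) ^ 2) ^ (p / 2 - 1) * (y / x) ^ 2 = |y / x| ^ p := by
            rw [← sq_abs, ← Real.rpow_natCast, ← Real.rpow_mul hyx.le, ← Real.rpow_add hyx]
            congr 1; push_cast; ring
          rw [← e4, ← mul_assoc]
          exact le_mul_of_one_le_left (by positivity) h3
        calc |x| ^ p * (y / x) ^ 2 ≤ |x| ^ p * (N ^ (p / 2 - 1) * |y / x| ^ p) :=
              mul_le_mul_of_nonneg_left h4 hxp.le
          _ = N ^ (p / 2 - 1) * |y| ^ p := by rw [← e2]; ring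
          _ ≤ _ := le_add_of_nonneg_left (by positivity)
    rw [e1, e3] at h1
    have h5 : C * |y| ^ p ≤ C * N ^ (p / 2 - 1) * |y| ^ p := by
      refine mul_le_mul_of_nonneg_right ?_ (by positivity)
      exact le_mul_of_one_le_right hC0 hNp
    have h6 := mul_le_mul_of_nonneg_left h2 hC0
    calc |x + y| ^ p ≤ _ := h1
      _ ≤ |x| ^ p + p * |x| ^ p / x * y + C * (|x| ^ p / N + N ^ (p / 2 - 1) * |y| ^ p) +
          C * N ^ (p / 2 - 1) * |y| ^ p := by linarith
      _ = _ := by ring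

section Moments

variable {β : Type*} [Fintype β]

/-- The Marcinkiewicz–Zygmund bound for the `p`-th moment of a sum of `N` independent copies of a
centred random variable `X`, uniformly distributed on the values of `X : β → ℝ`. -/
theorem exists_sum_abs_sum_rpow_le {p : ℝ} (hp : 2 < p) : ∃ C : ℝ, 0 < C ∧
    ∀ {β : Type} [Fintype β] (X : β → ℝ), ∑ b, X b = 0 → ∀ N : ℕ, 1 ≤ N →
      (Fintype.card β : ℝ) * ∑ J : Fin N → β, |∑ l, X (J l)| ^ p ≤
        C * (N : ℝ) ^ (p / 2) * (Fintype.card β : ℝ) ^ N * ∑ b, |X b| ^ p := by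
  obtain ⟨C, hC, hpt⟩ := exists_abs_add_rpow_le hp
  refine ⟨2 * C * Real.exp C, by positivity, fun {β} _ X hX N hN => ?_⟩
  have hN1 : (1 : ℝ) ≤ N := by exact_mod_cast hN
  have hN0 : (0 : ℝ) < N := by linarith
  have hcN : 1 ≤ 1 + C / N := by have : 0 < C / N := by positivity
                                 linarith
  set B : ℝ := 2 * C * (N : ℝ) ^ (p / 2 - 1) with hB
  set c : ℝ := (Fintype.card β : ℝ) with hc
  set a : ℝ := ∑ b, |X b| ^ p with ha
  have ha0 : 0 ≤ a := Finset.sum_nonneg fun i _ => by positivity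
  have hB0 : 0 ≤ B := by positivity
  have hc0 : 0 ≤ c := by positivity
  -- adding one more copy of `X`: the linear term of the pointwise bound sums to zero
  have hstep : ∀ k : ℕ, ∑ J : Fin (k + 1) → β, |∑ l, X (J l)| ^ p ≤
      (1 + C / N) * c * ∑ J : Fin k → β, |∑ l, X (J l)| ^ p + B * c ^ k * a := by
    intro k
    rw [← (Fin.consEquiv fun _ : Fin (k + 1) => β).sum_comp, Fintype.sum_prod_type_right]
    have h1 : ∀ J : Fin k → β, ∑ b, |X b + ∑ l, X (J l)| ^ p ≤
        (1 + C / N) * c * |∑ l, X (J l)| ^ p + B * a := by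
      intro J
      obtain ⟨d, hd⟩ := hpt N hN1 (∑ l, X (J l))
      calc ∑ b, |X b + ∑ l, X (J l)| ^ p
          ≤ ∑ b, ((1 + C / N) * |∑ l, X (J l)| ^ p + d * X b + B * |X b| ^ p) :=
            Finset.sum_le_sum fun b _ => by rw [add_comm]; exact hd (X b)
        _ = _ := by
          rw [Finset.sum_add_distrib, Finset.sum_add_distrib, ← Finset.mul_sum, ← Finset.mul_sum,
            ← Finset.mul_sum, hX, Finset.sum_const, Finset.card_univ, nsmul_eq_mul]
          ring
    calc _ = ∑ J : Fin k → β, ∑ b, |X b + ∑ l, X (J l)| ^ p := by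
          refine Finset.sum_congr rfl fun J _ => Finset.sum_congr rfl fun b _ => ?_
          simp [Fin.consEquiv, Fin.sum_univ_succ]
      _ ≤ ∑ J : Fin k → β, ((1 + C / N) * c * |∑ l, X (J l)| ^ p + B * a) :=
          Finset.sum_le_sum fun J _ => h1 J
      _ = _ := by
          rw [Finset.sum_add_distrib, ← Finset.mul_sum]
          simp [hc]; ring
  have hind : ∀ k : ℕ, c * ∑ J : Fin k → β, |∑ l, X (J l)| ^ p ≤
      (1 + C / N) ^ k * k * B * c ^ k * a := by
    intro k
    induction k with
    | zero => simp [Real.zero_rpow (by linarith : p ≠ 0)]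
    | succ k ih =>
      have hpow : 1 ≤ (1 + C / N) ^ (k + 1) := one_le_pow₀ hcN
      have hz : 0 ≤ B * c ^ (k + 1) * a := by positivity
      calc c * ∑ J : Fin (k + 1) → β, |∑ l, X (J l)| ^ p
          ≤ c * ((1 + C / N) * c * ∑ J : Fin k → β, |∑ l, X (J l)| ^ p + B * c ^ k * a) :=
            mul_le_mul_of_nonneg_left (hstep k) hc0
        _ = (1 + C / N) * c * (c * ∑ J : Fin k → β, |∑ l, X (J l)| ^ p) +
              1 * (B * c ^ (k + 1) * a) := by ring
        _ ≤ (1 + C / N) * c * ((1 + C / N) ^ k * k * B * c ^ k * a) +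
              (1 + C / N) ^ (k + 1) * (B * c ^ (k + 1) * a) := by gcongr
        _ = _ := by push_cast; ring
  refine (hind N).trans ?_
  have hexp : (1 + C / N) ^ N ≤ Real.exp C := by
    have : (1 + C / N) ≤ Real.exp (C / N) := by linarith [Real.add_one_le_exp (C / N)]
    calc (1 + C / N) ^ N ≤ Real.exp (C / N) ^ N := by gcongr
      _ = Real.exp C := by rw [← Real.exp_nat_mul]; congr 1; field_simp
  have hpowN : (N : ℝ) * (N : ℝ) ^ (p / 2 - 1) = (N : ℝ) ^ (p / 2) := by
    rw [← Real.rpow_one_add' hN0.le (by linarith)]; congr 1; ring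
  calc (1 + C / N) ^ N * N * B * c ^ N * a ≤ Real.exp C * N * B * c ^ N * a := by gcongr
    _ = 2 * C * Real.exp C * (N * (N : ℝ) ^ (p / 2 - 1)) * c ^ N * a := by rw [hB]; ring
    _ = _ := by rw [hpowN]

/-- The exponential moment of a sum of `k` independent copies of a random variable. -/
theorem sum_exp_sum_le (X : β → ℝ) (k : ℕ) (s : ℝ)
    (h : ∑ b, Real.exp (X b) ≤ Fintype.card β * Real.exp s) :
    ∑ J : Fin k → β, Real.exp (∑ l, X (J l)) ≤ (Fintype.card β : ℝ) ^ k * Real.exp (k * s) := by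
  calc ∑ J : Fin k → β, Real.exp (∑ l, X (J l)) = (∑ b, Real.exp (X b)) ^ k := by
        rw [Fintype.sum_pow]
        exact Finset.sum_congr rfl fun J _ => Real.exp_sum _ _
    _ ≤ (Fintype.card β * Real.exp s) ^ k :=
        pow_le_pow_left₀ (Finset.sum_nonneg fun _ _ => (Real.exp_pos _).le) h k
    _ = _ := by rw [mul_pow, Real.exp_nat_mul]

theorem sum_exp_le_of_centred (X : β → ℝ) (h0 : ∑ b, X b = 0) (h1 : ∀ b, |X b| ≤ 1) {v : ℝ}
    (h2 : ∑ b, X b ^ 2 ≤ Fintype.card β * v) :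
    ∑ b, Real.exp (X b) ≤ Fintype.card β * Real.exp v := by
  calc ∑ b, Real.exp (X b) ≤ ∑ b, (1 + X b + X b ^ 2) := Finset.sum_le_sum fun b _ => by
        have := (abs_le.1 (Real.abs_exp_sub_one_sub_id_le (h1 b))).2
        linarith
    _ ≤ Fintype.card β * (v + 1) := by
        rw [Finset.sum_add_distrib, Finset.sum_add_distrib, h0]
        simp; linarith
    _ ≤ _ := by
        gcongr
        exact Real.add_one_le_exp v

theorem sum_exp_neg_le (X : β → ℝ) (h0 : ∀ b, 0 ≤ X b) (h1 : ∀ b, X b ≤ 1) {v : ℝ}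
    (h2 : Fintype.card β * v ≤ ∑ b, X b) :
    ∑ b, Real.exp (-X b) ≤ Fintype.card β * Real.exp (-(v / 2)) := by
  calc ∑ b, Real.exp (-X b) ≤ ∑ b, (1 - X b / 2) := Finset.sum_le_sum fun b _ => by
        -- `exp (-x) ≤ 1 / (1 + x) ≤ 1 - x / 2` on `[0, 1]`
        have h3 : Real.exp (-X b) * (1 + X b) ≤ 1 := by
          have := Real.add_one_le_exp (X b)
          calc Real.exp (-X b) * (1 + X b) ≤ Real.exp (-X b) * Real.exp (X b) := by
                gcongr; linarith
            _ = 1 := by rw [← Real.exp_add]; simp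
        nlinarith [h0 b, h1 b, Real.exp_pos (-X b), mul_nonneg (h0 b) (sub_nonneg.2 (h1 b))]
    _ ≤ Fintype.card β * (-(v / 2) + 1) := by
        rw [Finset.sum_sub_distrib, ← Finset.sum_div]
        simp; linarith
    _ ≤ _ := by
        gcongr
        exact Real.add_one_le_exp _

end Moments

/-! ### Sums of random signs -/

/-- The Rademacher sign `±1` attached to a Boolean. -/
def boolSign (b : Bool) : ℝ := if b then 1 else -1

theorem boolSign_not (b : Bool) : boolSign (!b) = -boolSign b := by cases b <;> simp [boolSign]

theorem boolSign_sq (b : Bool) : boolSign b ^ 2 = 1 := by cases b <;> simp [boolSign]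

theorem abs_boolSign (b : Bool) : |boolSign b| = 1 := by cases b <;> simp [boolSign]

section Rademacher

variable {β : Type*} [DecidableEq β]

/-- The flip of the sign of one coordinate, as a permutation of the cube. -/
def flipAt (b : β) : Equiv.Perm (β → Bool) :=
  Function.Involutive.toPerm (fun δ => Function.update δ b (!δ b)) fun δ => by
    funext c
    rcases eq_or_ne c b with rfl | h <;> simp [*]

theorem flipAt_self (b : β) (δ : β → Bool) : flipAt b δ b = !δ b := by
  simp [flipAt, Function.Involutive.toPerm]

theorem flipAt_of_ne {b c : β} (h : c ≠ b) (δ : β → Bool) : flipAt b δ c = δ c := by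
  simp [flipAt, Function.Involutive.toPerm, h]

theorem sum_boolSign_flipAt {U : Finset β} {b : β} (h : b ∉ U) (δ : β → Bool) :
    ∑ c ∈ U, boolSign (flipAt b δ c) = ∑ c ∈ U, boolSign (δ c) :=
  Finset.sum_congr rfl fun c hc => by rw [flipAt_of_ne (ne_of_mem_of_not_mem hc h)]

variable [Fintype β]

theorem sum_sq_sum_boolSign (U : Finset β) :
    ∑ δ : β → Bool, (∑ b ∈ U, boolSign (δ b)) ^ 2 = U.card * (Fintype.card (β → Bool) : ℝ) := by
  induction U using Finset.induction_on with
  | empty => simp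
  | insert b U hb ih =>
    have h1 : ∑ δ : β → Bool, boolSign (δ b) * ∑ c ∈ U, boolSign (δ c) = 0 := by
      have := Equiv.sum_comp (flipAt b) fun δ : β → Bool => boolSign (δ b) * ∑ c ∈ U, boolSign (δ c)
      simp only [sum_boolSign_flipAt hb, flipAt_self, boolSign_not, neg_mul,
        Finset.sum_neg_distrib] at this
      linarith
    have h2 : ∀ δ : β → Bool, (∑ c ∈ insert b U, boolSign (δ c)) ^ 2 =
        1 + 2 * (boolSign (δ b) * ∑ c ∈ U, boolSign (δ c)) +
          (∑ c ∈ U, boolSign (δ c)) ^ 2 := by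
      intro δ
      rw [Finset.sum_insert hb]
      linear_combination boolSign_sq (δ b)
    simp only [h2, Finset.sum_add_distrib, ← Finset.mul_sum, h1, ih, Finset.card_insert_of_notMem hb]
    simp; ring

theorem sum_pow_four_sum_boolSign_le (U : Finset β) :
    ∑ δ : β → Bool, (∑ b ∈ U, boolSign (δ b)) ^ 4 ≤
      3 * (U.card : ℝ) ^ 2 * (Fintype.card (β → Bool) : ℝ) := by
  induction U using Finset.induction_on with
  | empty => simp
  | insert b U hb ih =>
    have h1 : ∑ δ : β → Bool, boolSign (δ b) * (4 * (∑ c ∈ U, boolSign (δ c)) +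
        4 * (∑ c ∈ U, boolSign (δ c)) ^ 3) = 0 := by
      have := Equiv.sum_comp (flipAt b) fun δ : β → Bool => boolSign (δ b) * (4 * (∑ c ∈ U, boolSign (δ c)) +
        4 * (∑ c ∈ U, boolSign (δ c)) ^ 3)
      simp only [sum_boolSign_flipAt hb, flipAt_self, boolSign_not, neg_mul,
        Finset.sum_neg_distrib] at this
      linarith
    have h2 : ∀ δ : β → Bool, (∑ c ∈ insert b U, boolSign (δ c)) ^ 4 =
        1 + boolSign (δ b) * (4 * (∑ c ∈ U, boolSign (δ c)) +
          4 * (∑ c ∈ U, boolSign (δ c)) ^ 3) + 6 * (∑ c ∈ U, boolSign (δ c)) ^ 2 +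
          (∑ c ∈ U, boolSign (δ c)) ^ 4 := by
      intro δ
      rw [Finset.sum_insert hb]
      generalize ∑ c ∈ U, boolSign (δ c) = x
      linear_combination (boolSign (δ b) ^ 2 + 1 + 4 * boolSign (δ b) * x + 6 * x ^ 2) *
        boolSign_sq (δ b)
    have hc : (0 : ℝ) ≤ Fintype.card (β → Bool) := by positivity
    simp only [h2, Finset.sum_add_distrib, ← Finset.mul_sum, h1, sum_sq_sum_boolSign,
      Finset.card_insert_of_notMem hb]
    simp only [Finset.sum_const, Finset.card_univ, nsmul_eq_mul, mul_one, add_zero]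
    push_cast
    nlinarith

/-- A first moment bound in the spirit of Khintchine's inequality, linear in the number of signs. -/
theorem le_sum_abs_sum_boolSign (U : Finset β) {M : ℕ} (hM : 1 ≤ M) (hU : U.card ≤ M) :
    (5 / 9 : ℝ) * U.card / √M * Fintype.card (β → Bool) ≤
      ∑ δ : β → Bool, |∑ b ∈ U, boolSign (δ b)| := by
  have hM0 : (0 : ℝ) < M := by exact_mod_cast hM
  have hs : 0 < √(M : ℝ) := Real.sqrt_pos.2 hM0
  have hss : √(M : ℝ) ^ 2 = M := Real.sq_sqrt hM0.le
  have hU' : (U.card : ℝ) ≤ M := by exact_mod_cast hU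
  set r := √(M : ℝ) with hr
  -- the polynomial minorant `y ^ 2 - 4 / 27 * y ^ 4 ≤ |y|` at `y = x / √M`
  have hpt : ∀ x : ℝ, x ^ 2 / r - 4 / 27 * x ^ 4 / r ^ 3 ≤ |x| := by
    intro x
    have h : ∀ y : ℝ, 0 ≤ y → y ^ 2 - 4 / 27 * y ^ 4 ≤ y := fun y hy => by
      have : 0 ≤ y * ((y - 3 / 2) ^ 2 * (y + 3)) := by positivity
      nlinarith
    have h1 := h (|x| / r) (by positivity)
    have h2 : r * ((|x| / r) ^ 2 - 4 / 27 * (|x| / r) ^ 4) ≤ r * (|x| / r) :=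
      mul_le_mul_of_nonneg_left h1 hs.le
    have e4 : |x| ^ 4 = x ^ 4 := by rw [show 4 = 2 * 2 from rfl, pow_mul, pow_mul, sq_abs]
    calc x ^ 2 / r - 4 / 27 * x ^ 4 / r ^ 3 = r * ((|x| / r) ^ 2 - 4 / 27 * (|x| / r) ^ 4) := by
          rw [div_pow, div_pow, sq_abs, e4]; field_simp
      _ ≤ r * (|x| / r) := h2
      _ = |x| := by field_simp
  set c : ℝ := (Fintype.card (β → Bool) : ℝ) with hc
  have hc0 : 0 ≤ c := by positivity
  calc (5 / 9 : ℝ) * U.card / r * c ≤ U.card * c / r - 4 / 27 * (3 * (U.card : ℝ) ^ 2 * c) / r ^ 3 := by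
        have : (U.card : ℝ) ^ 2 ≤ U.card * r ^ 2 := by
          rw [hss, sq]; exact mul_le_mul_of_nonneg_left hU' (by positivity)
        have h3 : (U.card : ℝ) ^ 2 * c / r ^ 3 ≤ U.card * r ^ 2 * c / r ^ 3 := by gcongr
        have h4 : U.card * r ^ 2 * c / r ^ 3 = U.card * c / r := by field_simp
        have h5 : 4 / 27 * (3 * (U.card : ℝ) ^ 2 * c) / r ^ 3 =
          4 / 9 * ((U.card : ℝ) ^ 2 * c / r ^ 3) := by ring
        have h6 : 5 / 9 * U.card / r * c = 5 / 9 * (U.card * c / r) := by ring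
        rw [h5, h6]; linarith
    _ ≤ ∑ δ : β → Bool, ((∑ b ∈ U, boolSign (δ b)) ^ 2 / r -
          4 / 27 * (∑ b ∈ U, boolSign (δ b)) ^ 4 / r ^ 3) := by
        rw [Finset.sum_sub_distrib, ← Finset.sum_div, ← Finset.sum_div, ← Finset.mul_sum,
          sum_sq_sum_boolSign]
        have := sum_pow_four_sum_boolSign_le U
        gcongr
    _ ≤ _ := Finset.sum_le_sum fun δ _ => hpt _

/-- Shifting a symmetric random variable does not decrease its first absolute moment. -/
theorem le_sum_norm_add_sum_boolSign {𝕜 : Type*} [RCLike 𝕜] (U : Finset β) {M : ℕ} (hM : 1 ≤ M)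
    (hU : U.card ≤ M) (a : 𝕜) (h : ℝ) :
    |h| * ((5 / 9 : ℝ) * U.card / √M * Fintype.card (β → Bool)) ≤
      ∑ δ : β → Bool, ‖a + ((h * ∑ b ∈ U, boolSign (δ b) : ℝ) : 𝕜)‖ := by
  have hinv : Function.Involutive fun (δ : β → Bool) b => !δ b := fun δ => by simp
  have h1 := Equiv.sum_comp (Function.Involutive.toPerm _ hinv) fun δ : β → Bool =>
    ‖a + ((h * ∑ b ∈ U, boolSign (δ b) : ℝ) : 𝕜)‖
  simp only [Function.Involutive.toPerm, Equiv.coe_fn_mk, boolSign_not, Finset.sum_neg_distrib,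
    mul_neg] at h1
  have h2 : ∀ x : ℝ, 2 * |x| ≤ ‖a + ((x : ℝ) : 𝕜)‖ + ‖a + ((-x : ℝ) : 𝕜)‖ := by
    intro x
    have := norm_sub_le (a + ((x : ℝ) : 𝕜)) (a + ((-x : ℝ) : 𝕜))
    have e : (a + ((x : ℝ) : 𝕜)) - (a + ((-x : ℝ) : 𝕜)) = ((2 * x : ℝ) : 𝕜) := by
      push_cast; ring
    rw [e, RCLike.norm_ofReal, abs_mul, abs_two] at this
    exact this
  have h3 : 2 * ∑ δ : β → Bool, |h * ∑ b ∈ U, boolSign (δ b)| ≤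
      2 * ∑ δ : β → Bool, ‖a + ((h * ∑ b ∈ U, boolSign (δ b) : ℝ) : 𝕜)‖ := by
    rw [Finset.mul_sum]
    refine (Finset.sum_le_sum fun δ _ => h2 _).trans_eq ?_
    rw [Finset.sum_add_distrib, h1]; ring
  have h4 := mul_le_mul_of_nonneg_left (le_sum_abs_sum_boolSign U hM hU) (abs_nonneg h)
  simp only [abs_mul, ← Finset.mul_sum] at h3
  linarith

end Rademacher

/-! ### Functions constant on cells -/

section CellFunctions

variable {𝕜 : Type} [RCLike 𝕜] {p q : ℝ≥0∞} {M₁ M₂ β : Type}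

/-- The function on `M₁ × M₂` which equals `w (i, b)` on the cell `{i} × c⁻¹(b)`, and vanishes at
those columns that `c : M₂ → Option β` assigns to no cell. -/
noncomputable def cellFun (𝕜 : Type) [RCLike 𝕜] (p : ℝ≥0∞) (c : M₂ → Option β) (w : M₁ × β → ℝ) :
    LSpace 𝕜 p (M₁ × M₂) :=
  fun x => (((c x.2).elim 0 fun b => w (x.1, b) : ℝ) : 𝕜)

theorem sum_option_elim [Fintype M₂] [Fintype β] [DecidableEq β] {c : M₂ → Option β} {s : ℕ}
    (hc : ∀ b, (Finset.univ.filter fun j => c j = some b).card = s) (g : β → ℝ) :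
    ∑ j, (c j).elim 0 g = s * ∑ b, g b := by
  have h1 : ∀ j, (c j).elim 0 g = ∑ b, if c j = some b then g b else 0 := by
    intro j
    cases h : c j <;> simp
  simp only [h1]
  rw [Finset.sum_comm, Finset.mul_sum]
  refine Finset.sum_congr rfl fun b _ => ?_
  rw [← Finset.sum_filter, Finset.sum_const, hc, nsmul_eq_mul]

variable [Fintype M₁] [Fintype M₂] [Fintype β] [DecidableEq β]

theorem norm_cellFun_le_one [Nonempty M₁] [Nonempty M₂] (hp1 : 1 ≤ p) (hp : p ≠ ∞)
    {c : M₂ → Option β} {s : ℕ} (hc : ∀ b, (Finset.univ.filter fun j => c j = some b).card = s)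
    {w : M₁ × β → ℝ}
    (hw : s * ∑ x, |w x| ^ p.toReal ≤ Fintype.card M₁ * Fintype.card M₂) :
    ‖cellFun 𝕜 p c w‖ ≤ 1 := by
  have hp0 := LSpace.toReal_pos_of_one_le hp1 hp
  refine LSpace.norm_le_one_of_sum_rpow_le hp1 hp ?_
  rw [Fintype.card_prod, Nat.cast_mul]
  refine le_trans (le_of_eq ?_) hw
  rw [Fintype.sum_prod_type, Fintype.sum_prod_type, Finset.mul_sum]
  refine Finset.sum_congr rfl fun i _ => ?_
  rw [← sum_option_elim hc]
  refine Finset.sum_congr rfl fun j _ => ?_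
  simp only [cellFun]
  rw [RCLike.norm_ofReal]
  cases c j <;> simp [hp0.ne']

variable [Fact (1 ≤ p)]

theorem meanProblem_S_cellFun {c : M₂ → Option β} {s : ℕ}
    (hc : ∀ b, (Finset.univ.filter fun j => c j = some b).card = s) {w : M₁ × β → ℝ}
    {f : Metric.closedBall (0 : LSpace 𝕜 p (M₁ × M₂)) 1} (hf : f.1 = cellFun 𝕜 p c w) (i : M₁) :
    (meanProblem 𝕜 p q M₁ M₂).S f i =
      ((s / Fintype.card M₂ * ∑ b, w (i, b) : ℝ) : 𝕜) := by
  have h : (meanProblem 𝕜 p q M₁ M₂).S f i = (Fintype.card M₂ : 𝕜)⁻¹ * ∑ j : M₂, f.1 (i, j) := rfl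
  rw [h, hf]
  have h2 := sum_option_elim hc fun b => w (i, b)
  have h3 : ∑ j : M₂, cellFun 𝕜 p c w (i, j) = ((s * ∑ b, w (i, b) : ℝ) : 𝕜) := by
    rw [← h2]; push_cast; rfl
  rw [h3]; push_cast; ring

/-- The cell (if any) containing the point at which an information functional is evaluated. -/
noncomputable def cellOf (c : M₂ → Option β) (l : (meanProblem 𝕜 p q M₁ M₂).Λ) : Option (M₁ × β) :=
  (c l.2.choose.2).map fun b => (l.2.choose.1, b)

omit [Fintype β] [DecidableEq β] in
theorem functional_cellFun (c : M₂ → Option β) (l : (meanProblem 𝕜 p q M₁ M₂).Λ)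
    {w : M₁ × β → ℝ} {f : Metric.closedBall (0 : LSpace 𝕜 p (M₁ × M₂)) 1}
    (hf : f.1 = cellFun 𝕜 p c w) : l.1 f = (((cellOf c l).elim 0 w : ℝ) : 𝕜) := by
  have h1 : l.1 f = f.1 l.2.choose := (congrFun l.2.choose_spec f).symm
  rw [h1, hf]
  simp only [cellFun, cellOf]
  cases c l.2.choose.2 <;> rfl

open Classical in
/-- The cells visited by the algorithm `A` on the input `f`. -/
noncomputable def visited (c : M₂ → Option β) (A : DetAlg (meanProblem 𝕜 p q M₁ M₂))
    (f : Metric.closedBall (0 : LSpace 𝕜 p (M₁ × M₂)) 1) : Finset (M₁ × β) :=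
  Finset.univ.filter fun x =>
    ∃ i : ℕ, (i : ℕ∞) < A.card f ∧ cellOf c (A.L i (A.info f i)) = some x

variable {c : M₂ → Option β} {A : DetAlg (meanProblem 𝕜 p q M₁ M₂)}
  {f g : Metric.closedBall (0 : LSpace 𝕜 p (M₁ × M₂)) 1}

omit [DecidableEq β] in
theorem card_visited_le : ((visited c A f).card : ℝ≥0∞) ≤ ((A.card f : ℕ∞) : ℝ≥0∞) := by
  classical
  rcases h : A.card f with _ | n
  · exact le_top
  · have h1 : (visited c A f).map Function.Embedding.some ⊆
        (Finset.range n).image fun i => cellOf c (A.L i (A.info f i)) := by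
      intro x hx
      simp only [visited, Finset.mem_map, Finset.mem_filter, Finset.mem_univ, true_and] at hx
      obtain ⟨y, ⟨i, hi, hy⟩, rfl⟩ := hx
      rw [h] at hi
      exact Finset.mem_image.2 ⟨i, Finset.mem_range.2 (Nat.cast_lt.1 hi), hy⟩
    have h2 := (Finset.card_le_card h1).trans Finset.card_image_le
    rw [Finset.card_map, Finset.card_range] at h2
    change ((visited c A f).card : ℝ≥0∞) ≤ (((n : ℕ) : ℕ∞) : ℝ≥0∞)
    rw [ENat.toENNReal_coe]
    exact_mod_cast h2

omit [DecidableEq β] in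
theorem agree_of_eq_on_visited {w w' : M₁ × β → ℝ} (hf : f.1 = cellFun 𝕜 p c w)
    (hg : g.1 = cellFun 𝕜 p c w') (h : ∀ x ∈ visited c A f, w' x = w x) (i : ℕ)
    (hi : (i : ℕ∞) < A.card f) :
    (A.L i (A.info f i)).1 g = (A.L i (A.info f i)).1 f := by
  rw [functional_cellFun c _ hf, functional_cellFun c _ hg]
  cases hx : cellOf c (A.L i (A.info f i)) with
  | none => rfl
  | some x =>
    simp only [Option.elim_some]
    rw [h x (by simp only [visited, Finset.mem_filter, Finset.mem_univ, true_and]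
                exact ⟨i, hi, hx⟩)]

omit [DecidableEq β] in
/-- The visited cells are determined by the values of the functionals that are evaluated. -/
theorem visited_eq_of_agree (h : ∀ i : ℕ, (i : ℕ∞) < A.card f →
    (A.L i (A.info f i)).1 g = (A.L i (A.info f i)).1 f) : visited c A g = visited c A f := by
  ext x
  simp only [visited, Finset.mem_filter, Finset.mem_univ, true_and]
  refine exists_congr fun i => ?_
  rw [A.card_eq_of_agree h]
  refine and_congr_right fun hi => ?_
  rw [A.info_eq_of_agree h i hi.le]

omit [DecidableEq β] in
theorem visited_eq_of_nonAdaptive (hA : A.NonAdaptive) : visited c A f = visited c A g := by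
  ext x
  simp only [visited, Finset.mem_filter, Finset.mem_univ, true_and]
  refine exists_congr fun i => ?_
  rw [hA.card_eq f g, hA.L_eq f g]

/-- A deterministic algorithm on random signs: in each row the signs in the cells which have not
been visited remain uniformly distributed, given the output, and cause an error. -/
theorem le_sum_error_of_random_signs [Nonempty β] [DecidableEq M₁] {s : ℕ}
    (hc : ∀ b, (Finset.univ.filter fun j => c j = some b).card = s) (h : M₁ → ℝ)
    (F : (M₁ × β → Bool) → Metric.closedBall (0 : LSpace 𝕜 p (M₁ × M₂)) 1)
    (hF : ∀ ε, (F ε).1 = cellFun 𝕜 p c fun x => h x.1 * boolSign (ε x)) (i : M₁) :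
    |h i| * (s / Fintype.card M₂) * (5 / 9) / √(Fintype.card β) *
        (Fintype.card β * Fintype.card (M₁ × β → Bool)) ≤
      ∑ ε, ‖(meanProblem 𝕜 p q M₁ M₂).S (F ε) i - A.out (F ε) i‖ +
      |h i| * (s / Fintype.card M₂) * (5 / 9) / √(Fintype.card β) *
        ∑ ε, (((visited c A (F ε)).filter fun x => x.1 = i).card : ℝ) := by
  set r : ℝ := s / Fintype.card M₂ with hr
  have hr0 : 0 ≤ r := by positivity
  set V : (M₁ × β → Bool) → Finset (M₁ × β) := fun ε => visited c A (F ε) with hV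
  set κ : ℝ := (Fintype.card (M₁ × β → Bool) : ℝ) with hκ
  have hκ0 : 0 < κ := by rw [hκ]; exact_mod_cast Fintype.card_pos
  -- resampling the signs outside the visited cells is an involution on pairs of sign patterns
  let T : (M₁ × β → Bool) → (M₁ × β → Bool) → (M₁ × β → Bool) :=
    fun ε δ x => if x ∈ V ε then ε x else δ x
  let T' : (M₁ × β → Bool) → (M₁ × β → Bool) → (M₁ × β → Bool) :=
    fun ε δ x => if x ∈ V ε then δ x else ε x
  have hagree : ∀ ε δ, ∀ j : ℕ, (j : ℕ∞) < A.card (F ε) →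
      (A.L j (A.info (F ε) j)).1 (F (T ε δ)) = (A.L j (A.info (F ε) j)).1 (F ε) := fun ε δ =>
    agree_of_eq_on_visited (hF ε) (hF _) fun x hx => by
      have : x ∈ V ε := hx
      simp [T, this]
  have hVT : ∀ ε δ, V (T ε δ) = V ε := fun ε δ => visited_eq_of_agree (hagree ε δ)
  have hinv : Function.Involutive fun z : (M₁ × β → Bool) × (M₁ × β → Bool) =>
      (T z.1 z.2, T' z.1 z.2) := by
    rintro ⟨ε, δ⟩
    ext x <;> simp only [T, T', hVT ε δ] <;> by_cases hx : x ∈ V ε <;>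
      simp [hx]
  set err : (M₁ × β → Bool) → ℝ :=
    fun ε => ‖(meanProblem 𝕜 p q M₁ M₂).S (F ε) i - A.out (F ε) i‖ with herr
  have hswap : κ * ∑ ε, err ε = ∑ ε, ∑ δ, err (T ε δ) := by
    have h1 := Equiv.sum_comp (Function.Involutive.toPerm _ hinv)
      fun z : (M₁ × β → Bool) × (M₁ × β → Bool) => err z.1
    rw [Fintype.sum_prod_type, Fintype.sum_prod_type] at h1
    simp only [Function.Involutive.toPerm, Equiv.coe_fn_mk, Finset.sum_const, Finset.card_univ,
      nsmul_eq_mul, ← Finset.mul_sum] at h1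
    exact h1.symm
  have hrow : ∀ ε, |h i| * r * (5 / 9) / √(Fintype.card β) *
      (Fintype.card β - (((V ε).filter fun x => x.1 = i).card : ℝ)) * κ ≤
      ∑ δ, err (T ε δ) := by
    intro ε
    set U : Finset (M₁ × β) := Finset.univ.filter fun x => x.1 = i ∧ x ∉ V ε with hU
    have hrowcard : (Finset.univ.filter fun x : M₁ × β => x.1 = i).card = Fintype.card β := by
      have : (Finset.univ.filter fun x : M₁ × β => x.1 = i) =
          (Finset.univ : Finset β).map (Function.Embedding.sectR i β) := by
        ext ⟨a, b⟩
        simp [eq_comm]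
      rw [this, Finset.card_map, Finset.card_univ]
    have hcardU : U.card + ((V ε).filter fun x => x.1 = i).card = Fintype.card β := by
      rw [← hrowcard, ← Finset.card_filter_add_card_filter_not (s := Finset.univ.filter
        fun x : M₁ × β => x.1 = i) (fun x => x ∉ V ε)]
      congr 1
      · rw [Finset.filter_filter]
      · rw [Finset.filter_filter]
        congr 1
        ext x
        simp [and_comm]
    have hcardU' : (Fintype.card β - (((V ε).filter fun x => x.1 = i).card : ℝ)) = U.card := by
      rw [← hcardU]; push_cast; ring
    have hkh := le_sum_norm_add_sum_boolSign U (M := Fintype.card β) Fintype.card_pos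
      (by omega) (((r * h i * ∑ x ∈ (V ε).filter fun x => x.1 = i, boolSign (ε x) : ℝ) : 𝕜) -
        A.out (F ε) i) (r * h i)
    have hS : ∀ δ, err (T ε δ) = ‖((r * h i * ∑ x ∈ (V ε).filter fun x => x.1 = i,
        boolSign (ε x) : ℝ) : 𝕜) - A.out (F ε) i + ((r * h i * ∑ x ∈ U, boolSign (δ x) : ℝ) : 𝕜)‖ := by
      intro δ
      have e1 : ∑ b, h i * boolSign (T ε δ (i, b)) =
          h i * (∑ x ∈ (V ε).filter fun x => x.1 = i, boolSign (ε x)) +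
          h i * ∑ x ∈ U, boolSign (δ x) := by
        rw [← Finset.mul_sum, ← mul_add]
        congr 1
        have e2 : ∑ b, boolSign (T ε δ (i, b)) =
            ∑ x ∈ Finset.univ.filter fun x : M₁ × β => x.1 = i, boolSign (T ε δ x) := by
          rw [Finset.sum_filter, Fintype.sum_prod_type, Finset.sum_eq_single i]
          · simp
          · intro a _ ha; simp [ha]
          · simp
        rw [e2, ← Finset.sum_filter_add_sum_filter_not _ (fun x => x ∈ V ε)]
        congr 1
        · rw [Finset.filter_filter]
          refine Finset.sum_congr (by ext x; simp [and_comm]) fun x hx => ?_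
          have : x ∈ V ε := (Finset.mem_filter.1 hx).1
          simp [T, this]
        · rw [Finset.filter_filter]
          refine Finset.sum_congr rfl fun x hx => ?_
          have : x ∉ V ε := (Finset.mem_filter.1 hx).2.2
          simp [T, this]
      simp only [herr]
      rw [meanProblem_S_cellFun hc (hF _), ← hr, A.out_eq_of_agree (hagree ε δ), e1]
      congr 1
      push_cast
      ring
    simp only [hS, hcardU']
    refine le_trans (le_of_eq ?_) hkh
    rw [abs_mul, abs_of_nonneg hr0]
    ring
  have hsum := Finset.sum_le_sum fun ε (_ : ε ∈ (Finset.univ : Finset (M₁ × β → Bool))) => hrow ε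
  rw [← hswap, ← Finset.sum_mul, ← Finset.mul_sum, Finset.sum_sub_distrib, Finset.sum_const,
    Finset.card_univ, nsmul_eq_mul, ← hκ, mul_comm κ (∑ ε, err ε)] at hsum
  have := le_of_mul_le_mul_right hsum hκ0
  rw [mul_sub, sub_le_iff_le_add] at this
  linarith

end CellFunctions

open MeasureTheory

/-! ### Averaging over randomized algorithms -/

namespace RanAlg

variable {F G K : Type} [NormedAddCommGroup G] [MeasurableSpace G] [BorelSpace G]
  {P : NumericalProblem F G K}

theorem lintegral_card_le (A : RanAlg P) (f : F) :
    ∫⁻ ω, (((A.alg ω).card f : ℕ∞) : ℝ≥0∞) ∂A.ℙ ≤ A.card :=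
  le_iSup (fun f : F => ∫⁻ ω, (((A.alg ω).card f : ℕ∞) : ℝ≥0∞) ∂A.ℙ) f

theorem lintegral_enorm_le (A : RanAlg P) (f : F) :
    ∫⁻ ω, ‖P.S f - (A.alg ω).out f‖ₑ ∂A.ℙ ≤ A.error :=
  le_iSup (fun f : F => ∫⁻ ω, ‖P.S f - (A.alg ω).out f‖ₑ ∂A.ℙ) f

theorem measurable_enorm (A : RanAlg P) (f : F) :
    Measurable fun ω => ‖P.S f - (A.alg ω).out f‖ₑ :=
  (continuous_const.sub continuous_id).enorm.measurable.comp (A.measurable_out f)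

/-- Averaging: a lower bound on a sum of errors of every `A_ω`, which may degrade linearly in the
cardinality, gives a lower bound on the error. -/
theorem ofReal_le_error {ι : Type*} {n : ℕ} (A : RanAlg P) (hA : A.card ≤ n) (s : Finset ι)
    (F' : ι → F) {κ : Type*} (s' : Finset κ) (G' : κ → F) {a x y k : ℝ}
    (hx : 0 ≤ x) (hy : 0 < y) (hk : 2 * n ≤ k) (hs : a * s.card ≤ y)
    (h : ∀ ω, ENNReal.ofReal (x * (s'.card * k)) ≤
      (∑ i ∈ s, ENNReal.ofReal a * ‖P.S (F' i) - (A.alg ω).out (F' i)‖ₑ) +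
        ENNReal.ofReal x * ∑ i ∈ s', (((A.alg ω).card (G' i) : ℕ∞) : ℝ≥0∞)) :
    ENNReal.ofReal (x * s'.card * k / (2 * y)) ≤ A.error := by
  have h1 : ENNReal.ofReal (x * (s'.card * k)) ≤
      ENNReal.ofReal y * A.error + ENNReal.ofReal (x * (s'.card * n)) := by
    calc ENNReal.ofReal (x * (s'.card * k))
        = ∫⁻ _ω, ENNReal.ofReal (x * (s'.card * k)) ∂A.ℙ := by simp
      _ ≤ ∫⁻ ω, ((∑ i ∈ s, ENNReal.ofReal a * ‖P.S (F' i) - (A.alg ω).out (F' i)‖ₑ) +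
            ENNReal.ofReal x * ∑ i ∈ s', (((A.alg ω).card (G' i) : ℕ∞) : ℝ≥0∞)) ∂A.ℙ :=
          lintegral_mono h
      _ = (∑ i ∈ s, ENNReal.ofReal a * ∫⁻ ω, ‖P.S (F' i) - (A.alg ω).out (F' i)‖ₑ ∂A.ℙ) +
            ENNReal.ofReal x *
              ∑ i ∈ s', ∫⁻ ω, (((A.alg ω).card (G' i) : ℕ∞) : ℝ≥0∞) ∂A.ℙ := by
          have hm1 : ∀ i, Measurable fun ω =>
              ENNReal.ofReal a * ‖P.S (F' i) - (A.alg ω).out (F' i)‖ₑ :=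
            fun i => (A.measurable_enorm _).const_mul _
          have hm2 : ∀ i, Measurable fun ω => (((A.alg ω).card (G' i) : ℕ∞) : ℝ≥0∞) :=
            fun i => A.measurable_card _
          rw [lintegral_add_left (Finset.measurable_sum _ fun i _ => hm1 i),
            lintegral_const_mul _ (Finset.measurable_sum _ fun i _ => hm2 i),
            lintegral_finsetSum _ fun i _ => hm1 i, lintegral_finsetSum _ fun i _ => hm2 i]
          congr 1
          exact Finset.sum_congr rfl fun i _ => lintegral_const_mul _ (A.measurable_enorm _)
      _ ≤ (∑ _i ∈ s, ENNReal.ofReal a * A.error) + ENNReal.ofReal x * ∑ _i ∈ s', (n : ℝ≥0∞) := by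
          gcongr with i _ i _
          · exact A.lintegral_enorm_le _
          · exact (A.lintegral_card_le _).trans hA
      _ ≤ _ := by
          rw [Finset.sum_const, Finset.sum_const, nsmul_eq_mul, nsmul_eq_mul]
          rw [ENNReal.ofReal_mul hx, ENNReal.ofReal_mul (by positivity), ENNReal.ofReal_natCast,
            ENNReal.ofReal_natCast, ← mul_assoc]
          gcongr
          rw [← ENNReal.ofReal_natCast, ← ENNReal.ofReal_mul (by positivity), mul_comm]
          exact ENNReal.ofReal_le_ofReal hs
  rcases eq_or_ne A.error ∞ with he | he
  · rw [he]; exact le_top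
  · rw [← ENNReal.ofReal_toReal he] at h1 ⊢
    rw [← ENNReal.ofReal_mul hy.le, ← ENNReal.ofReal_add (by positivity) (by positivity)] at h1
    refine ENNReal.ofReal_le_ofReal ?_
    have h2 := (ENNReal.ofReal_le_ofReal_iff (by positivity)).1 h1
    rw [div_le_iff₀ (by positivity)]
    have h3 : x * (s'.card * (2 * n)) ≤ x * (s'.card * k) := by gcongr
    linarith

end RanAlg

/-! ### Lower bounds from fooling functions -/

section LowerBounds

variable {𝕜 : Type} [RCLike 𝕜] {p q : ℝ≥0∞} {M₁ M₂ β : Type} [Fintype M₁] [Fintype M₂] [Fintype β]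
  [DecidableEq β] [DecidableEq M₁] [Fact (1 ≤ p)] [Fact (1 ≤ q)] [Nonempty M₁] [Nonempty M₂]
  [Nonempty β]

/-- Adaptive lower bound from a spike `± h` on a single cell: the cell is missed by an algorithm
which visits at most half of the cells on the zero input. -/
theorem le_eRan_of_spike (hp : p ≠ ∞) {c : M₂ → Option β} {s : ℕ}
    (hc : ∀ b, (Finset.univ.filter fun j => c j = some b).card = s) {h : ℝ} (hh : 0 ≤ h)
    (hs : s * h ^ p.toReal ≤ Fintype.card M₁ * Fintype.card M₂) {n : ℕ}
    (hn : 2 * n ≤ Fintype.card M₁ * Fintype.card β) :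
    ENNReal.ofReal ((Fintype.card M₁ : ℝ) ^ (-(q⁻¹).toReal) * (s / Fintype.card M₂ * h) / 2) ≤
      (meanProblem 𝕜 p q M₁ M₂).eRan n := by
  have hp1 : 1 ≤ p := Fact.out
  have hq1 : 1 ≤ q := Fact.out
  have hp0 := LSpace.toReal_pos_of_one_le hp1 hp
  refine le_iInf₂ fun A hA => ?_
  set σ : ℝ := (Fintype.card M₁ : ℝ) ^ (-(q⁻¹).toReal) * (s / Fintype.card M₂ * h) with hσ
  have hσ0 : 0 ≤ σ := by positivity
  set B : ℝ := ((Fintype.card (M₁ × β) : ℕ) : ℝ) with hB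
  have hB0 : 0 < B := by rw [hB]; exact_mod_cast Fintype.card_pos
  have hmem : ∀ (u : M₁ × β) (t : ℝ), |t| = h →
      cellFun 𝕜 p c (Pi.single u t) ∈ Metric.closedBall (0 : LSpace 𝕜 p (M₁ × M₂)) 1 := by
    intro u t ht
    rw [mem_closedBall_zero_iff]
    refine norm_cellFun_le_one hp1 hp hc ?_
    rw [Finset.sum_eq_single u]
    · simpa [ht] using hs
    · intro v _ hv
      simp [Pi.single_eq_of_ne hv, hp0.ne']
    · simp
  set Fp : M₁ × β → Metric.closedBall (0 : LSpace 𝕜 p (M₁ × M₂)) 1 := fun u =>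
    ⟨cellFun 𝕜 p c (Pi.single u h), hmem u h (abs_of_nonneg hh)⟩ with hFp
  set Fm : M₁ × β → Metric.closedBall (0 : LSpace 𝕜 p (M₁ × M₂)) 1 := fun u =>
    ⟨cellFun 𝕜 p c (Pi.single u (-h)), hmem u (-h) (by rw [abs_neg, abs_of_nonneg hh])⟩ with hFm
  have h0mem : cellFun 𝕜 p c (0 : M₁ × β → ℝ) ∈
      Metric.closedBall (0 : LSpace 𝕜 p (M₁ × M₂)) 1 := by
    rw [mem_closedBall_zero_iff]
    exact norm_cellFun_le_one hp1 hp hc (by simp [hp0.ne']; positivity)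
  set f₀ : Metric.closedBall (0 : LSpace 𝕜 p (M₁ × M₂)) 1 := ⟨_, h0mem⟩ with hf₀
  have key : ∀ ω, ENNReal.ofReal (2 * σ * ((({f₀} : Finset _).card : ℕ) * B)) ≤
      (∑ u ∈ (Finset.univ : Finset ((M₁ × β) × Bool)), ENNReal.ofReal 1 *
        ‖(meanProblem 𝕜 p q M₁ M₂).S (bif u.2 then Fp u.1 else Fm u.1) -
          (A.alg ω).out (bif u.2 then Fp u.1 else Fm u.1)‖ₑ) +
        ENNReal.ofReal (2 * σ) *
          ∑ f ∈ ({f₀} : Finset _), (((A.alg ω).card f : ℕ∞) : ℝ≥0∞) := by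
    intro ω
    rw [Finset.sum_singleton, Finset.card_singleton, Nat.cast_one, one_mul,
      ← Finset.univ_product_univ, Finset.sum_product]
    simp only [ENNReal.ofReal_one, one_mul, Fintype.sum_bool, cond_true, cond_false]
    set V := visited c (A.alg ω) f₀ with hV
    have hmiss : ∀ u ∉ V, ENNReal.ofReal (2 * σ) ≤
        ‖(meanProblem 𝕜 p q M₁ M₂).S (Fp u) - (A.alg ω).out (Fp u)‖ₑ +
          ‖(meanProblem 𝕜 p q M₁ M₂).S (Fm u) - (A.alg ω).out (Fm u)‖ₑ := by
      intro u hu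
      have hne : ∀ x ∈ V, x ≠ u := fun x hx e => hu (e ▸ hx)
      have e1 : (A.alg ω).out (Fp u) = (A.alg ω).out f₀ :=
        (A.alg ω).out_eq_of_agree (agree_of_eq_on_visited rfl rfl fun x hx => by
          simp [Pi.single_eq_of_ne (hne x hx)])
      have e2 : (A.alg ω).out (Fm u) = (A.alg ω).out f₀ :=
        (A.alg ω).out_eq_of_agree (agree_of_eq_on_visited rfl rfl fun x hx => by
          simp [Pi.single_eq_of_ne (hne x hx)])
      rw [e1, e2, ← ofReal_norm, ← ofReal_norm, ← ENNReal.ofReal_add (norm_nonneg _) (norm_nonneg _)]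
      refine ENNReal.ofReal_le_ofReal ?_
      have h1 := norm_sub_le ((meanProblem 𝕜 p q M₁ M₂).S (Fp u) - (A.alg ω).out f₀)
        ((meanProblem 𝕜 p q M₁ M₂).S (Fm u) - (A.alg ω).out f₀)
      have h2 := LSpace.rpow_mul_norm_apply_le hq1 ((meanProblem 𝕜 p q M₁ M₂).S (Fp u) -
        (A.alg ω).out f₀ - ((meanProblem 𝕜 p q M₁ M₂).S (Fm u) - (A.alg ω).out f₀)) u.1
      have h3 : ((meanProblem 𝕜 p q M₁ M₂).S (Fp u) - (A.alg ω).out f₀ -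
          ((meanProblem 𝕜 p q M₁ M₂).S (Fm u) - (A.alg ω).out f₀)) u.1 =
          ((2 * (s / Fintype.card M₂ * h) : ℝ) : 𝕜) := by
        rw [sub_sub_sub_cancel_right]
        change (meanProblem 𝕜 p q M₁ M₂).S (Fp u) u.1 - (meanProblem 𝕜 p q M₁ M₂).S (Fm u) u.1 = _
        rw [meanProblem_S_cellFun hc rfl, meanProblem_S_cellFun hc rfl]
        have e3 : ∀ t : ℝ, ∑ b, (Pi.single u t : M₁ × β → ℝ) (u.1, b) = t := by
          intro t
          rw [Finset.sum_eq_single u.2]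
          · simp
          · intro b _ hb
            exact Pi.single_eq_of_ne (fun e => hb (congrArg Prod.snd e)) _
          · simp
        rw [e3, e3]
        push_cast; ring
      rw [h3, RCLike.norm_ofReal, abs_of_nonneg (by positivity)] at h2
      have h4 : (Fintype.card M₁ : ℝ) ^ (-(q⁻¹).toReal) * (2 * (s / Fintype.card M₂ * h)) =
        2 * σ := by rw [hσ]; ring
      rw [h4] at h2
      exact h2.trans h1
    calc ENNReal.ofReal (2 * σ * B)
        = ENNReal.ofReal (2 * σ) * ((Finset.univ \ V).card + V.card : ℝ≥0∞) := by
          rw [ENNReal.ofReal_mul (by positivity), hB, ENNReal.ofReal_natCast]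
          congr 1
          have h1 := Finset.card_sdiff_add_card_eq_card (Finset.subset_univ V)
          rw [Finset.card_univ] at h1
          exact_mod_cast h1.symm
      _ = ∑ u ∈ Finset.univ \ V, ENNReal.ofReal (2 * σ) + ENNReal.ofReal (2 * σ) * V.card := by
          rw [Finset.sum_const, nsmul_eq_mul, mul_add, mul_comm]
      _ ≤ ∑ u ∈ Finset.univ \ V,
          (‖(meanProblem 𝕜 p q M₁ M₂).S (Fp u) - (A.alg ω).out (Fp u)‖ₑ +
          ‖(meanProblem 𝕜 p q M₁ M₂).S (Fm u) - (A.alg ω).out (Fm u)‖ₑ) +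
          ENNReal.ofReal (2 * σ) * (((A.alg ω).card f₀ : ℕ∞) : ℝ≥0∞) := by
          gcongr with u hu
          · exact hmiss u (Finset.mem_sdiff.1 hu).2
          · exact card_visited_le
      _ ≤ _ := by
          gcongr
          exact Finset.subset_univ _
  have := A.ofReal_le_error hA Finset.univ
    (fun u : (M₁ × β) × Bool => bif u.2 then Fp u.1 else Fm u.1)
    {f₀} id (a := 1) (x := 2 * σ) (y := 2 * B) (k := B) (by positivity) (by positivity)
    (by rw [hB, Fintype.card_prod]; exact_mod_cast hn)
    (by rw [Finset.card_univ, Fintype.card_prod, Fintype.card_bool, hB]; push_cast; linarith) key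
  refine le_trans (ENNReal.ofReal_le_ofReal (le_of_eq ?_)) this
  rw [Finset.card_singleton]
  field_simp
  norm_num

omit [DecidableEq M₁] in
theorem norm_cellFun_sign_le_one (hp : p ≠ ∞) {c : M₂ → Option β} {s : ℕ}
    (hc : ∀ b, (Finset.univ.filter fun j => c j = some b).card = s) (h : M₁ → ℝ)
    (hh : ∑ i, |h i| ^ p.toReal ≤ Fintype.card M₁)
    (hs : s * Fintype.card β ≤ Fintype.card M₂) (ε : M₁ × β → Bool) :
    cellFun 𝕜 p c (fun x => h x.1 * boolSign (ε x)) ∈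
      Metric.closedBall (0 : LSpace 𝕜 p (M₁ × M₂)) 1 := by
  rw [mem_closedBall_zero_iff]
  refine norm_cellFun_le_one Fact.out hp hc ?_
  simp only [abs_mul, abs_boolSign, mul_one]
  rw [Fintype.sum_prod_type]
  simp only [Finset.sum_const, Finset.card_univ, nsmul_eq_mul]
  rw [← Finset.mul_sum, ← mul_assoc, mul_comm]
  have hs' : (s : ℝ) * Fintype.card β ≤ Fintype.card M₂ := by exact_mod_cast hs
  have : 0 ≤ ∑ i, |h i| ^ p.toReal := Finset.sum_nonneg fun i _ => by positivity
  gcongr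

/-- Adaptive lower bound from random signs on all cells. -/
theorem le_eRan_of_signs (hp : p ≠ ∞) {c : M₂ → Option β} {s : ℕ}
    (hc : ∀ b, (Finset.univ.filter fun j => c j = some b).card = s)
    (hs : s * Fintype.card β ≤ Fintype.card M₂) {n : ℕ}
    (hn : 2 * n ≤ Fintype.card M₁ * Fintype.card β) :
    ENNReal.ofReal (5 / 18 * (s / Fintype.card M₂) * √(Fintype.card β)) ≤
      (meanProblem 𝕜 p q M₁ M₂).eRan n := by
  have hq1 : 1 ≤ q := Fact.out
  refine le_iInf₂ fun A hA => ?_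
  set F : (M₁ × β → Bool) → Metric.closedBall (0 : LSpace 𝕜 p (M₁ × M₂)) 1 := fun ε =>
    ⟨cellFun 𝕜 p c fun x => (1 : M₁ → ℝ) x.1 * boolSign (ε x),
      norm_cellFun_sign_le_one hp hc 1 (by simp) hs ε⟩ with hF
  set w : ℝ := s / Fintype.card M₂ * (5 / 9) / √(Fintype.card β) with hw
  have hw0 : 0 ≤ w := by positivity
  set N : ℝ := (Fintype.card M₁ : ℝ) with hN
  have hN0 : 0 < N := by rw [hN]; exact_mod_cast Fintype.card_pos
  set b : ℝ := (Fintype.card β : ℝ) with hb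
  have hb0 : 0 < b := by rw [hb]; exact_mod_cast Fintype.card_pos
  set κ : ℝ := (Fintype.card (M₁ × β → Bool) : ℝ) with hκ
  have hκ0 : 0 < κ := by rw [hκ]; exact_mod_cast Fintype.card_pos
  have key : ∀ ω, ENNReal.ofReal (w * (((Finset.univ : Finset (M₁ × β → Bool)).card : ℕ) *
      (N * b))) ≤ (∑ ε, ENNReal.ofReal N * ‖(meanProblem 𝕜 p q M₁ M₂).S (F ε) -
        (A.alg ω).out (F ε)‖ₑ) + ENNReal.ofReal w *
          ∑ ε, (((A.alg ω).card (F ε) : ℕ∞) : ℝ≥0∞) := by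
    intro ω
    have h1 := Finset.sum_le_sum fun i (_ : i ∈ (Finset.univ : Finset M₁)) =>
      le_sum_error_of_random_signs (A := A.alg ω) hc 1 F (fun ε => rfl) i
    simp only [Pi.one_apply, abs_one, one_mul] at h1
    rw [← hw, Finset.sum_const, Finset.card_univ, nsmul_eq_mul, Finset.sum_add_distrib,
      ← Finset.mul_sum, Finset.sum_comm, Finset.sum_comm (s := Finset.univ) (t := Finset.univ)
        (f := fun i ε => (((visited c (A.alg ω) (F ε)).filter fun x => x.1 = i).card : ℝ))] at h1
    have h2 : ∀ ε, ∑ i, (((visited c (A.alg ω) (F ε)).filter fun x => x.1 = i).card : ℝ) =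
        ((visited c (A.alg ω) (F ε)).card : ℝ) := by
      intro ε
      rw [Finset.card_eq_sum_card_fiberwise (f := Prod.fst) (t := Finset.univ)
        (fun x _ => Finset.mem_coe.2 (Finset.mem_univ _))]
      push_cast; rfl
    have h3 : ∀ ε, ∑ i, ‖(meanProblem 𝕜 p q M₁ M₂).S (F ε) i - (A.alg ω).out (F ε) i‖ ≤
        N * ‖(meanProblem 𝕜 p q M₁ M₂).S (F ε) - (A.alg ω).out (F ε)‖ := fun ε =>
      LSpace.sum_norm_le hq1 ((meanProblem 𝕜 p q M₁ M₂).S (F ε) - (A.alg ω).out (F ε))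
    simp only [h2] at h1
    have h4 := Finset.sum_le_sum fun ε (_ : ε ∈ (Finset.univ : Finset (M₁ × β → Bool))) => h3 ε
    calc ENNReal.ofReal (w * (((Finset.univ : Finset (M₁ × β → Bool)).card : ℕ) * (N * b)))
        ≤ ENNReal.ofReal ((∑ ε, N * ‖(meanProblem 𝕜 p q M₁ M₂).S (F ε) - (A.alg ω).out (F ε)‖) +
          w * ∑ ε, ((visited c (A.alg ω) (F ε)).card : ℝ)) := by
          refine ENNReal.ofReal_le_ofReal ?_
          rw [Finset.card_univ]
          linarith
      _ = (∑ ε, ENNReal.ofReal N * ‖(meanProblem 𝕜 p q M₁ M₂).S (F ε) - (A.alg ω).out (F ε)‖ₑ) +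
          ENNReal.ofReal w * ∑ ε, ((visited c (A.alg ω) (F ε)).card : ℝ≥0∞) := by
          rw [ENNReal.ofReal_add (Finset.sum_nonneg fun _ _ => by positivity)
            (mul_nonneg hw0 (Finset.sum_nonneg fun _ _ => by positivity)),
            ENNReal.ofReal_sum_of_nonneg fun _ _ => by positivity, ENNReal.ofReal_mul hw0,
            ENNReal.ofReal_sum_of_nonneg fun _ _ => by positivity]
          simp only [ENNReal.ofReal_mul hN0.le, ofReal_norm, ENNReal.ofReal_natCast]
      _ ≤ _ := by
          gcongr with ε _
          exact card_visited_le
  have := A.ofReal_le_error hA Finset.univ F Finset.univ F (a := N) (x := w) (y := N * κ)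
    (k := N * b) hw0 (by positivity) (by rw [hN, hb]; exact_mod_cast hn)
    (by rw [Finset.card_univ]) key
  refine le_trans (ENNReal.ofReal_le_ofReal (le_of_eq ?_)) this
  rw [Finset.card_univ, ← hκ, hw]
  have hsb : √b ^ 2 = b := Real.sq_sqrt hb0.le
  have hsb0 : 0 < √b := Real.sqrt_pos.2 hb0
  field_simp
  rw [hsb]; ring

/-- Non-adaptive lower bound: random signs in a single, unknown row, scaled to norm one. -/
theorem le_eRanNon_of_signs (hp : p ≠ ∞) {c : M₂ → Option β} {s : ℕ}
    (hc : ∀ b, (Finset.univ.filter fun j => c j = some b).card = s)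
    (hs : s * Fintype.card β ≤ Fintype.card M₂) {n : ℕ}
    (hn : 2 * n ≤ Fintype.card M₁ * Fintype.card β) :
    ENNReal.ofReal ((Fintype.card M₁ : ℝ) ^ ((p⁻¹).toReal - (q⁻¹).toReal) *
      (5 / 18 * (s / Fintype.card M₂) * √(Fintype.card β))) ≤
      (meanProblem 𝕜 p q M₁ M₂).eRanNon n := by
  have hp1 : 1 ≤ p := Fact.out
  have hq1 : 1 ≤ q := Fact.out
  have hp0 := LSpace.toReal_pos_of_one_le hp1 hp
  refine le_iInf fun A => le_iInf₂ fun hnon hA => ?_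
  set N : ℝ := (Fintype.card M₁ : ℝ) with hN
  have hN0 : 0 < N := by rw [hN]; exact_mod_cast Fintype.card_pos
  -- the largest height admitted by the unit ball for a function supported on one row
  set H : ℝ := N ^ (p⁻¹).toReal with hH
  have hH0 : 0 < H := by positivity
  have hHp : H ^ p.toReal = N := by
    rw [hH, ENNReal.toReal_inv]
    exact Real.rpow_inv_rpow hN0.le hp0.ne'
  have hsum : ∀ i : M₁, ∑ i', |(Pi.single i H : M₁ → ℝ) i'| ^ p.toReal ≤ N := by
    intro i
    rw [Finset.sum_eq_single i]
    · rw [Pi.single_eq_same, abs_of_pos hH0, hHp]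
    · intro v _ hv
      simp [Pi.single_eq_of_ne hv, hp0.ne']
    · simp
  set F : M₁ × (M₁ × β → Bool) → Metric.closedBall (0 : LSpace 𝕜 p (M₁ × M₂)) 1 := fun z =>
    ⟨cellFun 𝕜 p c fun x => (Pi.single z.1 H : M₁ → ℝ) x.1 * boolSign (z.2 x),
      norm_cellFun_sign_le_one hp hc _ (hsum z.1) hs z.2⟩ with hF
  set w : ℝ := H * (s / Fintype.card M₂) * (5 / 9) / √(Fintype.card β) with hw
  have hw0 : 0 ≤ w := by positivity
  set b : ℝ := (Fintype.card β : ℝ) with hb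
  have hb0 : 0 < b := by rw [hb]; exact_mod_cast Fintype.card_pos
  set κ : ℝ := (Fintype.card (M₁ × β → Bool) : ℝ) with hκ
  have hκ0 : 0 < κ := by rw [hκ]; exact_mod_cast Fintype.card_pos
  set Q : ℝ := N ^ (q⁻¹).toReal with hQ
  have hQ0 : 0 < Q := by positivity
  obtain ⟨i₀⟩ := ‹Nonempty M₁›
  have key : ∀ ω, ENNReal.ofReal (w * (((Finset.univ : Finset (M₁ × β → Bool)).card : ℕ) *
      (N * b))) ≤ (∑ z, ENNReal.ofReal Q * ‖(meanProblem 𝕜 p q M₁ M₂).S (F z) -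
        (A.alg ω).out (F z)‖ₑ) + ENNReal.ofReal w *
          ∑ ε, (((A.alg ω).card (F (i₀, ε)) : ℕ∞) : ℝ≥0∞) := by
    intro ω
    have h1 := Finset.sum_le_sum fun i (_ : i ∈ (Finset.univ : Finset M₁)) =>
      le_sum_error_of_random_signs (A := A.alg ω) hc (Pi.single i H) (fun ε => F (i, ε))
        (fun ε => rfl) i
    simp only [Pi.single_eq_same, abs_of_pos hH0] at h1
    -- the visited cells do not depend on the input
    have hvis : ∀ i ε, visited c (A.alg ω) (F (i, ε)) = visited c (A.alg ω) (F (i₀, ε)) :=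
      fun i ε => visited_eq_of_nonAdaptive (hnon ω)
    simp only [hvis] at h1
    rw [← hw, Finset.sum_const, Finset.card_univ, nsmul_eq_mul, Finset.sum_add_distrib,
      ← Finset.mul_sum, Finset.sum_comm (s := Finset.univ) (t := Finset.univ)
        (f := fun i ε => (((visited c (A.alg ω) (F (i₀, ε))).filter
          fun x => x.1 = i).card : ℝ))] at h1
    have h2 : ∀ ε, ∑ i, (((visited c (A.alg ω) (F (i₀, ε))).filter fun x => x.1 = i).card : ℝ) =
        ((visited c (A.alg ω) (F (i₀, ε))).card : ℝ) := by
      intro ε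
      rw [Finset.card_eq_sum_card_fiberwise (f := Prod.fst) (t := Finset.univ)
        (fun x _ => Finset.mem_coe.2 (Finset.mem_univ _))]
      push_cast; rfl
    have h3 : ∀ i ε, ‖(meanProblem 𝕜 p q M₁ M₂).S (F (i, ε)) i - (A.alg ω).out (F (i, ε)) i‖ ≤
        Q * ‖(meanProblem 𝕜 p q M₁ M₂).S (F (i, ε)) - (A.alg ω).out (F (i, ε))‖ := by
      intro i ε
      have h4 := LSpace.rpow_mul_norm_apply_le hq1
        ((meanProblem 𝕜 p q M₁ M₂).S (F (i, ε)) - (A.alg ω).out (F (i, ε))) i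
      rw [Real.rpow_neg hN0.le, inv_mul_le_iff₀ hQ0] at h4
      exact h4
    simp only [h2] at h1
    have h4 := Finset.sum_le_sum fun i (_ : i ∈ (Finset.univ : Finset M₁)) =>
      Finset.sum_le_sum fun ε (_ : ε ∈ (Finset.univ : Finset (M₁ × β → Bool))) => h3 i ε
    calc ENNReal.ofReal (w * (((Finset.univ : Finset (M₁ × β → Bool)).card : ℕ) * (N * b)))
        ≤ ENNReal.ofReal ((∑ z, Q * ‖(meanProblem 𝕜 p q M₁ M₂).S (F z) - (A.alg ω).out (F z)‖) +
          w * ∑ ε, ((visited c (A.alg ω) (F (i₀, ε))).card : ℝ)) := by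
          refine ENNReal.ofReal_le_ofReal ?_
          rw [Finset.card_univ, Fintype.sum_prod_type]
          linarith
      _ = (∑ z, ENNReal.ofReal Q * ‖(meanProblem 𝕜 p q M₁ M₂).S (F z) - (A.alg ω).out (F z)‖ₑ) +
          ENNReal.ofReal w * ∑ ε, ((visited c (A.alg ω) (F (i₀, ε))).card : ℝ≥0∞) := by
          rw [ENNReal.ofReal_add (Finset.sum_nonneg fun _ _ => by positivity)
            (mul_nonneg hw0 (Finset.sum_nonneg fun _ _ => by positivity)),
            ENNReal.ofReal_sum_of_nonneg fun _ _ => by positivity, ENNReal.ofReal_mul hw0,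
            ENNReal.ofReal_sum_of_nonneg fun _ _ => by positivity]
          simp only [ENNReal.ofReal_mul hQ0.le, ofReal_norm, ENNReal.ofReal_natCast]
      _ ≤ _ := by
          gcongr with ε _
          exact card_visited_le
  have := A.ofReal_le_error hA Finset.univ F Finset.univ (fun ε => F (i₀, ε)) (a := Q) (x := w)
    (y := Q * (N * κ)) (k := N * b) hw0 (by positivity)
    (by rw [hN, hb]; exact_mod_cast hn)
    (by rw [Finset.card_univ, Fintype.card_prod, Nat.cast_mul]) key
  refine le_trans (ENNReal.ofReal_le_ofReal (le_of_eq ?_)) this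
  rw [Finset.card_univ, ← hκ, hw, Real.rpow_sub hN0, ← hH, ← hQ]
  have hsb : √b ^ 2 = b := Real.sq_sqrt hb0.le
  have hsb0 : 0 < √b := Real.sqrt_pos.2 hb0
  field_simp
  rw [hsb]; ring

end LowerBounds

/-! ### Lower bounds in terms of `n`, `N₁` and `N₂` -/

section Blocks

/-- The partition of (an initial segment of) `Fin N` into `M` blocks of length `s`. -/
def blockOf (N M s : ℕ) (j : Fin N) : Option (Fin M) :=
  if h : (j : ℕ) / s < M then some ⟨(j : ℕ) / s, h⟩ else none

theorem card_blockOf {N M s : ℕ} (hs : 0 < s) (h : s * M ≤ N) (b : Fin M) :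
    (Finset.univ.filter fun j => blockOf N M s j = some b).card = s := by
  have hb : (b : ℕ) * s + s ≤ N := by
    have := Nat.mul_le_mul_left s (Nat.succ_le_of_lt b.2)
    calc (b : ℕ) * s + s = s * (b + 1) := by ring
      _ ≤ s * M := this
      _ ≤ N := h
  have h1 : ∀ j : Fin N, blockOf N M s j = some b ↔ (j : ℕ) / s = b := by
    intro j
    unfold blockOf
    split_ifs with hj
    · simp [Fin.ext_iff]
    · simp only [false_iff]
      intro e
      exact hj (e ▸ b.2)
  simp only [h1]
  have h2 : (Finset.univ.filter fun j : Fin N => (j : ℕ) / s = b) =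
      (Finset.univ : Finset (Fin s)).image fun l : Fin s => (⟨b * s + l, by omega⟩ : Fin N) := by
    ext j
    simp only [Finset.mem_filter, Finset.mem_univ, true_and, Finset.mem_image]
    rw [Nat.div_eq_iff hs]
    constructor
    · rintro ⟨h1, h2⟩
      exact ⟨⟨j - b * s, by omega⟩, Fin.ext (by simp only; omega)⟩
    · rintro ⟨l, rfl⟩
      have := l.2
      constructor <;> simp only <;> omega
  rw [h2, Finset.card_image_of_injective _ fun l l' e =>
    Fin.ext (Nat.add_left_cancel (Fin.mk.inj_iff.1 e)), Finset.card_univ, Fintype.card_fin]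

/-- The block length `s` and the number `M` of blocks used in the lower bounds: at least `2 n / N₁`
and at most `3 n / N₁` blocks per row, covering at least half of the columns. -/
theorem exists_blocks {n N₁ N₂ : ℕ} (hN₁ : 1 ≤ N₁) (hn : N₁ ≤ n) (h : 8 * n ≤ N₁ * N₂) :
    ∃ M s : ℕ, 1 ≤ M ∧ 1 ≤ s ∧ s * M ≤ N₂ ∧ N₂ ≤ 2 * s * M ∧ 2 * n ≤ N₁ * M ∧
      N₁ * M ≤ 3 * n := by
  have h1 : 2 * n ≤ N₁ * (2 * n / N₁ + 1) := (Nat.lt_mul_div_succ _ (by omega)).le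
  have h2 : N₁ * (2 * n / N₁) ≤ 2 * n := Nat.mul_div_le _ _
  set M := 2 * n / N₁ + 1 with hM
  have h3 : N₁ * M ≤ 3 * n := by rw [hM, mul_add]; omega
  have hMN : M ≤ N₂ := Nat.le_of_mul_le_mul_left (by omega : N₁ * M ≤ N₁ * N₂) (by omega)
  have hM1 : 1 ≤ M := Nat.le_add_left 1 _
  have hs1 : 1 ≤ N₂ / M := Nat.div_pos hMN hM1
  have h4 : N₂ < M * (N₂ / M + 1) := Nat.lt_mul_div_succ _ hM1
  refine ⟨M, N₂ / M, hM1, hs1, Nat.div_mul_le_self _ _, ?_, h1, h3⟩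
  have : M * 1 ≤ M * (N₂ / M) := Nat.mul_le_mul_left _ hs1
  calc N₂ ≤ M * (N₂ / M) + M * 1 := by rw [← mul_add]; exact h4.le
    _ ≤ M * (N₂ / M) + M * (N₂ / M) := by omega
    _ = _ := by ring

variable {𝕜 : Type} [RCLike 𝕜] {p q : ℝ≥0∞} [Fact (1 ≤ p)] [Fact (1 ≤ q)] {n N₁ N₂ : ℕ}

/-- The adaptive lower bound which dominates if there are many rows. -/
theorem le_eRan_spike (hp : p ≠ ∞) (hN₁ : 1 ≤ N₁) (hn : N₁ ≤ n) (h : 8 * n ≤ N₁ * N₂) :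
    ENNReal.ofReal (1 / 12 * (N₁ : ℝ) ^ ((p⁻¹).toReal - (q⁻¹).toReal) *
      ((n : ℝ) / N₁) ^ (-(1 - (p⁻¹).toReal))) ≤
      (meanProblem 𝕜 p q (Fin N₁) (Fin N₂)).eRan n := by
  have hp1 : 1 ≤ p := Fact.out
  have hp0 := LSpace.toReal_pos_of_one_le hp1 hp
  obtain ⟨M, s, hM, hs, hsM, hN₂, hnM, hMn⟩ := exists_blocks hN₁ hn h
  have hN₂' : 1 ≤ N₂ := le_trans (Nat.mul_pos hs hM) hsM
  have : Nonempty (Fin N₁) := ⟨⟨0, hN₁⟩⟩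
  have : Nonempty (Fin N₂) := ⟨⟨0, hN₂'⟩⟩
  have : Nonempty (Fin M) := ⟨⟨0, hM⟩⟩
  have hN : (0 : ℝ) < N₁ := by exact_mod_cast hN₁
  have hN2 : (0 : ℝ) < N₂ := by exact_mod_cast hN₂'
  have hs0 : (0 : ℝ) < s := by exact_mod_cast hs
  have hM0 : (0 : ℝ) < M := by exact_mod_cast hM
  have hn0 : (0 : ℝ) < n := by exact_mod_cast (by omega : 0 < n)
  set u : ℝ := (p⁻¹).toReal with hu
  have hu0 : 0 < u := by rw [hu, ENNReal.toReal_inv]; positivity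
  have hu1 : u ≤ 1 := by
    rw [hu, ENNReal.toReal_inv]; exact inv_le_one_of_one_le₀ (LSpace.one_le_toReal hp1 hp)
  have hpow : ((N₁ * N₂ / s : ℝ) ^ u) ^ p.toReal = N₁ * N₂ / s := by
    rw [hu, ENNReal.toReal_inv]
    exact Real.rpow_inv_rpow (by positivity) hp0.ne'
  have key := le_eRan_of_spike (𝕜 := 𝕜) (p := p) (q := q) (M₁ := Fin N₁) (M₂ := Fin N₂)
    (β := Fin M) hp (card_blockOf hs hsM) (h := (N₁ * N₂ / s : ℝ) ^ u) (by positivity)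
    (by rw [hpow, Fintype.card_fin, Fintype.card_fin]; field_simp; exact le_refl _) (n := n)
    (by simpa using hnM)
  refine le_trans (ENNReal.ofReal_le_ofReal ?_) key
  rw [Fintype.card_fin, Fintype.card_fin]
  have e1 : (N₁ : ℝ) ^ (-(q⁻¹).toReal) * (s / N₂ * (N₁ * N₂ / s : ℝ) ^ u) / 2 =
      1 / 2 * (N₁ : ℝ) ^ (u - (q⁻¹).toReal) * (N₂ / s : ℝ) ^ (-(1 - u)) := by
    have e2 : (N₁ * N₂ / s : ℝ) = N₁ * (N₂ / s) := by ring
    have e3 : (N₂ / s : ℝ) ^ (-(1 - u)) = s / N₂ * (N₂ / s : ℝ) ^ u := by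
      rw [show -(1 - u) = -1 + u by ring, Real.rpow_add (by positivity), Real.rpow_neg_one, inv_div]
    rw [e2, e3, Real.mul_rpow (by positivity) (by positivity), sub_eq_add_neg u,
      Real.rpow_add hN]
    ring
  rw [e1]
  have h6 : (N₂ / s : ℝ) ≤ 6 * (n / N₁) := by
    have a1 : (N₂ : ℝ) ≤ 2 * s * M := by exact_mod_cast hN₂
    have a2 : (N₁ : ℝ) * M ≤ 3 * n := by exact_mod_cast hMn
    rw [div_le_iff₀ hs0, ← mul_div_assoc, div_mul_eq_mul_div, le_div_iff₀ hN]
    nlinarith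
  have h7 : (6 * (n / N₁) : ℝ) ^ (-(1 - u)) ≤ (N₂ / s : ℝ) ^ (-(1 - u)) :=
    Real.rpow_le_rpow_of_nonpos (by positivity) h6 (by linarith)
  have h8 : (1 / 6 : ℝ) ≤ (6 : ℝ) ^ (-(1 - u)) := by
    have := Real.rpow_le_rpow_of_exponent_le (by norm_num : (1 : ℝ) ≤ 6)
      (by linarith : -1 ≤ -(1 - u))
    rw [Real.rpow_neg_one] at this
    linarith
  rw [Real.mul_rpow (by norm_num) (by positivity)] at h7
  calc 1 / 12 * (N₁ : ℝ) ^ (u - (q⁻¹).toReal) * ((n : ℝ) / N₁) ^ (-(1 - u))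
      = 1 / 2 * (N₁ : ℝ) ^ (u - (q⁻¹).toReal) * (1 / 6 * ((n : ℝ) / N₁) ^ (-(1 - u))) := by ring
    _ ≤ 1 / 2 * (N₁ : ℝ) ^ (u - (q⁻¹).toReal) *
        ((6 : ℝ) ^ (-(1 - u)) * ((n : ℝ) / N₁) ^ (-(1 - u))) := by gcongr
    _ ≤ _ := by gcongr

theorem block_sqrt_bound {M s : ℕ} (hN₁ : 1 ≤ N₁) (hn : N₁ ≤ n) (hM : 1 ≤ M) (hs : 1 ≤ s)
    (hN₂ : N₂ ≤ 2 * s * M) (hN₂' : 1 ≤ N₂) (hMn : N₁ * M ≤ 3 * n) :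
    1 / 18 * ((n : ℝ) / N₁) ^ (-(1 / 2) : ℝ) ≤ 5 / 18 * (s / N₂) * √M := by
  have hN : (0 : ℝ) < N₁ := by exact_mod_cast hN₁
  have hN2 : (0 : ℝ) < N₂ := by exact_mod_cast hN₂'
  have hs0 : (0 : ℝ) < s := by exact_mod_cast hs
  have hM0 : (0 : ℝ) < M := by exact_mod_cast hM
  have hn0 : (0 : ℝ) < n := by exact_mod_cast (by omega : 0 < n)
  have hm0 : (0 : ℝ) < n / N₁ := by positivity
  rw [Real.rpow_neg hm0.le, ← Real.sqrt_eq_rpow]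
  have a1 : (N₂ : ℝ) ≤ 2 * s * M := by exact_mod_cast hN₂
  have a2 : (N₁ : ℝ) * M ≤ 3 * n := by exact_mod_cast hMn
  have a3 : (M : ℝ) ≤ 4 * (n / N₁) := by
    rw [← mul_div_assoc, le_div_iff₀ hN]; nlinarith
  have a4 : √(M : ℝ) ≤ 2 * √(n / N₁ : ℝ) := by
    calc √(M : ℝ) ≤ √(4 * (n / N₁)) := Real.sqrt_le_sqrt a3
      _ = _ := by
        rw [Real.sqrt_mul (by norm_num)]
        congr 1
        rw [show (4 : ℝ) = 2 ^ 2 by norm_num, Real.sqrt_sq (by norm_num)]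
  have hm : 0 < √(n / N₁ : ℝ) := Real.sqrt_pos.2 hm0
  have hsM : 0 < √(M : ℝ) := Real.sqrt_pos.2 hM0
  have a5 : 1 / (2 * √(M : ℝ)) ≤ s / N₂ * √M := by
    rw [div_le_iff₀ (by positivity)]
    have e : s / N₂ * √(M : ℝ) * (2 * √M) = 2 * s * (√(M : ℝ) ^ 2) / N₂ := by ring
    rw [e, Real.sq_sqrt hM0.le, le_div_iff₀ hN2, one_mul]
    exact a1
  have a6 : 1 / (4 * √(n / N₁ : ℝ)) ≤ 1 / (2 * √(M : ℝ)) := by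
    apply one_div_le_one_div_of_le (by positivity); linarith
  have a7 : 1 / 4 * (√(n / N₁ : ℝ))⁻¹ = 1 / (4 * √(n / N₁ : ℝ)) := by
    rw [one_div (4 * _), mul_inv]; norm_num
  have a8 : 0 < (√(n / N₁ : ℝ))⁻¹ := by positivity
  linarith

/-- The adaptive lower bound which dominates if there are few rows. -/
theorem le_eRan_signs (hp : p ≠ ∞) (hN₁ : 1 ≤ N₁) (hn : N₁ ≤ n) (h : 8 * n ≤ N₁ * N₂) :
    ENNReal.ofReal (1 / 18 * ((n : ℝ) / N₁) ^ (-(1 / 2) : ℝ)) ≤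
      (meanProblem 𝕜 p q (Fin N₁) (Fin N₂)).eRan n := by
  obtain ⟨M, s, hM, hs, hsM, hN₂, hnM, hMn⟩ := exists_blocks hN₁ hn h
  have hN₂' : 1 ≤ N₂ := le_trans (Nat.mul_pos hs hM) hsM
  have : Nonempty (Fin N₁) := ⟨⟨0, hN₁⟩⟩
  have : Nonempty (Fin N₂) := ⟨⟨0, hN₂'⟩⟩
  have : Nonempty (Fin M) := ⟨⟨0, hM⟩⟩
  have key := le_eRan_of_signs (𝕜 := 𝕜) (p := p) (q := q) (M₁ := Fin N₁) (M₂ := Fin N₂)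
    (β := Fin M) hp (card_blockOf hs hsM) (by simpa using hsM) (n := n) (by simpa using hnM)
  refine le_trans (ENNReal.ofReal_le_ofReal ?_) key
  simpa using block_sqrt_bound hN₁ hn hM hs hN₂ hN₂' hMn

/-- The non-adaptive lower bound, larger than `le_eRan_signs` by the factor `N₁^(1/p - 1/q)`. -/
theorem le_eRanNon_signs (hp : p ≠ ∞) (hN₁ : 1 ≤ N₁) (hn : N₁ ≤ n) (h : 8 * n ≤ N₁ * N₂) :
    ENNReal.ofReal (1 / 18 * (N₁ : ℝ) ^ ((p⁻¹).toReal - (q⁻¹).toReal) *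
        ((n : ℝ) / N₁) ^ (-(1 / 2) : ℝ)) ≤
      (meanProblem 𝕜 p q (Fin N₁) (Fin N₂)).eRanNon n := by
  obtain ⟨M, s, hM, hs, hsM, hN₂, hnM, hMn⟩ := exists_blocks hN₁ hn h
  have hN₂' : 1 ≤ N₂ := le_trans (Nat.mul_pos hs hM) hsM
  have : Nonempty (Fin N₁) := ⟨⟨0, hN₁⟩⟩
  have : Nonempty (Fin N₂) := ⟨⟨0, hN₂'⟩⟩
  have : Nonempty (Fin M) := ⟨⟨0, hM⟩⟩
  have key := le_eRanNon_of_signs (𝕜 := 𝕜) (p := p) (q := q) (M₁ := Fin N₁) (M₂ := Fin N₂)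
    (β := Fin M) hp (card_blockOf hs hsM) (by simpa using hsM) (n := n) (by simpa using hnM)
  refine le_trans (ENNReal.ofReal_le_ofReal ?_) key
  have := block_sqrt_bound hN₁ hn hM hs hN₂ hN₂' hMn
  rw [Fintype.card_fin, Fintype.card_fin, Fintype.card_fin, mul_comm (1 / 18 : ℝ), mul_assoc]
  gcongr

end Blocks

/-! ### Algorithms sampling whole columns -/

section UniformAlgorithms

variable {F G K : Type} [NormedAddCommGroup G] [MeasurableSpace G] [BorelSpace G]
  {P : NumericalProblem F G K}

/-- The uniform distribution on a finite type, on the σ-algebra of all subsets. -/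
noncomputable def unifMeasure (Ω : Type) [Fintype Ω] : @Measure Ω ⊤ :=
  letI : MeasurableSpace Ω := ⊤
  (Fintype.card Ω : ℝ≥0∞)⁻¹ • Measure.count

theorem lintegral_unifMeasure (Ω : Type) [Fintype Ω] (g : Ω → ℝ≥0∞) :
    @lintegral Ω ⊤ (unifMeasure Ω) g = (Fintype.card Ω : ℝ≥0∞)⁻¹ * ∑ ω, g ω := by
  let _ : MeasurableSpace Ω := ⊤
  simp only [unifMeasure]
  rw [lintegral_smul_measure, lintegral_count, tsum_fintype, smul_eq_mul]

/-- A randomized algorithm choosing uniformly from a finite family of deterministic ones. -/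
noncomputable def unifRanAlg {Ω : Type} [Fintype Ω] [Nonempty Ω] (alg : Ω → DetAlg P) :
    RanAlg P where
  Ω := Ω
  mΩ := ⊤
  ℙ := unifMeasure Ω
  isProb := by
    let _ : MeasurableSpace Ω := ⊤
    refine ⟨?_⟩
    have h := lintegral_unifMeasure Ω fun _ => 1
    rw [lintegral_one] at h
    rw [h]
    simp only [Finset.sum_const, Finset.card_univ, nsmul_eq_mul, mul_one]
    exact ENNReal.inv_mul_cancel (by simp) (by simp)
  alg := alg
  measurable_card _ := measurable_from_top
  measurable_out _ := measurable_from_top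
  separable_out f := ⟨Set.range fun ω => (alg ω).out f,
    (Set.finite_range _).countable.isSeparable, Filter.Eventually.of_forall fun ω => ⟨ω, rfl⟩⟩

theorem unifRanAlg_error_le {Ω : Type} [Fintype Ω] [Nonempty Ω] {alg : Ω → DetAlg P} {U : ℝ}
    (h : ∀ f, ∑ ω, ‖P.S f - (alg ω).out f‖ ≤ Fintype.card Ω * U) :
    (unifRanAlg alg).error ≤ ENNReal.ofReal U := by
  refine iSup_le fun f => ?_
  have h1 := lintegral_unifMeasure Ω fun ω => ‖P.S f - (alg ω).out f‖ₑ
  have hc : (Fintype.card Ω : ℝ≥0∞) ≠ 0 := by simp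
  refine (le_of_eq h1).trans ?_
  rw [ENNReal.inv_mul_le_iff hc (by simp)]
  simp only [← ofReal_norm]
  rw [← ENNReal.ofReal_sum_of_nonneg fun _ _ => norm_nonneg _, ← ENNReal.ofReal_natCast,
    ← ENNReal.ofReal_mul (by positivity)]
  exact ENNReal.ofReal_le_ofReal (h f)

theorem unifRanAlg_card_le {Ω : Type} [Fintype Ω] [Nonempty Ω] {alg : Ω → DetAlg P} {n : ℕ}
    (cost : Ω → F → ℕ) (hcost : ∀ ω f, (alg ω).card f = (cost ω f : ℕ∞))
    (h : ∀ f, (∑ ω, (cost ω f : ℝ)) ≤ Fintype.card Ω * n) :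
    (unifRanAlg alg).card ≤ n := by
  refine iSup_le fun f => ?_
  have h1 := lintegral_unifMeasure Ω fun ω => (((alg ω).card f : ℕ∞) : ℝ≥0∞)
  have hc : (Fintype.card Ω : ℝ≥0∞) ≠ 0 := by simp
  refine (le_of_eq h1).trans ?_
  rw [ENNReal.inv_mul_le_iff hc (by simp)]
  simp only [hcost, ENat.toENNReal_coe]
  exact_mod_cast h f

end UniformAlgorithms

section SampleAlgorithms

variable {𝕜 : Type} [RCLike 𝕜] {p q : ℝ≥0∞} [Fact (1 ≤ p)] {N₁ N₂ : ℕ}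

/-- The algorithms used in the upper bounds: sample the columns `J 0, …, J (k - 1)` in all rows,
select from these data a set of rows to be read completely, and estimate the mean of the others. -/
theorem exists_sampleAlg (hN₁ : 1 ≤ N₁) (hN₂ : 1 ≤ N₂) {k : ℕ} (J : Fin k → Fin N₂)
    (sel : (Fin N₁ → Fin k → 𝕜) → Finset (Fin N₁)) (est : (Fin k → 𝕜) → 𝕜) :
    ∃ A : DetAlg (meanProblem 𝕜 p q (Fin N₁) (Fin N₂)),
      ((∀ y z, sel y = sel z) → A.NonAdaptive) ∧ ∀ f,
        A.card f = ((N₁ * k + (sel fun i l => f.1 (i, J l)).card * N₂ : ℕ) : ℕ∞) ∧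
        ∀ i, A.out f i = if i ∈ sel fun i l => f.1 (i, J l) then
          (meanProblem 𝕜 p q (Fin N₁) (Fin N₂)).S f i else est fun l => f.1 (i, J l) := by
  let δ : Fin N₁ × Fin N₂ → (meanProblem 𝕜 p q (Fin N₁) (Fin N₂)).Λ :=
    fun x => ⟨fun f => f.1 x, ⟨x, rfl⟩⟩
  let x₀ : Fin N₁ × Fin N₂ := (⟨0, hN₁⟩, ⟨0, hN₂⟩)
  let q₁ : ℕ → (meanProblem 𝕜 p q (Fin N₁) (Fin N₂)).Λ := fun t =>
    if h : t < N₁ * k then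
      δ ((finProdFinEquiv.symm ⟨t, h⟩).1, J (finProdFinEquiv.symm ⟨t, h⟩).2) else δ x₀
  let q₂ : Finset (Fin N₁) → ℕ → (meanProblem 𝕜 p q (Fin N₁) (Fin N₂)).Λ := fun B t =>
    if h : t < B.card * N₂ then
      δ ((B.equivFin.symm (finProdFinEquiv.symm ⟨t, h⟩).1).1, (finProdFinEquiv.symm ⟨t, h⟩).2)
      else δ x₀
  let tab : (Fin (N₁ * k) → 𝕜) → Fin N₁ → Fin k → 𝕜 := fun y i l => y (finProdFinEquiv (i, l))
  let o : (Fin (N₁ * k) → 𝕜) → (ℕ → 𝕜) → LSpace 𝕜 q (Fin N₁) := fun y z i =>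
    if h : i ∈ sel (tab y) then
      (N₂ : 𝕜)⁻¹ * ∑ j : Fin N₂, z (finProdFinEquiv ((sel (tab y)).equivFin ⟨i, h⟩, j) : Fin _)
    else est (tab y i)
  have htab : ∀ f : Metric.closedBall (0 : LSpace 𝕜 p (Fin N₁ × Fin N₂)) 1,
      tab (fun l : Fin (N₁ * k) => (q₁ l).1 f) = fun i l => f.1 (i, J l) := by
    intro f
    funext i l
    simp only [tab, q₁, Fin.is_lt, dite_true, Fin.eta, Equiv.symm_apply_apply, δ]
  let zero : Zero (LSpace 𝕜 q (Fin N₁)) := ⟨fun _ => 0⟩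
  refine ⟨DetAlg.twoStage (N₁ * k) q₁ (fun y => q₂ (sel (tab y)))
    (fun y => (sel (tab y)).card * N₂) o, ?_, fun f => ⟨?_, fun i => ?_⟩⟩
  · intro hsel i y z
    refine ⟨?_, ?_⟩ <;> simp only [DetAlg.twoStage] <;> split_ifs with h
    · rw [hsel _ (tab fun l => z (Fin.castLE h l))]
    · rfl
    · simp only [hsel (tab fun l => y (Fin.castLE h l)) (tab fun l => z (Fin.castLE h l))]
    · rfl
  · rw [DetAlg.twoStage_card, htab]
  · rw [DetAlg.twoStage_out]
    simp only [o]
    rw [htab]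
    split_ifs with h
    · have hS : (meanProblem 𝕜 p q (Fin N₁) (Fin N₂)).S f i =
        (Fintype.card (Fin N₂) : 𝕜)⁻¹ * ∑ j : Fin N₂, f.1 (i, j) := rfl
      rw [hS, Fintype.card_fin]
      congr 1
      refine Finset.sum_congr rfl fun j _ => ?_
      rw [if_pos (Fin.is_lt _)]
      simp only [q₂, Fin.is_lt, dite_true, Fin.eta, Equiv.symm_apply_apply, δ]
    · rfl

end SampleAlgorithms

/-! ### Moments of the Monte Carlo error -/

section MonteCarlo

variable {𝕜 : Type} [RCLike 𝕜]

theorem add_rpow_le_two_rpow_mul {a b p : ℝ} (ha : 0 ≤ a) (hb : 0 ≤ b) (hp : 0 ≤ p) :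
    (a + b) ^ p ≤ 2 ^ p * (a ^ p + b ^ p) := by
  have h1 : a + b ≤ 2 * max a b := by
    have := le_max_left a b
    have := le_max_right a b
    linarith
  have h2 : max a b ^ p ≤ a ^ p + b ^ p := by
    have ha' : 0 ≤ a ^ p := by positivity
    have hb' : 0 ≤ b ^ p := by positivity
    rcases max_choice a b with h | h <;> rw [h] <;> linarith
  calc (a + b) ^ p ≤ (2 * max a b) ^ p := Real.rpow_le_rpow (by positivity) h1 hp
    _ = 2 ^ p * max a b ^ p := Real.mul_rpow (by norm_num) (le_max_of_le_left ha)
    _ ≤ _ := by gcongr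

theorem norm_le_abs_re_add_abs_im (z : 𝕜) : ‖z‖ ≤ |RCLike.re z| + |RCLike.im z| := by
  refine abs_le_of_sq_le_sq' ?_ (by positivity) |>.2
  rw [RCLike.norm_sq_eq_def, add_sq, ← sq, ← sq, sq_abs, sq_abs]
  have : 0 ≤ 2 * |RCLike.re z| * |RCLike.im z| := by positivity
  linarith

theorem exists_sum_norm_sum_rpow_le (𝕜 : Type) [RCLike 𝕜] {p : ℝ} (hp : 2 < p) : ∃ C : ℝ, 0 < C ∧
    ∀ {β : Type} [Fintype β] (X : β → 𝕜), ∑ b, X b = 0 → ∀ N : ℕ, 1 ≤ N →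
      (Fintype.card β : ℝ) * ∑ J : Fin N → β, ‖∑ l, X (J l)‖ ^ p ≤
        C * (N : ℝ) ^ (p / 2) * (Fintype.card β : ℝ) ^ N * ∑ b, ‖X b‖ ^ p := by
  obtain ⟨C, hC, h⟩ := exists_sum_abs_sum_rpow_le hp
  have hp0 : 0 ≤ p := by linarith
  refine ⟨2 ^ p * (2 * C), by positivity, fun {β} _ X hX N hN => ?_⟩
  have hre := h (fun b => RCLike.re (X b)) (by rw [← map_sum, hX, map_zero]) N hN
  have him := h (fun b => RCLike.im (X b)) (by rw [← map_sum, hX, map_zero]) N hN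
  simp only [← map_sum] at hre him
  have hre' : ∑ b, |RCLike.re (X b)| ^ p ≤ ∑ b, ‖X b‖ ^ p := Finset.sum_le_sum fun b _ =>
    Real.rpow_le_rpow (abs_nonneg _) (RCLike.abs_re_le_norm _) hp0
  have him' : ∑ b, |RCLike.im (X b)| ^ p ≤ ∑ b, ‖X b‖ ^ p := Finset.sum_le_sum fun b _ =>
    Real.rpow_le_rpow (abs_nonneg _) (RCLike.abs_im_le_norm _) hp0
  have hpt : ∀ z : 𝕜, ‖z‖ ^ p ≤ 2 ^ p * (|RCLike.re z| ^ p + |RCLike.im z| ^ p) := fun z =>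
    (Real.rpow_le_rpow (norm_nonneg _) (norm_le_abs_re_add_abs_im z) hp0).trans
      (add_rpow_le_two_rpow_mul (abs_nonneg _) (abs_nonneg _) hp0)
  calc (Fintype.card β : ℝ) * ∑ J : Fin N → β, ‖∑ l, X (J l)‖ ^ p
      ≤ (Fintype.card β : ℝ) * ∑ J : Fin N → β, 2 ^ p * (|RCLike.re (∑ l, X (J l))| ^ p +
          |RCLike.im (∑ l, X (J l))| ^ p) := by
        gcongr with J _
        exact hpt _
    _ = 2 ^ p * ((Fintype.card β : ℝ) * ∑ J : Fin N → β, |RCLike.re (∑ l, X (J l))| ^ p +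
          (Fintype.card β : ℝ) * ∑ J : Fin N → β, |RCLike.im (∑ l, X (J l))| ^ p) := by
        rw [← Finset.mul_sum, Finset.sum_add_distrib]; ring
    _ ≤ 2 ^ p * (C * (N : ℝ) ^ (p / 2) * (Fintype.card β : ℝ) ^ N * ∑ b, ‖X b‖ ^ p +
          C * (N : ℝ) ^ (p / 2) * (Fintype.card β : ℝ) ^ N * ∑ b, ‖X b‖ ^ p) := by
        exact mul_le_mul_of_nonneg_left (add_le_add (hre.trans (by gcongr))
          (him.trans (by gcongr))) (by positivity)
    _ = _ := by ring

theorem card_mul_norm_mean_rpow_le {β : Type} [Fintype β] [Nonempty β] (g : β → 𝕜) {p : ℝ}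
    (hp : 1 ≤ p) :
    (Fintype.card β : ℝ) * ‖(Fintype.card β : 𝕜)⁻¹ * ∑ b, g b‖ ^ p ≤ ∑ b, ‖g b‖ ^ p := by
  have hc : (0 : ℝ) < Fintype.card β := by exact_mod_cast Fintype.card_pos
  have h1 := Real.rpow_arith_mean_le_arith_mean_rpow Finset.univ
    (fun _ : β => (Fintype.card β : ℝ)⁻¹) (fun b => ‖g b‖) (fun _ _ => by positivity)
    (by simp [hc.ne']) (fun i _ => norm_nonneg _) hp
  rw [← Finset.mul_sum, ← Finset.mul_sum] at h1
  have h2 : ‖(Fintype.card β : 𝕜)⁻¹ * ∑ b, g b‖ ≤ (Fintype.card β : ℝ)⁻¹ * ∑ b, ‖g b‖ := by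
    rw [norm_mul, norm_inv, RCLike.norm_natCast]
    gcongr
    exact norm_sum_le _ _
  rw [← le_div_iff₀' hc, div_eq_inv_mul]
  exact (Real.rpow_le_rpow (norm_nonneg _) h2 (by linarith)).trans h1

/-- The `p`-th moment of the error of the Monte Carlo method with `k` samples. -/
theorem exists_monteCarlo_rpow_le (𝕜 : Type) [RCLike 𝕜] {p : ℝ} (hp : 2 < p) : ∃ C : ℝ, 0 < C ∧
    ∀ {β : Type} [Fintype β] [Nonempty β] (g : β → 𝕜) (k : ℕ), 1 ≤ k →
      (Fintype.card β : ℝ) * ∑ J : Fin k → β,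
        ‖(Fintype.card β : 𝕜)⁻¹ * ∑ b, g b - (k : 𝕜)⁻¹ * ∑ l, g (J l)‖ ^ p ≤
        C * (k : ℝ) ^ (-(p / 2)) * (Fintype.card β : ℝ) ^ k * ∑ b, ‖g b‖ ^ p := by
  obtain ⟨C, hC, h⟩ := exists_sum_norm_sum_rpow_le 𝕜 hp
  have hp0 : 0 ≤ p := by linarith
  refine ⟨C * (2 ^ p * 2), by positivity, fun {β} _ _ g k hk => ?_⟩
  have hk0 : (0 : ℝ) < k := by exact_mod_cast hk
  have hc : (Fintype.card β : 𝕜) ≠ 0 := by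
    have : Fintype.card β ≠ 0 := Fintype.card_ne_zero
    exact_mod_cast this
  have hkk : (k : 𝕜) ≠ 0 := by
    have : k ≠ 0 := by omega
    exact_mod_cast this
  set μ : 𝕜 := (Fintype.card β : 𝕜)⁻¹ * ∑ b, g b with hμ
  have h0 : ∑ b, (μ - g b) = 0 := by
    rw [Finset.sum_sub_distrib, Finset.sum_const, Finset.card_univ, nsmul_eq_mul, hμ,
      mul_inv_cancel_left₀ hc, sub_self]
  have h1 := h (fun b => μ - g b) h0 k hk
  have h2 : ∑ b, ‖μ - g b‖ ^ p ≤ 2 ^ p * 2 * ∑ b, ‖g b‖ ^ p := by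
    calc ∑ b, ‖μ - g b‖ ^ p ≤ ∑ b, 2 ^ p * (‖μ‖ ^ p + ‖g b‖ ^ p) := Finset.sum_le_sum fun b _ =>
          (Real.rpow_le_rpow (norm_nonneg _) (norm_sub_le _ _) hp0).trans
            (add_rpow_le_two_rpow_mul (norm_nonneg _) (norm_nonneg _) hp0)
      _ = 2 ^ p * ((Fintype.card β : ℝ) * ‖μ‖ ^ p + ∑ b, ‖g b‖ ^ p) := by
          rw [← Finset.mul_sum, Finset.sum_add_distrib, Finset.sum_const, Finset.card_univ,
            nsmul_eq_mul]
      _ ≤ 2 ^ p * (∑ b, ‖g b‖ ^ p + ∑ b, ‖g b‖ ^ p) := by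
          gcongr
          exact card_mul_norm_mean_rpow_le g (by linarith)
      _ = _ := by ring
  have h3 : ∀ J : Fin k → β, ‖μ - (k : 𝕜)⁻¹ * ∑ l, g (J l)‖ ^ p =
      (k : ℝ) ^ (-p) * ‖∑ l, (μ - g (J l))‖ ^ p := by
    intro J
    have : μ - (k : 𝕜)⁻¹ * ∑ l, g (J l) = (k : 𝕜)⁻¹ * ∑ l, (μ - g (J l)) := by
      rw [Finset.sum_sub_distrib, Finset.sum_const, Finset.card_univ, Fintype.card_fin,
        nsmul_eq_mul, mul_sub, inv_mul_cancel_left₀ hkk]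
    rw [this, norm_mul, norm_inv, RCLike.norm_natCast, Real.mul_rpow (by positivity) (by positivity),
      Real.inv_rpow hk0.le, Real.rpow_neg hk0.le]
  simp only [h3]
  rw [← Finset.mul_sum]
  calc (Fintype.card β : ℝ) * ((k : ℝ) ^ (-p) * ∑ J : Fin k → β, ‖∑ l, (μ - g (J l))‖ ^ p)
      = (k : ℝ) ^ (-p) * ((Fintype.card β : ℝ) * ∑ J : Fin k → β, ‖∑ l, (μ - g (J l))‖ ^ p) := by
        ring
    _ ≤ (k : ℝ) ^ (-p) * (C * (k : ℝ) ^ (p / 2) * (Fintype.card β : ℝ) ^ k *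
          (2 ^ p * 2 * ∑ b, ‖g b‖ ^ p)) := by
        exact mul_le_mul_of_nonneg_left (h1.trans (by gcongr)) (by positivity)
    _ = C * (2 ^ p * 2) * ((k : ℝ) ^ (-p) * (k : ℝ) ^ (p / 2)) * (Fintype.card β : ℝ) ^ k *
          ∑ b, ‖g b‖ ^ p := by ring
    _ = _ := by
        rw [← Real.rpow_add hk0]
        congr 3
        congr 1
        ring

/-- Jensen's inequality for the concave function `x ^ (1 / p)` and the uniform distribution. -/
theorem sum_rpow_inv_le {Ω : Type} [Fintype Ω] [Nonempty Ω] (X : Ω → ℝ) (hX : ∀ ω, 0 ≤ X ω) {p : ℝ}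
    (hp : 1 ≤ p) {B : ℝ} (hB : 0 ≤ B) (h : ∑ ω, X ω ≤ Fintype.card Ω * B) :
    ∑ ω, X ω ^ (1 / p) ≤ Fintype.card Ω * B ^ (1 / p) := by
  have hp0 : 0 < p := by linarith
  have hc : (0 : ℝ) < Fintype.card Ω := by exact_mod_cast Fintype.card_pos
  have h1 := Real.rpow_arith_mean_le_arith_mean_rpow Finset.univ
    (fun _ : Ω => (Fintype.card Ω : ℝ)⁻¹) (fun ω => X ω ^ (1 / p)) (fun _ _ => by positivity)
    (by simp [hc.ne']) (fun ω _ => Real.rpow_nonneg (hX ω) _) hp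
  have hXp : ∀ ω, (X ω ^ (1 / p)) ^ p = X ω := fun ω => by
    rw [one_div]
    exact Real.rpow_inv_rpow (hX ω) hp0.ne'
  simp only [hXp] at h1
  rw [← Finset.mul_sum, ← Finset.mul_sum] at h1
  rw [← inv_mul_le_iff₀ hc, one_div, Real.le_rpow_inv_iff_of_pos
    (mul_nonneg (by positivity) (Finset.sum_nonneg fun ω _ => Real.rpow_nonneg (hX ω) _)) hB hp0]
  rw [one_div] at h1
  exact h1.trans (by rwa [inv_mul_le_iff₀ hc])

end MonteCarlo

/-! ### The non-adaptive upper bound -/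

section NonAdaptiveUpperBound

variable {p q : ℝ≥0∞} [Fact (1 ≤ p)] [Fact (1 ≤ q)]

theorem sum_norm_rpow_le_of_ball {𝕜 : Type} [RCLike 𝕜] (hp : p ≠ ∞) {N₁ N₂ : ℕ} (hN₁ : 1 ≤ N₁)
    (hN₂ : 1 ≤ N₂) (f : Metric.closedBall (0 : LSpace 𝕜 p (Fin N₁ × Fin N₂)) 1) :
    ∑ i, ∑ j, ‖f.1 (i, j)‖ ^ p.toReal ≤ N₁ * N₂ := by
  have : Nonempty (Fin N₁ × Fin N₂) := ⟨(⟨0, hN₁⟩, ⟨0, hN₂⟩)⟩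
  have h := LSpace.sum_rpow_le_of_norm_le_one Fact.out hp (mem_closedBall_zero_iff.1 f.2)
  rw [Fintype.sum_prod_type] at h
  simpa using h

/-- The non-adaptive upper bound: Monte Carlo with `n / N₁` columns, common to all rows. Since
`p < q`, the `q`-norm of the error is bounded by its `p`-norm, whose `p`-th moment is a sum over the
rows. -/
theorem exists_eRanNon_le (𝕜 : Type) [RCLike 𝕜] (hp2 : 2 < p) (hpq : p < q) :
    ∃ C : ℝ, 0 < C ∧ ∀ n N₁ N₂ : ℕ, 1 ≤ N₁ → 1 ≤ N₂ → N₁ ≤ n →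
      (meanProblem 𝕜 p q (Fin N₁) (Fin N₂)).eRanNon n ≤
        ENNReal.ofReal (C * (N₁ : ℝ) ^ ((p⁻¹).toReal - (q⁻¹).toReal) *
          ((n : ℝ) / N₁) ^ (-(1 / 2) : ℝ)) := by
  have hp : p ≠ ∞ := hpq.ne_top
  have hp1 : 1 ≤ p := Fact.out
  have hq1 : 1 ≤ q := Fact.out
  have hP2 : 2 < p.toReal := by
    simpa using (ENNReal.toReal_lt_toReal (by norm_num) hp).2 hp2
  have hP0 : 0 < p.toReal := by linarith
  obtain ⟨C, hC, hMC⟩ := exists_monteCarlo_rpow_le 𝕜 hP2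
  refine ⟨2 * C ^ (1 / p.toReal), by positivity, fun n N₁ N₂ hN₁ hN₂ hn => ?_⟩
  have : Nonempty (Fin N₁) := ⟨⟨0, hN₁⟩⟩
  have : Nonempty (Fin N₂) := ⟨⟨0, hN₂⟩⟩
  have hN : (0 : ℝ) < N₁ := by exact_mod_cast hN₁
  have hN2 : (0 : ℝ) < N₂ := by exact_mod_cast hN₂
  set k := n / N₁ with hk
  have hk1 : 1 ≤ k := Nat.div_pos hn hN₁
  have hk0 : (0 : ℝ) < k := by exact_mod_cast hk1
  have hkn : N₁ * k ≤ n := Nat.mul_div_le _ _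
  choose A hAnon hA using fun J : Fin k → Fin N₂ =>
    exists_sampleAlg (𝕜 := 𝕜) (p := p) (q := q) hN₁ hN₂ J (fun _ => ∅)
      fun y => (k : 𝕜)⁻¹ * ∑ l, y l
  have hcard : (unifRanAlg A).card ≤ n := by
    refine unifRanAlg_card_le (fun J f => N₁ * k) (fun J f => ?_) fun f => ?_
    · rw [(hA J f).1]; simp
    · rw [Finset.sum_const, Finset.card_univ, nsmul_eq_mul]
      gcongr
  have herr : (unifRanAlg A).error ≤ ENNReal.ofReal ((N₁ : ℝ) ^ (-(q⁻¹).toReal) *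
      (C * (k : ℝ) ^ (-(p.toReal / 2)) * N₁) ^ (1 / p.toReal)) := by
    refine unifRanAlg_error_le fun f => ?_
    have hpt : ∀ J, ‖(meanProblem 𝕜 p q (Fin N₁) (Fin N₂)).S f - (A J).out f‖ ≤ (N₁ : ℝ) ^ (-(q⁻¹).toReal) *
        (∑ i, ‖(Fintype.card (Fin N₂) : 𝕜)⁻¹ * ∑ j, f.1 (i, j) -
          (k : 𝕜)⁻¹ * ∑ l, f.1 (i, J l)‖ ^ p.toReal) ^ (1 / p.toReal) := by
      intro J
      have h1 := LSpace.norm_le_rpow_sum hq1 hP0 (fun hq => ENNReal.toReal_mono hq hpq.le)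
        ((meanProblem 𝕜 p q (Fin N₁) (Fin N₂)).S f - (A J).out f)
      have h2 : ∀ i, ((meanProblem 𝕜 p q (Fin N₁) (Fin N₂)).S f - (A J).out f) i = (Fintype.card (Fin N₂) : 𝕜)⁻¹ * ∑ j, f.1 (i, j) -
          (k : 𝕜)⁻¹ * ∑ l, f.1 (i, J l) := by
        intro i
        change (meanProblem 𝕜 p q (Fin N₁) (Fin N₂)).S f i - (A J).out f i = _
        rw [(hA J f).2]
        simp [meanProblem]
      simp only [h2] at h1
      rwa [Fintype.card_fin N₁] at h1
    refine (Finset.sum_le_sum fun J _ => hpt J).trans ?_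
    rw [← Finset.mul_sum, mul_left_comm]
    refine mul_le_mul_of_nonneg_left ?_ (by positivity)
    refine sum_rpow_inv_le _ (fun J => Finset.sum_nonneg fun i _ => by positivity) (by linarith)
      (by positivity) ?_
    rw [Finset.sum_comm]
    have h3 := Finset.sum_le_sum fun i (_ : i ∈ (Finset.univ : Finset (Fin N₁))) =>
      hMC (fun j => f.1 (i, j)) k hk1
    rw [← Finset.mul_sum, ← Finset.mul_sum, Fintype.card_fin] at h3
    have h4 := sum_norm_rpow_le_of_ball hp hN₁ hN₂ f
    have h5 : (N₂ : ℝ) * ∑ i, ∑ J : Fin k → Fin N₂, ‖(Fintype.card (Fin N₂) : 𝕜)⁻¹ *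
        ∑ j, f.1 (i, j) - (k : 𝕜)⁻¹ * ∑ l, f.1 (i, J l)‖ ^ p.toReal ≤
        N₂ * (N₂ ^ k * (C * (k : ℝ) ^ (-(p.toReal / 2)) * N₁)) := by
      rw [Fintype.card_fin]
      refine h3.trans ?_
      calc C * (k : ℝ) ^ (-(p.toReal / 2)) * (N₂ : ℝ) ^ k * ∑ i, ∑ j, ‖f.1 (i, j)‖ ^ p.toReal
          ≤ C * (k : ℝ) ^ (-(p.toReal / 2)) * (N₂ : ℝ) ^ k * (N₁ * N₂) := by gcongr
        _ = _ := by ring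
    have h6 := le_of_mul_le_mul_left h5 hN2
    simpa using h6
  refine (iInf_le_of_le (unifRanAlg A) (iInf₂_le_of_le (fun J => hAnon J fun _ _ => rfl) hcard
    herr)).trans (ENNReal.ofReal_le_ofReal ?_)
  have e1 : (C * (k : ℝ) ^ (-(p.toReal / 2)) * N₁) ^ (1 / p.toReal) =
      C ^ (1 / p.toReal) * (k : ℝ) ^ (-(1 / 2) : ℝ) * (N₁ : ℝ) ^ (p⁻¹).toReal := by
    rw [Real.mul_rpow (by positivity) hN.le, Real.mul_rpow hC.le (by positivity),
      ← Real.rpow_mul hk0.le, ENNReal.toReal_inv, one_div]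
    congr 3
    field_simp
  rw [e1, sub_eq_add_neg (p⁻¹).toReal, Real.rpow_add hN]
  have h7 : (n : ℝ) / N₁ ≤ 4 * k := by
    have h8 : n < N₁ * (k + 1) := Nat.lt_mul_div_succ _ hN₁
    have h9 : n ≤ N₁ * (4 * k) := h8.le.trans (Nat.mul_le_mul_left _ (by omega))
    rw [div_le_iff₀ hN, mul_comm]
    exact_mod_cast h9
  have hn0 : (0 : ℝ) < n := by exact_mod_cast (by omega : 0 < n)
  have h10 : (k : ℝ) ^ (-(1 / 2) : ℝ) ≤ 2 * ((n : ℝ) / N₁) ^ (-(1 / 2) : ℝ) := by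
    have h11 := Real.rpow_le_rpow_of_nonpos (by positivity) h7 (by norm_num : (-(1 / 2) : ℝ) ≤ 0)
    rw [Real.mul_rpow (by norm_num) hk0.le] at h11
    have h12 : (4 : ℝ) ^ (-(1 / 2) : ℝ) = 1 / 2 := by
      rw [show (4 : ℝ) = 2 ^ (2 : ℝ) by norm_num, ← Real.rpow_mul (by norm_num)]
      norm_num [Real.rpow_neg_one]
    rw [h12] at h11
    linarith
  calc (N₁ : ℝ) ^ (-(q⁻¹).toReal) *
        (C ^ (1 / p.toReal) * (k : ℝ) ^ (-(1 / 2) : ℝ) * (N₁ : ℝ) ^ (p⁻¹).toReal)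
      ≤ (N₁ : ℝ) ^ (-(q⁻¹).toReal) * (C ^ (1 / p.toReal) *
        (2 * ((n : ℝ) / N₁) ^ (-(1 / 2) : ℝ)) * (N₁ : ℝ) ^ (p⁻¹).toReal) := by gcongr
    _ = _ := by ring

end NonAdaptiveUpperBound

/-! ### Truncated Monte Carlo in a single row -/

section TruncatedMonteCarlo

variable {𝕜 : Type} [RCLike 𝕜] {β : Type} [Fintype β]

/-- One coordinate of a uniformly distributed tuple is uniformly distributed. -/
theorem card_mul_sum_apply (W : β → ℝ) {k : ℕ} (l : Fin k) :
    (Fintype.card β : ℝ) * ∑ J : Fin k → β, W (J l) = (Fintype.card β : ℝ) ^ k * ∑ b, W b := by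
  classical
  have h := Finset.prod_univ_sum (fun _ : Fin k => (Finset.univ : Finset β))
    fun i b => if i = l then W b else 1
  rw [Fintype.piFinset_univ] at h
  have h1 : ∀ J : Fin k → β, ∏ i, (if i = l then W (J i) else 1) = W (J l) := fun J => by simp
  simp only [h1] at h
  rw [← h, ← Finset.mul_prod_erase _ _ (Finset.mem_univ l)]
  have h2 : ∏ i ∈ Finset.univ.erase l, ∑ b : β, (if i = l then W b else 1) =
      (Fintype.card β : ℝ) ^ (k - 1) := by
    rw [Finset.prod_congr rfl fun i hi => by
      rw [Finset.sum_congr rfl fun b _ => if_neg (Finset.ne_of_mem_erase hi)]]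
    simp
  rw [h2, ← mul_pow_sub_one l.pos.ne']
  simp only [if_true]
  ring

/-- The square of the absolute value, capped at height `t ^ 2`. -/
noncomputable def cappedSq (t : ℝ) (x : 𝕜) : ℝ := min (‖x‖ ^ 2) (t ^ 2)

/-- Hard truncation at level `t`. -/
noncomputable def trunc (t : ℝ) (x : 𝕜) : 𝕜 := if ‖x‖ ≤ t then x else 0

theorem cappedSq_nonneg (t : ℝ) (x : 𝕜) : 0 ≤ cappedSq t x := le_min (by positivity) (by positivity)

theorem cappedSq_le_norm_sq (t : ℝ) (x : 𝕜) : cappedSq t x ≤ ‖x‖ ^ 2 := min_le_left _ _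

theorem cappedSq_le_sq (t : ℝ) (x : 𝕜) : cappedSq t x ≤ t ^ 2 := min_le_right _ _

theorem norm_trunc_le {t : ℝ} (ht : 0 ≤ t) (x : 𝕜) : ‖trunc t x‖ ≤ t := by
  unfold trunc
  split_ifs with h
  · exact h
  · simpa using ht

theorem norm_trunc_sq_le (t : ℝ) (x : 𝕜) : ‖trunc t x‖ ^ 2 ≤ cappedSq t x := by
  unfold trunc cappedSq
  split_ifs with h
  · exact le_min le_rfl (by gcongr)
  · simp; positivity

/-- Markov's inequality: the expected indicator of the event that a row is selected is at most its mean
capped square over `θ`. -/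
theorem card_selected_le (g : β → 𝕜) {k : ℕ} (hk : 1 ≤ k) (t : ℝ) {θ : ℝ} (hθ : 0 < θ) :
    (Fintype.card β : ℝ) *
      ∑ J : Fin k → β, (if k * θ < ∑ l, cappedSq t (g (J l)) then 1 else 0 : ℝ) ≤
      (Fintype.card β : ℝ) ^ k * ((∑ b, cappedSq t (g b)) / θ) := by
  have hk0 : (0 : ℝ) < k := by exact_mod_cast hk
  have h1 : ∀ J : Fin k → β, (if k * θ < ∑ l, cappedSq t (g (J l)) then 1 else 0 : ℝ) ≤
      (∑ l, cappedSq t (g (J l))) / (k * θ) := by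
    intro J
    have h0 : 0 ≤ ∑ l, cappedSq t (g (J l)) := Finset.sum_nonneg fun _ _ => cappedSq_nonneg _ _
    split_ifs with h
    · rw [le_div_iff₀ (by positivity), one_mul]; exact h.le
    · positivity
  calc (Fintype.card β : ℝ) *
        ∑ J : Fin k → β, (if k * θ < ∑ l, cappedSq t (g (J l)) then 1 else 0 : ℝ)
      ≤ (Fintype.card β : ℝ) * ∑ J : Fin k → β, (∑ l, cappedSq t (g (J l))) / (k * θ) := by
        gcongr with J _
        exact h1 J
    _ = (∑ l : Fin k, (Fintype.card β : ℝ) * ∑ J : Fin k → β, cappedSq t (g (J l))) / (k * θ) := by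
        rw [← Finset.sum_div, ← mul_div_assoc, Finset.sum_comm, ← Finset.mul_sum]
    _ = _ := by
        rw [Finset.sum_congr rfl fun l _ => card_mul_sum_apply (fun b => cappedSq t (g b)) l]
        simp only [Finset.sum_const, Finset.card_univ, Fintype.card_fin, nsmul_eq_mul]
        field_simp

/-- A row of large truncated second moment is overlooked with exponentially small probability. -/
theorem card_overlooked_le (g : β → 𝕜) (k : ℕ) {t θ : ℝ} (ht : 0 < t)
    (h : 4 * θ * Fintype.card β < ∑ b, cappedSq t (g b)) :
    ∑ J : Fin k → β, (if k * θ < ∑ l, cappedSq t (g (J l)) then 0 else 1 : ℝ) ≤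
      (Fintype.card β : ℝ) ^ k * Real.exp (-(k * θ / t ^ 2)) := by
  have ht2 : 0 < t ^ 2 := by positivity
  have h1 : ∀ J : Fin k → β, (if k * θ < ∑ l, cappedSq t (g (J l)) then 0 else 1 : ℝ) ≤
      Real.exp (k * θ / t ^ 2) * Real.exp (∑ l, -(cappedSq t (g (J l)) / t ^ 2)) := by
    intro J
    split_ifs with h2
    · positivity
    · rw [← Real.exp_add]
      refine Real.one_le_exp ?_
      rw [Finset.sum_neg_distrib, ← Finset.sum_div, ← sub_eq_add_neg, ← sub_div]
      exact div_nonneg (by linarith [not_lt.1 h2]) ht2.le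
  have h3 := sum_exp_neg_le (fun b => cappedSq t (g b) / t ^ 2)
    (fun b => div_nonneg (cappedSq_nonneg _ _) ht2.le)
    (fun b => by rw [div_le_one ht2]; exact cappedSq_le_sq _ _) (v := 4 * θ / t ^ 2)
    (by rw [← Finset.sum_div, ← mul_div_assoc]
        gcongr
        linarith)
  have h4 := sum_exp_sum_le (fun b => -(cappedSq t (g b) / t ^ 2)) k _ h3
  calc _ ≤ ∑ J : Fin k → β, Real.exp (k * θ / t ^ 2) *
          Real.exp (∑ l, -(cappedSq t (g (J l)) / t ^ 2)) := Finset.sum_le_sum fun J _ => h1 J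
    _ ≤ Real.exp (k * θ / t ^ 2) * ((Fintype.card β : ℝ) ^ k *
          Real.exp (k * -(4 * θ / t ^ 2 / 2))) := by
        rw [← Finset.mul_sum]
        gcongr
    _ = (Fintype.card β : ℝ) ^ k * (Real.exp (k * θ / t ^ 2) *
          Real.exp (k * -(4 * θ / t ^ 2 / 2))) := by ring
    _ = _ := by
        rw [← Real.exp_add]
        congr 2
        ring

/-- A Bernstein-type bound for the exponential moment of the Monte Carlo error of bounded values, at
the scale `1 / (2 t)` at which the exponent of a single summand is at most one. -/
theorem sum_exp_sum_le_of_second_moment [Nonempty β] (x : β → ℝ) {t θ : ℝ} (ht : 0 < t)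
    (hx : ∀ b, |x b| ≤ t) (h2 : ∑ b, x b ^ 2 ≤ 4 * θ * Fintype.card β) (k : ℕ) {σ : ℝ}
    (hσ : |σ| = 1 / (2 * t)) :
    ∑ J : Fin k → β, Real.exp (σ * ∑ l, ((Fintype.card β : ℝ)⁻¹ * (∑ b, x b) - x (J l))) ≤
      (Fintype.card β : ℝ) ^ k * Real.exp (k * θ / t ^ 2) := by
  have hc : (0 : ℝ) < Fintype.card β := by exact_mod_cast Fintype.card_pos
  set m : ℝ := (Fintype.card β : ℝ)⁻¹ * ∑ b, x b with hm
  have hcm : (Fintype.card β : ℝ) * m = ∑ b, x b := by rw [hm]; field_simp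
  have hmt : |m| ≤ t := by
    rw [hm, abs_mul, abs_of_pos (by positivity), inv_mul_le_iff₀ hc]
    calc |∑ b, x b| ≤ ∑ b, |x b| := Finset.abs_sum_le_sum_abs _ _
      _ ≤ ∑ _b : β, t := Finset.sum_le_sum fun b _ => hx b
      _ = _ := by simp
  have hσ2 : σ ^ 2 = 1 / (4 * t ^ 2) := by rw [← sq_abs, hσ]; field_simp; norm_num
  have h0 : ∑ b, σ * (m - x b) = 0 := by
    rw [← Finset.mul_sum, Finset.sum_sub_distrib, Finset.sum_const, Finset.card_univ,
      nsmul_eq_mul, hcm, sub_self, mul_zero]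
  have h1 : ∀ b, |σ * (m - x b)| ≤ 1 := by
    intro b
    rw [abs_mul, hσ]
    have : |m - x b| ≤ 2 * t := (abs_sub _ _).trans (by linarith [hx b])
    rw [one_div, inv_mul_le_iff₀ (by positivity), mul_one]
    exact this
  have hvar : ∑ b, (m - x b) ^ 2 ≤ ∑ b, x b ^ 2 := by
    have : ∑ b, (m - x b) ^ 2 = ∑ b, x b ^ 2 - Fintype.card β * m ^ 2 := by
      have e : ∀ b, (m - x b) ^ 2 = m ^ 2 - 2 * m * x b + x b ^ 2 := fun b => by ring
      simp only [e]
      rw [Finset.sum_add_distrib, Finset.sum_sub_distrib, ← Finset.mul_sum, ← hcm]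
      simp
      ring
    rw [this]
    have : 0 ≤ Fintype.card β * m ^ 2 := by positivity
    linarith
  have hsec : ∑ b, (σ * (m - x b)) ^ 2 ≤ Fintype.card β * (θ / t ^ 2) := by
    simp only [mul_pow, hσ2]
    rw [← Finset.mul_sum, one_div, inv_mul_le_iff₀ (by positivity)]
    refine hvar.trans (h2.trans (le_of_eq ?_))
    field_simp
  have h4 := sum_exp_sum_le _ k _ (sum_exp_le_of_centred _ h0 h1 hsec)
  simp only [← Finset.mul_sum] at h4
  rw [mul_div_assoc]
  exact h4

/-- The Monte Carlo error of truncated values, controlled by a variable `E` whose mean is bounded: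
the logarithm of `E` dominates the error. -/
theorem exists_exp_control [Nonempty β] (g : β → 𝕜) {k : ℕ} (hk : 1 ≤ k) {t θ : ℝ} (ht : 0 < t)
    (h : ∑ b, cappedSq t (g b) ≤ 4 * θ * Fintype.card β) :
    ∃ E : (Fin k → β) → ℝ, (∀ J, 0 < E J ∧
        ‖(Fintype.card β : 𝕜)⁻¹ * ∑ b, trunc t (g b) - (k : 𝕜)⁻¹ * ∑ l, trunc t (g (J l))‖ ≤
          4 * t / k * Real.log (E J)) ∧
      ∑ J, E J ≤ (Fintype.card β : ℝ) ^ k * (4 * Real.exp (k * θ / t ^ 2)) := by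
  have hk0 : (0 : ℝ) < k := by exact_mod_cast hk
  have hkk : (k : 𝕜) ≠ 0 := by
    have : k ≠ 0 := by omega
    exact_mod_cast this
  set lam : ℝ := 1 / (2 * t) with hlam
  have hlam0 : 0 < lam := by positivity
  set u : β → ℝ := fun b => RCLike.re (trunc t (g b)) with hu
  set v : β → ℝ := fun b => RCLike.im (trunc t (g b)) with hv
  have hut : ∀ b, |u b| ≤ t := fun b =>
    (RCLike.abs_re_le_norm _).trans (norm_trunc_le ht.le _)
  have hvt : ∀ b, |v b| ≤ t := fun b =>
    (RCLike.abs_im_le_norm _).trans (norm_trunc_le ht.le _)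
  have hu2 : ∑ b, u b ^ 2 ≤ 4 * θ * Fintype.card β := le_trans (Finset.sum_le_sum fun b _ => by
    rw [← sq_abs]
    exact (pow_le_pow_left₀ (abs_nonneg _) (RCLike.abs_re_le_norm _) 2).trans
      (norm_trunc_sq_le t (g b))) h
  have hv2 : ∑ b, v b ^ 2 ≤ 4 * θ * Fintype.card β := le_trans (Finset.sum_le_sum fun b _ => by
    rw [← sq_abs]
    exact (pow_le_pow_left₀ (abs_nonneg _) (RCLike.abs_im_le_norm _) 2).trans
      (norm_trunc_sq_le t (g b))) h
  let D : (β → ℝ) → (Fin k → β) → ℝ := fun x J =>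
    ∑ l, ((Fintype.card β : ℝ)⁻¹ * (∑ b, x b) - x (J l))
  refine ⟨fun J => Real.exp (lam * D u J) + Real.exp (-lam * D u J) +
    (Real.exp (lam * D v J) + Real.exp (-lam * D v J)), fun J => ⟨by positivity, ?_⟩, ?_⟩
  · set E := Real.exp (lam * D u J) + Real.exp (-lam * D u J) +
      (Real.exp (lam * D v J) + Real.exp (-lam * D v J)) with hE
    have hlog : ∀ y, Real.exp y ≤ E → y ≤ Real.log E := fun y hy => by
      have := Real.log_le_log (Real.exp_pos y) hy
      rwa [Real.log_exp] at this
    have e1 := Real.exp_pos (lam * D u J)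
    have e2 := Real.exp_pos (-lam * D u J)
    have e3 := Real.exp_pos (lam * D v J)
    have e4 := Real.exp_pos (-lam * D v J)
    have hDu : lam * |D u J| ≤ Real.log E := by
      rw [← abs_of_pos hlam0, ← abs_mul, abs_le', ← neg_mul]
      exact ⟨hlog _ (by linarith), hlog _ (by linarith)⟩
    have hDv : lam * |D v J| ≤ Real.log E := by
      rw [← abs_of_pos hlam0, ← abs_mul, abs_le', ← neg_mul]
      exact ⟨hlog _ (by linarith), hlog _ (by linarith)⟩
    set z : 𝕜 := ∑ l, ((Fintype.card β : 𝕜)⁻¹ * ∑ b, trunc t (g b) - trunc t (g (J l))) with hz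
    have hcast : ((Fintype.card β : ℕ) : 𝕜)⁻¹ = (((Fintype.card β : ℝ)⁻¹ : ℝ) : 𝕜) := by
      push_cast; rfl
    have hzre : RCLike.re z = D u J := by
      rw [hz, map_sum]
      refine Finset.sum_congr rfl fun l _ => ?_
      rw [map_sub, hcast, RCLike.re_ofReal_mul, map_sum]
    have hzim : RCLike.im z = D v J := by
      rw [hz, map_sum]
      refine Finset.sum_congr rfl fun l _ => ?_
      rw [map_sub, hcast, RCLike.im_ofReal_mul, map_sum]
    have hzn := norm_le_abs_re_add_abs_im z
    rw [hzre, hzim] at hzn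
    have e5 : (Fintype.card β : 𝕜)⁻¹ * ∑ b, trunc t (g b) -
        (k : 𝕜)⁻¹ * ∑ l, trunc t (g (J l)) = (k : 𝕜)⁻¹ * z := by
      rw [hz, Finset.sum_sub_distrib, Finset.sum_const, Finset.card_univ, Fintype.card_fin,
        nsmul_eq_mul, mul_sub, inv_mul_cancel_left₀ hkk]
    rw [e5, norm_mul, norm_inv, RCLike.norm_natCast, mul_comm (4 * t / (k : ℝ)), mul_div_assoc',
      inv_mul_eq_div]
    gcongr
    have e6 : lam * ‖z‖ ≤ 2 * Real.log E := by
      calc lam * ‖z‖ ≤ lam * (|D u J| + |D v J|) := by gcongr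
        _ ≤ 2 * Real.log E := by rw [mul_add]; linarith
    rw [hlam, one_div, inv_mul_le_iff₀ (by positivity)] at e6
    linarith
  · have hl1 : |lam| = 1 / (2 * t) := abs_of_pos hlam0
    have hl2 : |(-lam)| = 1 / (2 * t) := by rw [abs_neg, hl1]
    have b1 := sum_exp_sum_le_of_second_moment u ht hut hu2 k hl1
    have b2 := sum_exp_sum_le_of_second_moment u ht hut hu2 k hl2
    have b3 := sum_exp_sum_le_of_second_moment v ht hvt hv2 k hl1
    have b4 := sum_exp_sum_le_of_second_moment v ht hvt hv2 k hl2
    rw [Finset.sum_add_distrib, Finset.sum_add_distrib, Finset.sum_add_distrib]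
    linarith

/-- The bias of the truncation, by Hölder's inequality and Chebyshev's bound for the number of
truncated values. -/
theorem card_mul_bias_rpow_le [Nonempty β] (g : β → 𝕜) {t θ p : ℝ} (ht : 0 < t) (hp : 1 ≤ p)
    (h : ∑ b, cappedSq t (g b) ≤ 4 * θ * Fintype.card β) :
    (Fintype.card β : ℝ) * ‖(Fintype.card β : 𝕜)⁻¹ * ∑ b, g b -
        (Fintype.card β : 𝕜)⁻¹ * ∑ b, trunc t (g b)‖ ^ p ≤
      (4 * θ / t ^ 2) ^ (p - 1) * ∑ b, ‖g b‖ ^ p := by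
  have hc : (0 : ℝ) < Fintype.card β := by exact_mod_cast Fintype.card_pos
  set S : Finset β := Finset.univ.filter fun b => t < ‖g b‖ with hS
  have hcard : (S.card : ℝ) ≤ 4 * θ / t ^ 2 * Fintype.card β := by
    have h1 : S.card * t ^ 2 ≤ ∑ b, cappedSq t (g b) := by
      calc S.card * t ^ 2 = ∑ _b ∈ S, t ^ 2 := by simp
        _ ≤ ∑ b ∈ S, cappedSq t (g b) := Finset.sum_le_sum fun b hb => by
            have : t < ‖g b‖ := (Finset.mem_filter.1 hb).2
            exact le_min (by gcongr) le_rfl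
        _ ≤ _ := Finset.sum_le_sum_of_subset_of_nonneg (Finset.subset_univ _)
            fun b _ _ => cappedSq_nonneg _ _
    rw [div_mul_eq_mul_div, le_div_iff₀ (by positivity)]
    exact h1.trans h
  have hdiff : ‖(Fintype.card β : 𝕜)⁻¹ * ∑ b, g b -
      (Fintype.card β : 𝕜)⁻¹ * ∑ b, trunc t (g b)‖ ≤ (Fintype.card β : ℝ)⁻¹ * ∑ b ∈ S, ‖g b‖ := by
    rw [← mul_sub, ← Finset.sum_sub_distrib, norm_mul, norm_inv, RCLike.norm_natCast]
    gcongr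
    refine (norm_sum_le _ _).trans (le_of_eq ?_)
    rw [hS, Finset.sum_filter]
    refine Finset.sum_congr rfl fun b _ => ?_
    unfold trunc
    by_cases hb : ‖g b‖ ≤ t
    · simp [hb]
    · simp [hb, not_le.1 hb]
  have hholder := Real.rpow_sum_le_const_mul_sum_rpow S (fun b => ‖g b‖) hp
  simp only [abs_norm] at hholder
  have hsub : ∑ b ∈ S, ‖g b‖ ^ p ≤ ∑ b, ‖g b‖ ^ p :=
    Finset.sum_le_sum_of_subset_of_nonneg (Finset.subset_univ _) fun b _ _ => by positivity
  have hθ : 0 ≤ 4 * θ / t ^ 2 := by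
    by_contra hneg
    have : 4 * θ / t ^ 2 * Fintype.card β < 0 := mul_neg_of_neg_of_pos (not_le.1 hneg) hc
    have h0 : (0 : ℝ) ≤ S.card := by positivity
    linarith
  calc (Fintype.card β : ℝ) * ‖(Fintype.card β : 𝕜)⁻¹ * ∑ b, g b -
        (Fintype.card β : 𝕜)⁻¹ * ∑ b, trunc t (g b)‖ ^ p
      ≤ (Fintype.card β : ℝ) * ((Fintype.card β : ℝ)⁻¹ * ∑ b ∈ S, ‖g b‖) ^ p := by gcongr
    _ = (Fintype.card β : ℝ) ^ (1 - p) * (∑ b ∈ S, ‖g b‖) ^ p := by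
        rw [Real.mul_rpow (by positivity) (Finset.sum_nonneg fun _ _ => norm_nonneg _),
          Real.inv_rpow hc.le, ← Real.rpow_neg hc.le, ← mul_assoc, sub_eq_add_neg,
          Real.rpow_add hc, Real.rpow_one]
    _ ≤ (Fintype.card β : ℝ) ^ (1 - p) * ((4 * θ / t ^ 2 * Fintype.card β) ^ (p - 1) *
          ∑ b, ‖g b‖ ^ p) := by
        gcongr
        refine hholder.trans ?_
        have : 0 ≤ ∑ b ∈ S, ‖g b‖ ^ p := Finset.sum_nonneg fun _ _ => by positivity
        have hp' : 0 ≤ p - 1 := by linarith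
        gcongr
    _ = (4 * θ / t ^ 2) ^ (p - 1) * ∑ b, ‖g b‖ ^ p := by
        rw [Real.mul_rpow hθ hc.le, show 1 - p = -(p - 1) by ring, Real.rpow_neg hc.le]
        have : (Fintype.card β : ℝ) ^ (p - 1) ≠ 0 := (Real.rpow_pos_of_pos hc _).ne'
        field_simp

end TruncatedMonteCarlo

/-! ### The adaptive upper bound -/

section AdaptiveUpperBound

variable {𝕜 : Type} [RCLike 𝕜] {p q : ℝ≥0∞} [Fact (1 ≤ p)] [Fact (1 ≤ q)]

theorem sum_norm_sq_le_of_ball (hp2 : 2 < p) (hp : p ≠ ∞) {N₁ N₂ : ℕ} (hN₁ : 1 ≤ N₁)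
    (hN₂ : 1 ≤ N₂) (f : Metric.closedBall (0 : LSpace 𝕜 p (Fin N₁ × Fin N₂)) 1) :
    ∑ i, ∑ j, ‖f.1 (i, j)‖ ^ 2 ≤ 2 * N₁ * N₂ := by
  have hP2 : 2 < p.toReal := by
    simpa using (ENNReal.toReal_lt_toReal (by norm_num) hp).2 hp2
  have h1 : ∀ x : ℝ, 0 ≤ x → x ^ 2 ≤ 1 + x ^ p.toReal := by
    intro x hx
    have hxp : 0 ≤ x ^ p.toReal := by positivity
    rcases le_total x 1 with h | h
    · have : x ^ 2 ≤ 1 := pow_le_one₀ hx h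
      linarith
    · have := Real.rpow_le_rpow_of_exponent_le h hP2.le
      rw [Real.rpow_two] at this
      linarith
  have h2 := sum_norm_rpow_le_of_ball hp hN₁ hN₂ f
  calc ∑ i, ∑ j, ‖f.1 (i, j)‖ ^ 2 ≤ ∑ i, ∑ j, (1 + ‖f.1 (i, j)‖ ^ p.toReal) :=
        Finset.sum_le_sum fun i _ => Finset.sum_le_sum fun j _ => h1 _ (norm_nonneg _)
    _ = N₁ * N₂ + ∑ i, ∑ j, ‖f.1 (i, j)‖ ^ p.toReal := by
        simp [Finset.sum_add_distrib]
    _ ≤ _ := by linarith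

theorem norm_mean_le_of_ball (hp : p ≠ ∞) {N₁ N₂ : ℕ} (hN₁ : 1 ≤ N₁)
    (hN₂ : 1 ≤ N₂) (f : Metric.closedBall (0 : LSpace 𝕜 p (Fin N₁ × Fin N₂)) 1) (i : Fin N₁) :
    ‖(Fintype.card (Fin N₂) : 𝕜)⁻¹ * ∑ j, f.1 (i, j)‖ ≤ 1 + N₁ := by
  have hN2 : (0 : ℝ) < N₂ := by exact_mod_cast hN₂
  have hp1 : 1 ≤ p.toReal := LSpace.one_le_toReal Fact.out hp
  have : Nonempty (Fin N₂) := ⟨⟨0, hN₂⟩⟩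
  have h1 := card_mul_norm_mean_rpow_le (fun j => f.1 (i, j)) hp1
  have h2 : ∑ j, ‖f.1 (i, j)‖ ^ p.toReal ≤ N₁ * N₂ :=
    (Finset.single_le_sum (f := fun i => ∑ j, ‖f.1 (i, j)‖ ^ p.toReal)
      (fun i _ => Finset.sum_nonneg fun j _ => by positivity) (Finset.mem_univ i)).trans
      (sum_norm_rpow_le_of_ball hp hN₁ hN₂ f)
  set x := ‖(Fintype.card (Fin N₂) : 𝕜)⁻¹ * ∑ j, f.1 (i, j)‖ with hx
  have h3 : x ^ p.toReal ≤ N₁ := by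
    have h4 := h1.trans h2
    rw [Fintype.card_fin, mul_comm] at h4
    exact le_of_mul_le_mul_right h4 hN2
  have hN0 : (0 : ℝ) ≤ N₁ := by positivity
  rcases le_total x 1 with h | h
  · linarith
  · have := Real.rpow_le_rpow_of_exponent_le h hp1
    rw [Real.rpow_one] at this
    linarith

/-- The error of the adaptive algorithm with `k` samples per row, truncation level `t`, which reads
completely those rows whose sampled mean of `min(|f|², t²)` exceeds `θ`. -/
theorem eRan_le_of_params (hp2 : 2 < p) (hpq : p < q) {n N₁ N₂ k : ℕ} (hN₁ : 1 ≤ N₁)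
    (hN₂ : 1 ≤ N₂) (hk : 1 ≤ k) {t θ : ℝ} (ht : 0 < t) (hθ : 0 < θ)
    (hcost : (N₁ * k + 2 * N₁ * N₂ / θ : ℝ) ≤ n) :
    (meanProblem 𝕜 p q (Fin N₁) (Fin N₂)).eRan n ≤ ENNReal.ofReal
      (4 * t / k * (Real.log (4 * N₁ * Real.exp (k * θ / t ^ 2)) + 1) +
        N₁ * (t + (1 + N₁)) * Real.exp (-(k * θ / t ^ 2)) +
        (N₁ : ℝ) ^ ((p⁻¹).toReal - (q⁻¹).toReal) * (4 * θ / t ^ 2) ^ (1 - (p⁻¹).toReal)) := by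
  have hp : p ≠ ∞ := hpq.ne_top
  have hq1 : 1 ≤ q := Fact.out
  have hP2 : 2 < p.toReal := by
    simpa using (ENNReal.toReal_lt_toReal (by norm_num) hp).2 hp2
  have hP0 : 0 < p.toReal := by linarith
  have hFin₁ : Nonempty (Fin N₁) := ⟨⟨0, hN₁⟩⟩
  have hFin₂ : Nonempty (Fin N₂) := ⟨⟨0, hN₂⟩⟩
  have hN : (0 : ℝ) < N₁ := by exact_mod_cast hN₁
  have hN2 : (0 : ℝ) < N₂ := by exact_mod_cast hN₂
  have hN1' : (1 : ℝ) ≤ N₁ := by exact_mod_cast hN₁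
  have hk0 : (0 : ℝ) < k := by exact_mod_cast hk
  have ht2 : 0 < t ^ 2 := by positivity
  set c : ℝ := (N₂ : ℝ) ^ k with hc
  have hcΩ : (Fintype.card (Fin k → Fin N₂) : ℝ) = c := by simp [hc]
  have hc0 : 0 < c := by positivity
  choose A _ hA using fun J : Fin k → Fin N₂ =>
    exists_sampleAlg (𝕜 := 𝕜) (p := p) (q := q) hN₁ hN₂ J
      (fun y => Finset.univ.filter fun i => k * θ < ∑ l, cappedSq t (y i l))
      fun y => (k : 𝕜)⁻¹ * ∑ l, trunc t (y l)
  have hcard : (unifRanAlg A).card ≤ n := by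
    refine unifRanAlg_card_le _ (fun J f => (hA J f).1) fun f => ?_
    have h1 : ∀ J : Fin k → Fin N₂, ((N₁ * k + (Finset.univ.filter fun i =>
        k * θ < ∑ l, cappedSq t (f.1 (i, J l))).card * N₂ : ℕ) : ℝ) = N₁ * k + N₂ *
        ∑ i, (if k * θ < ∑ l, cappedSq t (f.1 (i, J l)) then 1 else 0 : ℝ) := by
      intro J
      rw [Finset.card_filter]
      push_cast
      ring
    rw [Finset.sum_congr rfl fun J _ => h1 J, Finset.sum_add_distrib, Finset.sum_const,
      Finset.card_univ, nsmul_eq_mul, ← Finset.mul_sum, Finset.sum_comm, Finset.mul_sum, hcΩ]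
    have h2 := Finset.sum_le_sum fun i (_ : i ∈ (Finset.univ : Finset (Fin N₁))) =>
      card_selected_le (fun j => f.1 (i, j)) hk t hθ
    simp only [Fintype.card_fin] at h2
    rw [← Finset.mul_sum (a := (N₂ : ℝ) ^ k), ← Finset.sum_div] at h2
    have h3 : ∑ i, ∑ j, cappedSq t (f.1 (i, j)) ≤ 2 * N₁ * N₂ :=
      (Finset.sum_le_sum fun i _ => Finset.sum_le_sum fun j _ => cappedSq_le_norm_sq _ _).trans
        (sum_norm_sq_le_of_ball hp2 hp hN₁ hN₂ f)
    calc c * (N₁ * k) + _ ≤ c * (N₁ * k) +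
          c * ((∑ i, ∑ j, cappedSq t (f.1 (i, j))) / θ) := by gcongr
      _ ≤ c * (N₁ * k) + c * (2 * N₁ * N₂ / θ) := by gcongr
      _ = c * (N₁ * k + 2 * N₁ * N₂ / θ) := by ring
      _ ≤ c * n := by gcongr
  refine (iInf₂_le_of_le (unifRanAlg A) hcard (unifRanAlg_error_le fun f => ?_))
  rw [hcΩ]
  -- the rows with moderate truncated second moment, and the quantities in the error estimate
  set tame : Fin N₁ → Prop := fun i => ∑ j, cappedSq t (f.1 (i, j)) ≤ 4 * θ * N₂ with htame
  set sel : (Fin k → Fin N₂) → Fin N₁ → Prop := fun J i =>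
    k * θ < ∑ l, cappedSq t (f.1 (i, J l)) with hsel
  set μ : Fin N₁ → 𝕜 := fun i => (Fintype.card (Fin N₂) : 𝕜)⁻¹ * ∑ j, f.1 (i, j) with hμ
  set ν : Fin N₁ → 𝕜 := fun i => (Fintype.card (Fin N₂) : 𝕜)⁻¹ * ∑ j, trunc t (f.1 (i, j)) with hν
  set est : (Fin k → Fin N₂) → Fin N₁ → 𝕜 := fun J i => (k : 𝕜)⁻¹ * ∑ l, trunc t (f.1 (i, J l))
    with hest
  have hE : ∀ i, ∃ E : (Fin k → Fin N₂) → ℝ, (∀ J, 0 ≤ E J) ∧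
      (tame i → ∀ J, 0 < E J ∧ ‖ν i - est J i‖ ≤ 4 * t / k * Real.log (E J)) ∧
      ∑ J, E J ≤ c * (4 * Real.exp (k * θ / t ^ 2)) := by
    intro i
    by_cases hi : tame i
    · obtain ⟨E, hE1, hE2⟩ := exists_exp_control (fun j => f.1 (i, j)) hk ht (θ := θ)
        (by rw [Fintype.card_fin]; exact hi)
      rw [Fintype.card_fin] at hE2
      exact ⟨E, fun J => (hE1 J).1.le, fun _ => hE1, hE2⟩
    · exact ⟨fun _ => 0, fun _ => le_rfl, fun h => absurd h hi, by simp; positivity⟩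
  choose E hE0 hElog hEsum using hE
  set y₀ : ℝ := 4 * N₁ * Real.exp (k * θ / t ^ 2) with hy₀
  have hy₀1 : 1 ≤ y₀ := by
    have : 1 ≤ Real.exp (k * θ / t ^ 2) := Real.one_le_exp (by positivity)
    rw [hy₀]; nlinarith
  have hlogy : 0 ≤ Real.log y₀ := Real.log_nonneg hy₀1
  -- `Z` dominates the fluctuation in all tame rows simultaneously, at the cost of `log N₁`
  set Z : (Fin k → Fin N₂) → ℝ := fun J =>
    4 * t / k * (Real.log y₀ + (∑ i, E i J) / y₀) with hZ
  have hEs : ∀ J, 0 ≤ ∑ i, E i J := fun J => Finset.sum_nonneg fun i _ => hE0 i J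
  have hZ0 : ∀ J, 0 ≤ Z J := fun J => by
    have := hEs J
    positivity
  have hZtame : ∀ J i, tame i → ‖ν i - est J i‖ ≤ Z J := by
    intro J i hi
    obtain ⟨hpos, hle⟩ := hElog i hi J
    refine hle.trans ?_
    refine mul_le_mul_of_nonneg_left ?_ (by positivity)
    have h1 : E i J ≤ ∑ i, E i J := Finset.single_le_sum (f := fun i => E i J)
      (fun i _ => hE0 i J) (Finset.mem_univ i)
    have h2 : 0 < ∑ i, E i J := hpos.trans_le h1
    -- the tangent of the logarithm at `y₀`
    have h3 := Real.log_le_sub_one_of_pos (div_pos h2 (by linarith : 0 < y₀))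
    rw [Real.log_div h2.ne' (by linarith : 0 < y₀).ne'] at h3
    have h4 := Real.log_le_log hpos h1
    linarith
  have hZsum : ∑ J, Z J ≤ c * (4 * t / k * (Real.log y₀ + 1)) := by
    rw [hZ, ← Finset.mul_sum, Finset.sum_add_distrib, Finset.sum_const, Finset.card_univ,
      nsmul_eq_mul, hcΩ, ← Finset.sum_div, Finset.sum_comm, mul_left_comm]
    refine mul_le_mul_of_nonneg_left ?_ (by positivity)
    have h1 : ∑ i, ∑ J, E i J ≤ c * y₀ := by
      refine (Finset.sum_le_sum fun i _ => hEsum i).trans (le_of_eq ?_)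
      rw [Finset.sum_const, Finset.card_univ, Fintype.card_fin, nsmul_eq_mul, hy₀]; ring
    have h2 : (∑ i, ∑ J, E i J) / y₀ ≤ c := by
      rw [div_le_iff₀ (by linarith)]; exact h1
    linarith
  classical
  -- `R` bounds the error in the rows which are not tame but have not been selected
  set R : (Fin k → Fin N₂) → ℝ := fun J =>
    ∑ i, if tame i then 0 else (t + (1 + N₁)) * (if sel J i then 0 else 1) with hR
  have hRterm : ∀ J i, 0 ≤ (if tame i then 0 else (t + (1 + N₁)) * (if sel J i then 0 else 1) : ℝ) :=
    fun J i => by split_ifs <;> positivity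
  have hR0 : ∀ J, 0 ≤ R J := fun J => Finset.sum_nonneg fun i _ => hRterm J i
  have hRsum : ∑ J, R J ≤ c * (N₁ * (t + (1 + N₁)) * Real.exp (-(k * θ / t ^ 2))) := by
    rw [hR, Finset.sum_comm]
    calc _ ≤ ∑ _i : Fin N₁, (t + (1 + N₁)) * (c * Real.exp (-(k * θ / t ^ 2))) := by
          refine Finset.sum_le_sum fun i _ => ?_
          by_cases hi : tame i
          · simp only [hi, if_true, Finset.sum_const_zero]
            positivity
          · simp only [hi, if_false]
            rw [← Finset.mul_sum]
            gcongr
            have := card_overlooked_le (fun j => f.1 (i, j)) k (θ := θ) ht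
              (by rw [Fintype.card_fin]; exact not_le.1 hi)
            rw [Fintype.card_fin] at this
            exact this
      _ = _ := by
          rw [Finset.sum_const, Finset.card_univ, Fintype.card_fin, nsmul_eq_mul]; ring
  -- the bias is measured in the `p`-norm: unlike `Z` and `R`, it is not small in every single row
  set b : (Fin k → Fin N₂) → LSpace 𝕜 q (Fin N₁) := fun J i =>
    if tame i ∧ ¬ sel J i then μ i - ν i else 0 with hb
  have hbnorm : ∀ J, ‖b J‖ ≤ (N₁ : ℝ) ^ ((p⁻¹).toReal - (q⁻¹).toReal) *
      (4 * θ / t ^ 2) ^ (1 - (p⁻¹).toReal) := by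
    intro J
    have h1 := LSpace.norm_le_rpow_sum hq1 hP0 (fun hq => ENNReal.toReal_mono hq hpq.le) (b J)
    have h2 : ∀ i, N₂ * ‖b J i‖ ^ p.toReal ≤
        (4 * θ / t ^ 2) ^ (p.toReal - 1) * ∑ j, ‖f.1 (i, j)‖ ^ p.toReal := by
      intro i
      have h0 : 0 ≤ ∑ j, ‖f.1 (i, j)‖ ^ p.toReal := Finset.sum_nonneg fun j _ => by positivity
      by_cases hi : tame i ∧ ¬ sel J i
      · have := card_mul_bias_rpow_le (fun j => f.1 (i, j)) (θ := θ) (p := p.toReal) ht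
          (by linarith) (by rw [Fintype.card_fin]; exact hi.1)
        have e : b J i = μ i - ν i := if_pos hi
        rw [e]
        rw [Fintype.card_fin] at this
        simpa [hμ, hν] using this
      · have e : b J i = 0 := if_neg hi
        rw [e, norm_zero, Real.zero_rpow hP0.ne', mul_zero]
        positivity
    have h3 : ∑ i, ‖b J i‖ ^ p.toReal ≤ (4 * θ / t ^ 2) ^ (p.toReal - 1) * N₁ := by
      have h4 := Finset.sum_le_sum fun i (_ : i ∈ (Finset.univ : Finset (Fin N₁))) => h2 i
      rw [← Finset.mul_sum, ← Finset.mul_sum] at h4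
      refine le_of_mul_le_mul_left (h4.trans ?_) hN2
      calc _ ≤ (4 * θ / t ^ 2) ^ (p.toReal - 1) * (N₁ * N₂) := by
            gcongr
            exact sum_norm_rpow_le_of_ball hp hN₁ hN₂ f
        _ = _ := by ring
    rw [Fintype.card_fin] at h1
    refine h1.trans ?_
    calc (N₁ : ℝ) ^ (-(q⁻¹).toReal) * (∑ i, ‖b J i‖ ^ p.toReal) ^ (1 / p.toReal)
        ≤ (N₁ : ℝ) ^ (-(q⁻¹).toReal) *
          ((4 * θ / t ^ 2) ^ (p.toReal - 1) * N₁) ^ (1 / p.toReal) := by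
          have : 0 ≤ ∑ i, ‖b J i‖ ^ p.toReal := Finset.sum_nonneg fun i _ => by positivity
          gcongr
      _ = _ := by
          rw [Real.mul_rpow (by positivity) hN.le, ← Real.rpow_mul (by positivity), sub_eq_add_neg
            (p⁻¹).toReal, Real.rpow_add hN, ENNReal.toReal_inv p, one_div]
          have : (p.toReal - 1) * p.toReal⁻¹ = 1 - p.toReal⁻¹ := by field_simp
          rw [this]; ring
  have hpt : ∀ J, ‖(meanProblem 𝕜 p q (Fin N₁) (Fin N₂)).S f - (A J).out f‖ ≤ Z J + R J +
      (N₁ : ℝ) ^ ((p⁻¹).toReal - (q⁻¹).toReal) * (4 * θ / t ^ 2) ^ (1 - (p⁻¹).toReal) := by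
    intro J
    have h1 : ‖(meanProblem 𝕜 p q (Fin N₁) (Fin N₂)).S f - (A J).out f - b J‖ ≤ Z J + R J := by
      refine LSpace.norm_le_of_forall_le hq1 (add_nonneg (hZ0 J) (hR0 J)) fun i => ?_
      change ‖(meanProblem 𝕜 p q (Fin N₁) (Fin N₂)).S f i - (A J).out f i - b J i‖ ≤ _
      rw [(hA J f).2]
      simp only [Finset.mem_filter, Finset.mem_univ, true_and]
      by_cases hs : sel J i
      · have e : b J i = 0 := if_neg (fun h => h.2 hs)
        rw [if_pos hs, e, sub_self, sub_zero, norm_zero]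
        exact add_nonneg (hZ0 J) (hR0 J)
      · rw [if_neg hs]
        change ‖μ i - est J i - b J i‖ ≤ _
        by_cases hi : tame i
        · have e : b J i = μ i - ν i := if_pos ⟨hi, hs⟩
          rw [e]
          have e2 : μ i - est J i - (μ i - ν i) = ν i - est J i := by ring
          rw [e2]
          linarith [hZtame J i hi, hR0 J]
        · have e : b J i = 0 := if_neg (fun h => hi h.1)
          rw [e, sub_zero]
          have h2 : ‖est J i‖ ≤ t := by
            simp only [hest]
            rw [norm_mul, norm_inv, RCLike.norm_natCast, inv_mul_le_iff₀ hk0]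
            refine (norm_sum_le _ _).trans ?_
            refine (Finset.sum_le_sum fun l _ => norm_trunc_le ht.le _).trans (le_of_eq ?_)
            simp
          have h3 : ‖μ i‖ ≤ 1 + N₁ := norm_mean_le_of_ball hp hN₁ hN₂ f i
          have h4 : t + (1 + N₁) ≤ R J := by
            have := Finset.single_le_sum (f := fun i => (if tame i then 0 else
              (t + (1 + N₁)) * (if sel J i then 0 else 1) : ℝ)) (fun i _ => hRterm J i)
              (Finset.mem_univ i)
            simp only [hi, hs, if_false, mul_one] at this
            exact this
          linarith [norm_sub_le (μ i) (est J i), hZ0 J]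
    have h5 := norm_add_le ((meanProblem 𝕜 p q (Fin N₁) (Fin N₂)).S f - (A J).out f - b J) (b J)
    rw [sub_add_cancel] at h5
    linarith [hbnorm J]
  refine (Finset.sum_le_sum fun J _ => hpt J).trans ?_
  rw [Finset.sum_add_distrib, Finset.sum_add_distrib, Finset.sum_const, Finset.card_univ,
    nsmul_eq_mul, hcΩ]
  linarith

end AdaptiveUpperBound

/-! ### The exponent of the gap -/

section Exponents

variable {p q : ℝ≥0∞}

theorem toReal_inv_bounds (hp2 : 2 < p) (hpq : p < q) :
    0 ≤ (q⁻¹).toReal ∧ (q⁻¹).toReal < (p⁻¹).toReal ∧ (p⁻¹).toReal < 1 / 2 := by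
  have hp0 : p ≠ 0 := (zero_lt_two.trans hp2).ne'
  refine ⟨ENNReal.toReal_nonneg, ?_, ?_⟩
  · exact (ENNReal.toReal_lt_toReal (ENNReal.inv_ne_top.2 (zero_lt_two.trans (hp2.trans hpq)).ne')
      (ENNReal.inv_ne_top.2 hp0)).2 (ENNReal.inv_lt_inv.2 hpq)
  · have h := (ENNReal.toReal_lt_toReal (ENNReal.inv_ne_top.2 hp0)
      (ENNReal.inv_ne_top.2 two_ne_zero)).2 (ENNReal.inv_lt_inv.2 hp2)
    rw [ENNReal.toReal_inv 2] at h
    simpa using h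

/-- With `α = 1/2 - 1/p` and `β = 1/p - 1/q` the exponent is `α β / (α + β)`, at most `(α + β) / 4`,
and `α + β = 1/2 - 1/q ≤ 1/2`. -/
theorem gapExponent_spec (hp2 : 2 < p) (hpq : p < q) :
    0 < gapExponent p q ∧ gapExponent p q ≤ 1 / 8 ∧
      (gapExponent p q = 1 / 8 ↔ p = 4 ∧ q = ∞) := by
  obtain ⟨hv, huv, hu⟩ := toReal_inv_bounds hp2 hpq
  have hu4 : (p⁻¹).toReal = 1 / 4 ↔ p = 4 := by
    constructor
    · intro h
      rw [ENNReal.toReal_inv, one_div, inv_inj] at h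
      rw [← ENNReal.ofReal_toReal hpq.ne_top, h]
      norm_num
    · rintro rfl
      rw [ENNReal.toReal_inv]
      norm_num
  have hv0 : (q⁻¹).toReal = 0 ↔ q = ∞ := by
    rw [ENNReal.toReal_eq_zero_iff, ENNReal.inv_eq_zero, ENNReal.inv_eq_top]
    have : q ≠ 0 := (zero_lt_two.trans (hp2.trans hpq)).ne'
    tauto
  rw [← hu4, ← hv0]
  unfold gapExponent
  set u := (p⁻¹).toReal
  set v := (q⁻¹).toReal
  have hd : 0 < 1 / 2 - v := by linarith
  refine ⟨div_pos (mul_pos (by linarith) (by linarith)) hd, ?_, ?_⟩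
  · rw [div_le_iff₀ hd]
    nlinarith [sq_nonneg ((1 / 2 - u) - (u - v))]
  · rw [div_eq_iff hd.ne']
    constructor
    · intro h
      -- `α β ≤ (α + β)² / 4` with `α + β = 1 / 2 - v`
      have h1 : v = 0 := by nlinarith [sq_nonneg ((1 / 2 - u) - (u - v))]
      refine ⟨?_, h1⟩
      rw [h1] at h
      have h2 : (u - 1 / 4) ^ 2 = 0 := by linarith
      have h3 := pow_eq_zero_iff (two_ne_zero) |>.1 h2
      linarith
    · rintro ⟨h1, h2⟩
      rw [h1, h2]; norm_num

theorem one_le_logb_two {n : ℕ} (hn : 1 ≤ n) : 1 ≤ Real.logb 2 ((n : ℝ) + 1) := by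
  have hn1 : (1 : ℝ) ≤ n := by exact_mod_cast hn
  rw [Real.le_logb_iff_rpow_le (by norm_num) (by linarith)]
  norm_num
  linarith

end Exponents

/-! ### The gap between adaptive and non-adaptive errors -/

section Gap

variable {p q : ℝ≥0∞} [Fact (1 ≤ p)] [Fact (1 ≤ q)]

set_option maxHeartbeats 1000000 in
/-- The upper bound for the adaptive error in the critical regime `N₁^(1/p - 1/q) ≤ m^(1/2 - 1/p)`,
`m = n / N₁`, with the smallest admissible number `N₂` of columns. -/
theorem exists_eRan_le (𝕜 : Type) [RCLike 𝕜] (hp2 : 2 < p) (hpq : p < q) {c₀ : ℝ} (hc₀ : 0 < c₀)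
    (hc₁ : c₀ ≤ 1) : ∃ C : ℝ, 0 < C ∧ ∀ n N₁ : ℕ, 1 ≤ N₁ → N₁ ≤ n →
      (N₁ : ℝ) ^ ((p⁻¹).toReal - (q⁻¹).toReal) ≤ ((n : ℝ) / N₁) ^ (1 / 2 - (p⁻¹).toReal) →
      (meanProblem 𝕜 p q (Fin N₁) (Fin (⌊(n : ℝ) / (c₀ * N₁)⌋₊ + 1))).eRan n ≤
        ENNReal.ofReal (C * Real.logb 2 ((n : ℝ) + 1) ^ (1 - (p⁻¹).toReal) *
          ((n : ℝ) / N₁) ^ (-(1 / 2) : ℝ)) := by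
  obtain ⟨hv, huv, hu⟩ := toReal_inv_bounds hp2 hpq
  obtain ⟨C, hC, hnon⟩ := exists_eRanNon_le 𝕜 hp2 hpq
  -- with `N₂ ≤ 2 n / (c₀ N₁)` the expected cost `2 N₁ N₂ / θ` of the selected rows is at most `n / 2`
  set θ : ℝ := 8 / c₀ with hθ
  have hθ0 : 0 < θ := by positivity
  refine ⟨2 * C + 57 * √θ + 49, by positivity, fun n N₁ hN₁ hn hcrit => ?_⟩
  set u := (p⁻¹).toReal with hu_def
  set L := Real.logb 2 ((n : ℝ) + 1) with hL
  have hL1 : 1 ≤ L := one_le_logb_two (hN₁.trans hn)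
  have hL0 : 0 < L := by linarith
  have hN : (0 : ℝ) < N₁ := by exact_mod_cast hN₁
  have hnR : (1 : ℝ) ≤ n := by exact_mod_cast hN₁.trans hn
  have hn0 : (0 : ℝ) < n := by linarith
  set m : ℝ := (n : ℝ) / N₁ with hm
  have hm1 : 1 ≤ m := by
    rw [hm, le_div_iff₀ hN, one_mul]; exact_mod_cast hn
  have hm0 : 0 < m := by linarith
  have hLu : 1 ≤ L ^ (1 - u) := Real.one_le_rpow hL1 (by linarith)
  set μ := m ^ (-(1 / 2) : ℝ) with hμ
  have hμ0 : 0 < μ := by positivity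
  set N₂ := ⌊(n : ℝ) / (c₀ * N₁)⌋₊ + 1 with hN₂
  rcases lt_or_ge n (2 * N₁) with hcase | hcase
  · -- fewer than two samples per row: the non-adaptive bound suffices
    refine (le_iInf fun A => le_iInf₂ fun _ hA => iInf₂_le_of_le A hA le_rfl :
      (meanProblem 𝕜 p q (Fin N₁) (Fin N₂)).eRan n ≤
        (meanProblem 𝕜 p q (Fin N₁) (Fin N₂)).eRanNon n).trans
      ((hnon n N₁ N₂ hN₁ (Nat.le_add_left 1 _) hn).trans (ENNReal.ofReal_le_ofReal ?_))
    have hm2 : m ≤ 2 := by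
      rw [hm, div_le_iff₀ hN]; exact_mod_cast hcase.le
    have h1 : m ^ (1 / 2 - u) ≤ 2 := by
      calc m ^ (1 / 2 - u) ≤ m ^ (1 : ℝ) :=
            Real.rpow_le_rpow_of_exponent_le hm1 (by linarith)
        _ ≤ 2 := by rw [Real.rpow_one]; exact hm2
    have h2 : C * (N₁ : ℝ) ^ (u - (q⁻¹).toReal) ≤ 2 * C := by
      nlinarith [hcrit.trans h1]
    have h3 : 0 ≤ √θ := Real.sqrt_nonneg _
    calc C * (N₁ : ℝ) ^ (u - (q⁻¹).toReal) * μ ≤ 2 * C * μ := by gcongr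
      _ ≤ (2 * C + 57 * √θ + 49) * L ^ (1 - u) * μ := by
        refine mul_le_mul_of_nonneg_right ?_ hμ0.le
        calc 2 * C ≤ (2 * C + 57 * √θ + 49) * 1 := by linarith
          _ ≤ _ := by gcongr
  · -- half of the budget goes to the samples, the other half to the rows which are read completely
    set k := n / (2 * N₁) with hk
    have hk1 : 1 ≤ k := Nat.div_pos hcase (by omega)
    have hk0 : (0 : ℝ) < k := by exact_mod_cast hk1
    have hkn : 2 * N₁ * k ≤ n := Nat.mul_div_le _ _
    have hkn' : (2 * N₁ * k : ℝ) ≤ n := by exact_mod_cast hkn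
    have hmk : m ≤ 4 * k := by
      have h8 : n < 2 * N₁ * (k + 1) := Nat.lt_mul_div_succ _ (by omega)
      have h9 : n ≤ N₁ * (4 * k) := by
        refine h8.le.trans ?_
        calc 2 * N₁ * (k + 1) ≤ 2 * N₁ * (k + k) := Nat.mul_le_mul_left _ (by omega)
          _ = _ := by ring
      rw [hm, div_le_iff₀ hN, mul_comm]
      exact_mod_cast h9
    have hLk : L / k ≤ 4 * L / m := by
      rw [div_le_div_iff₀ hk0 hm0]
      nlinarith
    have hN₂n : (N₂ : ℝ) ≤ 2 * n / (c₀ * N₁) := by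
      have h1 : (⌊(n : ℝ) / (c₀ * N₁)⌋₊ : ℝ) ≤ (n : ℝ) / (c₀ * N₁) :=
        Nat.floor_le (by positivity)
      have h2 : 1 ≤ (n : ℝ) / (c₀ * N₁) := by
        rw [le_div_iff₀ (by positivity), one_mul]
        rw [hm, le_div_iff₀ hN, one_mul] at hm1
        nlinarith
      rw [hN₂, mul_div_assoc]
      push_cast
      linarith
    -- this level makes the probability `exp (-k θ / t²)` of overlooking a row at most `n⁻³`
    set t : ℝ := √(θ * k / (3 * L)) with ht
    have ht0 : 0 < t := Real.sqrt_pos.2 (by positivity)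
    have htsq : t ^ 2 = θ * k / (3 * L) := Real.sq_sqrt (by positivity)
    have hcost : (N₁ * k + 2 * N₁ * N₂ / θ : ℝ) ≤ n := by
      have h1 : (2 * N₁ * N₂ / θ : ℝ) ≤ 2 * N₁ * (2 * n / (c₀ * N₁)) / θ := by gcongr
      have h2 : 2 * N₁ * (2 * n / (c₀ * N₁)) / θ = n / 2 := by
        rw [hθ]; field_simp; norm_num
      linarith
    have key := eRan_le_of_params (𝕜 := 𝕜) (p := p) (q := q) (n := n) (N₁ := N₁) (N₂ := N₂)
      hp2 hpq hN₁ (Nat.le_add_left 1 _) hk1 ht0 hθ0 hcost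
    refine key.trans (ENNReal.ofReal_le_ofReal ?_)
    have e1 : k * θ / t ^ 2 = 3 * L := by rw [htsq]; field_simp
    have e2 : 4 * θ / t ^ 2 = 12 * (L / k) := by rw [htsq]; field_simp; norm_num
    rw [e1, e2]
    have hlogL : Real.log ((n : ℝ) + 1) ≤ L := by
      rw [hL, Real.logb, le_div_iff₀ (Real.log_pos (by norm_num))]
      have h1 : 0 ≤ Real.log ((n : ℝ) + 1) := Real.log_nonneg (by linarith)
      have h2 : Real.log 2 ≤ 1 := by linarith [Real.log_two_lt_d9]
      nlinarith
    -- the fluctuation of the truncated Monte Carlo estimates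
    have t1 : 4 * t / k * (Real.log (4 * N₁ * Real.exp (3 * L)) + 1) ≤
        56 * √θ * L ^ (1 - u) * μ := by
      have h1 : Real.log (4 * N₁ * Real.exp (3 * L)) ≤ 6 * L := by
        rw [Real.log_mul (by positivity) (Real.exp_pos _).ne', Real.log_exp,
          Real.log_mul (by norm_num) hN.ne']
        have h2 : Real.log 4 ≤ 2 := by
          rw [show (4 : ℝ) = 2 ^ 2 by norm_num, Real.log_pow]
          push_cast
          linarith [Real.log_two_lt_d9]
        have h3 : Real.log N₁ ≤ Real.log ((n : ℝ) + 1) := by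
          apply Real.log_le_log hN
          have : (N₁ : ℝ) ≤ n := by exact_mod_cast hn
          linarith
        linarith
      have h4 : 4 * t / k * (Real.log (4 * N₁ * Real.exp (3 * L)) + 1) ≤ 4 * t / k * (7 * L) := by
        gcongr; linarith
      have h5 : t * L / k ≤ √θ * √(L / k) := by
        rw [← Real.sqrt_mul hθ0.le]
        refine Real.le_sqrt_of_sq_le ?_
        have e3 : (t * L / k) ^ 2 = θ * (L / k) / 3 := by
          rw [div_pow, mul_pow, htsq]; field_simp
        rw [e3]
        have : 0 < θ * (L / k) := by positivity
        linarith
      have h6 : √(L / k) ≤ 2 * (L ^ (1 - u) * μ) := by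
        calc √(L / k) ≤ √(4 * L / m) := Real.sqrt_le_sqrt hLk
          _ = 2 * (L ^ (1 / 2 : ℝ) * μ) := by
            rw [mul_div_assoc, Real.sqrt_mul (by norm_num), show (4 : ℝ) = 2 ^ 2 by norm_num,
              Real.sqrt_sq (by norm_num), Real.sqrt_eq_rpow, Real.div_rpow hL0.le hm0.le, hμ,
              Real.rpow_neg hm0.le]
            rfl
          _ ≤ _ := by
            gcongr
            linarith
      calc _ ≤ 4 * t / k * (7 * L) := h4
        _ = 28 * (t * L / k) := by ring
        _ ≤ 28 * (√θ * (2 * (L ^ (1 - u) * μ))) := by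
          gcongr
          exact h5.trans (by gcongr)
        _ = _ := by ring
    -- the rows which have been overlooked
    have t2 : N₁ * (t + (1 + N₁)) * Real.exp (-(3 * L)) ≤ (√θ + 1) * L ^ (1 - u) * μ := by
      have hNn : (N₁ : ℝ) ≤ n + 1 := by
        have : (N₁ : ℝ) ≤ n := by exact_mod_cast hn
        linarith
      have h1 : Real.exp (-(3 * L)) ≤ ((n : ℝ) + 1) ^ (-3 : ℝ) := by
        rw [Real.rpow_def_of_pos (by positivity)]
        apply Real.exp_le_exp.2
        linarith
      have hkn2 : (k : ℝ) ≤ n := by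
        exact_mod_cast Nat.div_le_self _ _
      have h2 : t ≤ √θ * (n + 1) := by
        have e3 : (n : ℝ) + 1 = √((n + 1) ^ 2) := (Real.sqrt_sq (by positivity)).symm
        rw [e3, ← Real.sqrt_mul hθ0.le]
        apply Real.sqrt_le_sqrt
        rw [mul_div_assoc]
        gcongr
        calc (k : ℝ) / (3 * L) ≤ k := div_le_self hk0.le (by linarith)
          _ ≤ ((n : ℝ) + 1) ^ 2 := by nlinarith
      have h3 : 1 + (N₁ : ℝ) ≤ n + 1 := by
        have : (N₁ : ℝ) ≤ n := by exact_mod_cast hn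
        linarith
      have h4 : ((n : ℝ) + 1) ^ (-3 : ℝ) = (((n : ℝ) + 1) ^ 3)⁻¹ := by
        rw [Real.rpow_neg (by positivity)]
        norm_cast
      have h5 : ((n : ℝ) + 1)⁻¹ ≤ μ := by
        rw [hμ, ← Real.rpow_neg_one]
        have hmn : m ≤ (n : ℝ) + 1 := by
          rw [hm, div_le_iff₀ hN]
          have : (1 : ℝ) ≤ N₁ := by exact_mod_cast hN₁
          nlinarith
        calc ((n : ℝ) + 1) ^ (-1 : ℝ) ≤ ((n : ℝ) + 1) ^ (-(1 / 2) : ℝ) :=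
              Real.rpow_le_rpow_of_exponent_le (by linarith) (by norm_num)
          _ ≤ m ^ (-(1 / 2) : ℝ) := Real.rpow_le_rpow_of_nonpos hm0 hmn (by norm_num)
      calc N₁ * (t + (1 + N₁)) * Real.exp (-(3 * L))
          ≤ (n + 1) * (√θ * (n + 1) + (n + 1)) * (((n : ℝ) + 1) ^ 3)⁻¹ := by
            rw [← h4]
            gcongr
        _ = (√θ + 1) * ((n : ℝ) + 1)⁻¹ := by field_simp
        _ ≤ (√θ + 1) * μ := by gcongr
        _ ≤ _ := by
          gcongr
          exact le_mul_of_one_le_right (by positivity) hLu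
    -- the bias of the truncation
    have t3 : (N₁ : ℝ) ^ (u - (q⁻¹).toReal) * (12 * (L / k)) ^ (1 - u) ≤
        48 * L ^ (1 - u) * μ := by
      have h1 : 12 * (L / k) ≤ 48 * (L * m⁻¹) := by
        have : 4 * L / m = 4 * (L * m⁻¹) := by rw [mul_div_assoc, div_eq_mul_inv]
        linarith
      have h48 : (48 : ℝ) ^ (1 - u) ≤ 48 := by
        calc (48 : ℝ) ^ (1 - u) ≤ (48 : ℝ) ^ (1 : ℝ) :=
              Real.rpow_le_rpow_of_exponent_le (by norm_num) (by linarith)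
          _ = 48 := Real.rpow_one _
      have hexp : m ^ (1 / 2 - u) * m⁻¹ ^ (1 - u) = μ := by
        rw [Real.inv_rpow hm0.le, ← Real.rpow_neg hm0.le, ← Real.rpow_add hm0, hμ]
        congr 1; ring
      calc (N₁ : ℝ) ^ (u - (q⁻¹).toReal) * (12 * (L / k)) ^ (1 - u)
          ≤ m ^ (1 / 2 - u) * (48 * (L * m⁻¹)) ^ (1 - u) := by
            have : 0 ≤ 1 - u := by linarith
            gcongr
        _ = 48 ^ (1 - u) * L ^ (1 - u) * (m ^ (1 / 2 - u) * m⁻¹ ^ (1 - u)) := by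
            rw [Real.mul_rpow (by norm_num) (by positivity),
              Real.mul_rpow hL0.le (by positivity)]
            ring
        _ ≤ _ := by
            rw [hexp]
            gcongr
    have t4 : 0 ≤ 2 * C * (L ^ (1 - u) * μ) := by positivity
    linarith

/-- The upper bound for the gap: the ratio to the spike bound is `m^(1/2 - 1/p)`, the ratio to the
sign bound is `N₁^(1/p - 1/q)`, where `m = n / N₁`, and one of the two is at most `n^κ`. -/
theorem adaptionGap_le (𝕜 : Type) [RCLike 𝕜] (hp2 : 2 < p) (hpq : p < q) {c₀ : ℝ}
    (hc₁ : c₀ ≤ 1 / 8) : ∃ C : ℝ, 0 < C ∧ ∀ n : ℕ, 1 ≤ n →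
      adaptionGap 𝕜 p q c₀ n ≤ ENNReal.ofReal (C * (n : ℝ) ^ gapExponent p q) := by
  obtain ⟨hv, huv, hu⟩ := toReal_inv_bounds hp2 hpq
  obtain ⟨C, hC, hnon⟩ := exists_eRanNon_le 𝕜 hp2 hpq
  refine ⟨18 * C, by positivity, fun n hn1 => ?_⟩
  have hn0 : (0 : ℝ) < n := by exact_mod_cast hn1
  refine iSup_le fun N₁ => iSup_le fun N₂ => iSup_le fun ⟨hN₁n, hlt⟩ => ?_
  have hN₁ : 1 ≤ N₁ := by
    rcases Nat.eq_zero_or_pos N₁ with h | h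
    · rw [h] at hlt; simp at hlt; linarith
    · exact h
  have hN₂ : 1 ≤ N₂ := by
    rcases Nat.eq_zero_or_pos N₂ with h | h
    · rw [h] at hlt; simp at hlt; linarith
    · exact h
  have h8 : 8 * n ≤ N₁ * N₂ := by
    have h : (8 * n : ℝ) ≤ N₁ * N₂ := by
      have : c₀ * N₁ * N₂ ≤ 1 / 8 * (N₁ * N₂) := by
        rw [mul_assoc]; gcongr
      linarith
    exact_mod_cast h
  have hN : (0 : ℝ) < N₁ := by exact_mod_cast hN₁
  have hspike := le_eRan_spike (𝕜 := 𝕜) (p := p) (q := q) hpq.ne_top hN₁ hN₁n h8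
  have hsign := le_eRan_signs (𝕜 := 𝕜) (p := p) (q := q) hpq.ne_top hN₁ hN₁n h8
  have hupper := hnon n N₁ N₂ hN₁ hN₂ hN₁n
  refine ENNReal.div_le_of_le_mul (hupper.trans ?_)
  set κ := gapExponent p q with hκ
  set u := (p⁻¹).toReal with hu_def
  set v := (q⁻¹).toReal with hv_def
  set m : ℝ := (n : ℝ) / N₁ with hm
  have hm0 : 0 < m := by positivity
  have hα : 0 < 1 / 2 - u := by linarith
  have hβ : 0 < u - v := by linarith
  rcases le_or_gt (m ^ (1 / 2 - u)) ((n : ℝ) ^ κ) with h | h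
  · refine le_trans ?_ (mul_le_mul_right hspike _)
    rw [← ENNReal.ofReal_mul (by positivity)]
    refine ENNReal.ofReal_le_ofReal ?_
    have e : m ^ (-(1 / 2) : ℝ) = m ^ (1 / 2 - u) * m ^ (-(1 - u)) := by
      rw [← Real.rpow_add hm0]; congr 1; ring
    rw [e]
    calc C * (N₁ : ℝ) ^ (u - v) * (m ^ (1 / 2 - u) * m ^ (-(1 - u)))
        ≤ C * (N₁ : ℝ) ^ (u - v) * ((n : ℝ) ^ κ * m ^ (-(1 - u))) := by gcongr
      _ ≤ 18 * (1 / 12) * (C * (N₁ : ℝ) ^ (u - v) * ((n : ℝ) ^ κ * m ^ (-(1 - u)))) :=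
          le_mul_of_one_le_left (by positivity) (by norm_num)
      _ = _ := by ring
  · refine le_trans ?_ (mul_le_mul_right hsign _)
    rw [← ENNReal.ofReal_mul (by positivity)]
    refine ENNReal.ofReal_le_ofReal ?_
    -- here `m ≥ n^(κ / α)`, and therefore `N₁ = n / m ≤ n^(κ / β)`
    have hNβ : (N₁ : ℝ) ^ (u - v) ≤ (n : ℝ) ^ κ := by
      have e1 : (N₁ : ℝ) = n / m := by rw [hm]; field_simp
      have h1 : (n : ℝ) ^ (κ / (1 / 2 - u)) ≤ m := by
        have h2 := Real.rpow_le_rpow (by positivity) h.le (by positivity : 0 ≤ (1 / 2 - u)⁻¹)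
        rwa [← Real.rpow_mul hn0.le, Real.rpow_rpow_inv hm0.le hα.ne', ← div_eq_mul_inv] at h2
      have h3 : (N₁ : ℝ) ≤ (n : ℝ) ^ (1 - κ / (1 / 2 - u)) := by
        rw [e1, Real.rpow_sub hn0, Real.rpow_one]
        gcongr
      calc (N₁ : ℝ) ^ (u - v) ≤ ((n : ℝ) ^ (1 - κ / (1 / 2 - u))) ^ (u - v) := by gcongr
        _ = (n : ℝ) ^ κ := by
          rw [← Real.rpow_mul hn0.le]
          congr 1
          rw [hκ]
          unfold gapExponent
          rw [← hu_def, ← hv_def]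
          have hsum : 1 / 2 - v = (1 / 2 - u) + (u - v) := by ring
          rw [hsum]
          generalize 1 / 2 - u = α at hα
          generalize u - v = β at hβ
          have hαβ : α + β ≠ 0 := (add_pos hα hβ).ne'
          field_simp
          ring
    calc C * (N₁ : ℝ) ^ (u - v) * m ^ (-(1 / 2) : ℝ)
        ≤ C * (n : ℝ) ^ κ * m ^ (-(1 / 2) : ℝ) := by gcongr
      _ = _ := by ring

/-- The lower bound for the gap, attained up to the logarithm at `N₁ ≈ n^x`, where `x` makes
`N₁^(1/p - 1/q)` and `(n / N₁)^(1/2 - 1/p)` equal. -/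
theorem le_adaptionGap (𝕜 : Type) [RCLike 𝕜] (hp2 : 2 < p) (hpq : p < q) {c₀ : ℝ} (hc₀ : 0 < c₀)
    (hc₁ : c₀ ≤ 1 / 8) : ∃ c : ℝ, 0 < c ∧ ∀ n : ℕ, 1 ≤ n →
      ENNReal.ofReal (c * (n : ℝ) ^ gapExponent p q *
        Real.logb 2 ((n : ℝ) + 1) ^ (-(1 - (p⁻¹).toReal))) ≤ adaptionGap 𝕜 p q c₀ n := by
  obtain ⟨hv, huv, hu⟩ := toReal_inv_bounds hp2 hpq
  obtain ⟨C, hC, hran⟩ := exists_eRan_le 𝕜 hp2 hpq hc₀ (by linarith)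
  refine ⟨1 / (36 * C), by positivity, fun n hn1 => ?_⟩
  have hnR : (1 : ℝ) ≤ n := by exact_mod_cast hn1
  have hn0 : (0 : ℝ) < n := by linarith
  set κ := gapExponent p q with hκ
  set u := (p⁻¹).toReal with hu_def
  set v := (q⁻¹).toReal with hv_def
  have hd : 0 < 1 / 2 - v := by linarith
  have hα : 0 < 1 / 2 - u := by linarith
  have hβ : 0 < u - v := by linarith
  -- `N₁ ≈ n^x` balances the two parts of the adaptive error
  set x : ℝ := (1 / 2 - u) / (1 / 2 - v) with hx
  have hx0 : 0 < x := by positivity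
  have hx1 : x ≤ 1 := by rw [hx, div_le_one hd]; linarith
  have hxβ : x * (u - v) = κ := by
    rw [hκ, hx]; unfold gapExponent; rw [← hu_def, ← hv_def]; ring
  have hxα : (1 - x) * (1 / 2 - u) = κ := by
    have h1 : 1 - x = (u - v) / (1 / 2 - v) := by
      rw [hx, eq_div_iff hd.ne', sub_mul, div_mul_cancel₀ _ hd.ne']; ring
    rw [h1, hκ]; unfold gapExponent; rw [← hu_def, ← hv_def]; ring
  have hnx : 1 ≤ (n : ℝ) ^ x := Real.one_le_rpow hnR hx0.le
  set N₁ := ⌊(n : ℝ) ^ x⌋₊ with hN₁def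
  have hN₁ : 1 ≤ N₁ := Nat.le_floor (by exact_mod_cast hnx)
  have hN : (0 : ℝ) < N₁ := by exact_mod_cast hN₁
  have hN₁le : (N₁ : ℝ) ≤ (n : ℝ) ^ x := Nat.floor_le (by positivity)
  have hN₁ge : (n : ℝ) ^ x ≤ 2 * N₁ := by
    have h1 := (Nat.lt_floor_add_one ((n : ℝ) ^ x)).le
    have h2 : (1 : ℝ) ≤ N₁ := by exact_mod_cast hN₁
    linarith
  have hN₁n : N₁ ≤ n := by
    have h1 : (n : ℝ) ^ x ≤ n := by
      calc (n : ℝ) ^ x ≤ (n : ℝ) ^ (1 : ℝ) := Real.rpow_le_rpow_of_exponent_le hnR hx1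
        _ = n := Real.rpow_one _
    exact_mod_cast hN₁le.trans h1
  set m : ℝ := (n : ℝ) / N₁ with hm
  have hm0 : 0 < m := by positivity
  have hcrit : (N₁ : ℝ) ^ (u - v) ≤ m ^ (1 / 2 - u) := by
    have h1 : (n : ℝ) ^ (1 - x) ≤ m := by
      rw [Real.rpow_sub hn0, Real.rpow_one, hm]
      gcongr
    calc (N₁ : ℝ) ^ (u - v) ≤ ((n : ℝ) ^ x) ^ (u - v) := by gcongr
      _ = (n : ℝ) ^ κ := by rw [← Real.rpow_mul hn0.le, hxβ]
      _ = ((n : ℝ) ^ (1 - x)) ^ (1 / 2 - u) := by rw [← Real.rpow_mul hn0.le, hxα]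
      _ ≤ _ := by gcongr
  -- the smallest `N₂` with `n < c₀ N₁ N₂`: reading a whole row costs no more than `≈ n / N₁`
  set N₂ := ⌊(n : ℝ) / (c₀ * N₁)⌋₊ + 1 with hN₂
  have hlt : (n : ℝ) < c₀ * N₁ * N₂ := by
    have h1 := Nat.lt_floor_add_one ((n : ℝ) / (c₀ * N₁))
    rw [div_lt_iff₀ (by positivity), mul_comm] at h1
    rw [hN₂]
    exact_mod_cast h1
  have h8 : 8 * n ≤ N₁ * N₂ := by
    have h : (8 * n : ℝ) ≤ N₁ * N₂ := by
      have : c₀ * N₁ * N₂ ≤ 1 / 8 * (N₁ * N₂) := by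
        rw [mul_assoc]; gcongr
      linarith
    exact_mod_cast h
  have hup := hran n N₁ hN₁ hN₁n hcrit
  have hlow := le_eRanNon_signs (𝕜 := 𝕜) (p := p) (q := q) hpq.ne_top hN₁ hN₁n h8
  refine le_trans ?_ (le_iSup_of_le N₁ (le_iSup_of_le N₂ (le_iSup_of_le ⟨hN₁n, hlt⟩ le_rfl)))
  set L := Real.logb 2 ((n : ℝ) + 1) with hL
  have hL0 : 0 < L := lt_of_lt_of_le one_pos (one_le_logb_two hn1)
  have hlow0 : (0 : ℝ) < 1 / 18 * (N₁ : ℝ) ^ (u - v) * m ^ (-(1 / 2) : ℝ) := by positivity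
  rw [ENNReal.le_div_iff_mul_le (Or.inr ((ENNReal.ofReal_pos.2 hlow0).trans_le hlow).ne')
    (Or.inl (hup.trans_lt ENNReal.ofReal_lt_top).ne)]
  refine le_trans (mul_le_mul_right hup _) (le_trans ?_ hlow)
  rw [← ENNReal.ofReal_mul (by positivity)]
  refine ENNReal.ofReal_le_ofReal ?_
  have hκN : (n : ℝ) ^ κ ≤ 2 * (N₁ : ℝ) ^ (u - v) := by
    have h2 : (2 : ℝ) ^ (u - v) ≤ 2 := by
      calc (2 : ℝ) ^ (u - v) ≤ (2 : ℝ) ^ (1 : ℝ) :=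
            Real.rpow_le_rpow_of_exponent_le (by norm_num) (by linarith)
        _ = 2 := Real.rpow_one _
    calc (n : ℝ) ^ κ = ((n : ℝ) ^ x) ^ (u - v) := by rw [← Real.rpow_mul hn0.le, hxβ]
      _ ≤ (2 * N₁) ^ (u - v) := by gcongr
      _ = 2 ^ (u - v) * (N₁ : ℝ) ^ (u - v) := Real.mul_rpow (by norm_num) hN.le
      _ ≤ _ := by gcongr
  have hLL : L ^ (-(1 - u)) * L ^ (1 - u) = 1 := by
    rw [← Real.rpow_add hL0]; simp
  calc 1 / (36 * C) * (n : ℝ) ^ κ * L ^ (-(1 - u)) * (C * L ^ (1 - u) * m ^ (-(1 / 2) : ℝ))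
      = 1 / 36 * (n : ℝ) ^ κ * (L ^ (-(1 - u)) * L ^ (1 - u)) * m ^ (-(1 / 2) : ℝ) := by
        field_simp
    _ = 1 / 36 * (n : ℝ) ^ κ * m ^ (-(1 / 2) : ℝ) := by rw [hLL, mul_one]
    _ ≤ 1 / 36 * (2 * (N₁ : ℝ) ^ (u - v)) * m ^ (-(1 / 2) : ℝ) := by gcongr
    _ = _ := by ring

theorem meanProblem_isLinear (𝕜 : Type) [RCLike 𝕜] {N₁ N₂ : ℕ} (hN₁ : 1 ≤ N₁) (hN₂ : 1 ≤ N₂) :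
    (meanProblem 𝕜 p q (Fin N₁) (Fin N₂)).IsLinear 𝕜 := by
  refine ⟨⟨0, by simp⟩, ⟨_, ⟨(⟨0, hN₁⟩, ⟨0, hN₂⟩), rfl⟩⟩, balanced_closedBall_zero, ?_, ?_, ?_⟩
  · intro f hf g hg a b ha hb hab
    rw [mem_closedBall_zero_iff] at hf hg ⊢
    calc ‖(a : 𝕜) • f + (b : 𝕜) • g‖ ≤ ‖(a : 𝕜) • f‖ + ‖(b : 𝕜) • g‖ := norm_add_le _ _
      _ = a * ‖f‖ + b * ‖g‖ := by
        rw [norm_smul, norm_smul, RCLike.norm_ofReal, RCLike.norm_ofReal, abs_of_nonneg ha,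
          abs_of_nonneg hb]
      _ ≤ a * 1 + b * 1 := by gcongr
      _ = 1 := by rw [mul_one, mul_one, hab]
  · refine ⟨{ toFun := fun f i => (Fintype.card (Fin N₂) : 𝕜)⁻¹ * ∑ j, f (i, j)
              map_add' := fun f g => ?_
              map_smul' := fun a f => ?_ }, fun f => rfl⟩
    · funext i
      change (Fintype.card (Fin N₂) : 𝕜)⁻¹ * ∑ j, (f (i, j) + g (i, j)) =
        (Fintype.card (Fin N₂) : 𝕜)⁻¹ * ∑ j, f (i, j) +
          (Fintype.card (Fin N₂) : 𝕜)⁻¹ * ∑ j, g (i, j)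
      rw [Finset.sum_add_distrib, mul_add]
    · funext i
      change (Fintype.card (Fin N₂) : 𝕜)⁻¹ * ∑ j, a * f (i, j) =
        a * ((Fintype.card (Fin N₂) : 𝕜)⁻¹ * ∑ j, f (i, j))
      rw [← Finset.mul_sum, mul_left_comm]
  · rintro l ⟨x, rfl⟩
    exact ⟨{ toFun := fun f => f x, map_add' := fun _ _ => rfl, map_smul' := fun _ _ => rfl },
      fun f => rfl⟩

/-- Powers of `n` outgrow the logarithmic factor in the lower bound for the gap. -/
theorem exists_lt_rpow_mul_logb {κ c C s : ℝ} (hκ : 0 < κ) (hc : 0 < c) (hC : 0 < C) (hs : s ≤ 1) :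
    ∃ n : ℕ, 1 ≤ n ∧ C < c * (n : ℝ) ^ κ * Real.logb 2 ((n : ℝ) + 1) ^ (-s) := by
  have hlog2 : 0 < Real.log 2 := Real.log_pos (by norm_num)
  have hlittle := (isLittleO_log_rpow_atTop hκ).def
    (show 0 < c * Real.log 2 / (2 * C * 2 ^ κ) by positivity)
  have htend : Filter.Tendsto (fun n : ℕ => (n : ℝ) + 1) Filter.atTop Filter.atTop :=
    Filter.tendsto_atTop_add_const_right _ _ tendsto_natCast_atTop_atTop
  obtain ⟨n, h1, hn⟩ := ((htend.eventually hlittle).and (Filter.eventually_ge_atTop 1)).exists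
  have hnR : (1 : ℝ) ≤ n := by exact_mod_cast hn
  have hn0 : (0 : ℝ) < n := by linarith
  refine ⟨n, hn, ?_⟩
  set L := Real.logb 2 ((n : ℝ) + 1) with hL
  have hL1 : 1 ≤ L := one_le_logb_two hn
  have hL0 : 0 < L := by linarith
  rw [Real.norm_of_nonneg (Real.log_nonneg (by linarith)), Real.norm_of_nonneg (by positivity)] at h1
  have h2 : ((n : ℝ) + 1) ^ κ ≤ 2 ^ κ * (n : ℝ) ^ κ := by
    rw [← Real.mul_rpow (by norm_num) hn0.le]
    gcongr
    linarith
  have h3 : Real.log ((n : ℝ) + 1) = L * Real.log 2 := by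
    rw [hL, Real.logb]; field_simp
  have h4 : C * L < c * (n : ℝ) ^ κ := by
    have h5 : L * Real.log 2 ≤ c * Real.log 2 / (2 * C * 2 ^ κ) * (2 ^ κ * (n : ℝ) ^ κ) := by
      rw [← h3]
      exact h1.trans (by gcongr)
    have h6 : c * Real.log 2 / (2 * C * 2 ^ κ) * (2 ^ κ * (n : ℝ) ^ κ) =
        c * (n : ℝ) ^ κ / (2 * C) * Real.log 2 := by field_simp
    rw [h6] at h5
    have h7 := le_of_mul_le_mul_right h5 hlog2
    rw [le_div_iff₀ (by positivity)] at h7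
    have : 0 < L * C := by positivity
    linarith
  have h8 : L⁻¹ ≤ L ^ (-s) := by
    rw [← Real.rpow_neg_one]
    exact Real.rpow_le_rpow_of_exponent_le hL1 (by linarith)
  calc C = C * L * L⁻¹ := by field_simp
    _ < c * (n : ℝ) ^ κ * L⁻¹ := by gcongr
    _ ≤ _ := by gcongr

end Gap

theorem corollary4p6 (𝕜 : Type) [RCLike 𝕜] :
    -- the two-sided estimate of the gap
    (∀ (p q : ℝ≥0∞) [Fact (1 ≤ p)] [Fact (1 ≤ q)], 2 < p → p < q →
      ∃ cbar : ℝ, 0 < cbar ∧ cbar < 1 ∧ ∀ c₀ : ℝ, 0 < c₀ → c₀ ≤ cbar →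
        ∃ c₁ c₂ : ℝ, 0 < c₁ ∧ 0 < c₂ ∧ ∀ n : ℕ, 1 ≤ n →
          ENNReal.ofReal (c₁ * (n : ℝ) ^ gapExponent p q *
              Real.logb 2 ((n : ℝ) + 1) ^ (-(1 - (p⁻¹).toReal))) ≤ adaptionGap 𝕜 p q c₀ n ∧
          adaptionGap 𝕜 p q c₀ n ≤ ENNReal.ofReal (c₂ * (n : ℝ) ^ gapExponent p q)) ∧
    -- the exponent is positive, and largest exactly at `p = 4`, `q = ∞`
    (∀ p q : ℝ≥0∞, 2 < p → p < q →
      0 < gapExponent p q ∧ gapExponent p q ≤ 1 / 8 ∧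
        (gapExponent p q = 1 / 8 ↔ p = 4 ∧ q = ∞)) ∧
    -- for linear problems the two errors cannot be compared up to a constant factor
    (∀ (p q : ℝ≥0∞) [Fact (1 ≤ p)] [Fact (1 ≤ q)], 2 < p → p < q →
      ∀ C : ℝ, 0 < C → ∃ n N₁ N₂ : ℕ, 1 ≤ n ∧ 1 ≤ N₁ ∧ 1 ≤ N₂ ∧
        (meanProblem 𝕜 p q (Fin N₁) (Fin N₂)).IsLinear 𝕜 ∧
        ENNReal.ofReal C * (meanProblem 𝕜 p q (Fin N₁) (Fin N₂)).eRan n <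
          (meanProblem 𝕜 p q (Fin N₁) (Fin N₂)).eRanNon n) := by
  have main : ∀ (p q : ℝ≥0∞) [Fact (1 ≤ p)] [Fact (1 ≤ q)], 2 < p → p < q →
      ∃ cbar : ℝ, 0 < cbar ∧ cbar < 1 ∧ ∀ c₀ : ℝ, 0 < c₀ → c₀ ≤ cbar →
        ∃ c₁ c₂ : ℝ, 0 < c₁ ∧ 0 < c₂ ∧ ∀ n : ℕ, 1 ≤ n →
          ENNReal.ofReal (c₁ * (n : ℝ) ^ gapExponent p q *
              Real.logb 2 ((n : ℝ) + 1) ^ (-(1 - (p⁻¹).toReal))) ≤ adaptionGap 𝕜 p q c₀ n ∧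
          adaptionGap 𝕜 p q c₀ n ≤ ENNReal.ofReal (c₂ * (n : ℝ) ^ gapExponent p q) := by
    intro p q _ _ hp2 hpq
    -- the block construction in the lower bounds needs `8 n ≤ N₁ N₂`
    refine ⟨1 / 8, by norm_num, by norm_num, fun c₀ hc₀ hc₁ => ?_⟩
    obtain ⟨c₁, h₁, hlow⟩ := le_adaptionGap 𝕜 hp2 hpq hc₀ hc₁
    obtain ⟨c₂, h₂, hup⟩ := adaptionGap_le 𝕜 hp2 hpq hc₁
    exact ⟨c₁, c₂, h₁, h₂, fun n hn => ⟨hlow n hn, hup n hn⟩⟩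
  refine ⟨main, fun p q hp2 hpq => gapExponent_spec hp2 hpq, ?_⟩
  intro p q _ _ hp2 hpq C hC
  obtain ⟨cbar, hcbar, -, h⟩ := main p q hp2 hpq
  obtain ⟨c₁, c₂, hc₁, -, hgap⟩ := h cbar hcbar le_rfl
  obtain ⟨n, hn, hCn⟩ := exists_lt_rpow_mul_logb (gapExponent_spec hp2 hpq).1 hc₁ hC
    (s := 1 - (p⁻¹).toReal) (by linarith [(ENNReal.toReal_nonneg : 0 ≤ (p⁻¹).toReal)])
  have hlt : ENNReal.ofReal C < adaptionGap 𝕜 p q cbar n :=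
    lt_of_lt_of_le ((ENNReal.ofReal_lt_ofReal_iff (hC.trans hCn)).2 hCn) (hgap n hn).1
  unfold adaptionGap at hlt
  simp only [lt_iSup_iff] at hlt
  obtain ⟨N₁, N₂, ⟨-, hreg⟩, hratio⟩ := hlt
  have hn0 : (0 : ℝ) < n := by exact_mod_cast hn
  have hN₁ : 1 ≤ N₁ := by
    rcases Nat.eq_zero_or_pos N₁ with h | h
    · rw [h] at hreg; simp at hreg; linarith
    · exact h
  have hN₂ : 1 ≤ N₂ := by
    rcases Nat.eq_zero_or_pos N₂ with h | h
    · rw [h] at hreg; simp at hreg; linarith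
    · exact h
  exact ⟨n, N₁, N₂, hn, hN₁, hN₂, meanProblem_isLinear 𝕜 hN₁ hN₂, ENNReal.mul_lt_of_lt_div hratio⟩
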